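/- A *surface* is a quadruple $S=(\mathcal F,\alpha,\beta,\gamma)$ of a non-empty set $\mathcal F$ (of *flags*) and fixed-point-free involutions $\alpha,\beta,\gamma$ of $\mathcal F$ such that $\langle\alpha,\beta,\gamma\rangle$ acts transitively on $\mathcal F$, $\alpha\beta$ has only $3$-cycles and $\alpha\gamma$ has only $2$-cycles. Its vertices, edges and faces are the orbits of $\langle\beta,\gamma\rangle$, $\langle\alpha,\gamma\rangle$ and $\langle\alpha,\beta\rangle$ on $\mathcal F$. It is a *degree-$d$-surface* ($d\ge 3$) if $\beta\gamma$ has only $d$-cycles. An isomorphism of surfaces is a bijection of the flag sets that carries the three permutations of one surface to those of the other, and $S$ is *geodesic self-dual* if it is isomorphic to its geodesic dual $(\mathcal F,\alpha,\beta,\alpha\gamma)$. Let $\chi=\#\text{vertices}-\#\text{edges}+\#\text{faces}$; $S$ is *orientable* if the flags can be $2$-coloured so that $\alpha,\beta,\gamma$ all exchange the colours. A projective plane is a non-orientable surface with $\chi=1$, a torus an orientable one with $\chi=0$. The *genus* $g$ is given by $\chi=2-2g$ for orientable surfaces and, by convention, by $\chi=1-g$ for non-orientable ones (so a sphere with $g+1$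 crosscaps has genus $g$). Let $H_d=\langle a,b,c\mid a^2,b^2,c^2,(ab)^3,(ac)^2,(bc)^d,(bac)^d\rangle$ and let $\#:H_d\to H_d$ be the homomorphism with $a\mapsto a$, $b\mapsto b$, $c\mapsto ac$. Consider the following condition on a subgroup $V\le H_d$: $(\ast)$ $g^{-1}Vg\cap X=\{1\}$ for all $g\in H_d$ and all $X\in\{\langle a\rangle,\langle c\rangle,\langle ab\rangle,\langle ac\rangle,\langle bc\rangle\}$, and $\#(V)$ is conjugate to $V$ in $H_d$. There is no geodesic self-dual degree-$d$-surface for $d\in\{3,4,7\}$. For $d\in\{5,6,8,9\}$ the subgroups $V$ listed below are, without repetition, all subgroups of $H_d$ satisfying $(\ast)$ up to conjugacy, and the surfaces $(H_d/V,a,b,c)$ (left action on the cosets $gV$) are, without repetition, all geodesic self-dual degree-$d$-surfaces up to isomorphism: * $d=5$ (one): $V=\{1\}$; a projective plane with 6 vertices, 15 edges, 10 faces. * $d=6$ (two): $V=\{1\}$; a torus with 9 vertices, 27 edges, 18 faces. $V$ normal of order $3$; a torus with 3 vertices, 9 edges, 6 faces. * $d=8$ (four): $V=\{1\}$; orientable,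 42 vertices, 168 edges, 112 faces, genus 8. $V$ normal of order $2$; non-orientable, 21 vertices, 84 edges, 56 faces, genus 8. $V$ of order $7$ and index $96$; orientable, 6 vertices, 24 edges, 16 faces, genus 2. $V$ of order $14$ and index $48$; non-orientable, 3 vertices, 12 edges, 8 faces, genus 2. * $d=9$ (three): $V=\{1\}$; non-orientable, 190 vertices, 855 edges, 570 faces, genus 96. $V$ of order $5$ and index $684$; non-orientable, 38 vertices, 171 edges, 114 faces, genus 20. $V$ of order $19$ and index $180$; non-orientable, 10 vertices, 45 edges, 30 faces, genus 6. -/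

import Mathlib

universe u v

namespace GeodesicSurface

/-- A set `F` of flags with three permutations: `α` changes the vertex of a flag, `β` its edge,
`γ` its face. -/
structure FlagSystem (F : Type u) where
  α : Equiv.Perm F
  β : Equiv.Perm F
  γ : Equiv.Perm F

/-- The permutation `σ` consists only of `k`-cycles: every point lies on a cycle of length
exactly `k`. -/
def OnlyCycles {F : Type u} (σ : Equiv.Perm F) (k : ℕ) : Prop :=
  ∀ x : F, Function.minimalPeriod σ x = k

/-- `σ` is an involution that fixes no point. -/
def IsFreeInvolution {F : Type u} (σ : Equiv.Perm F) : Prop :=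
  ∀ x : F, σ (σ x) = x ∧ σ x ≠ x

namespace FlagSystem

variable {F : Type u} {G : Type v}

/-- The group generated by the three permutations. -/
def monodromy (S : FlagSystem F) : Subgroup (Equiv.Perm F) :=
  Subgroup.closure {S.α, S.β, S.γ}

/-- Combinatorial (closed, connected, triangulated) surfaces. A transitive action is understood
to be an action on a non-empty set. -/
structure IsSurface (S : FlagSystem F) : Prop where
  involution_α : IsFreeInvolution S.α
  involution_β : IsFreeInvolution S.β
  involution_γ : IsFreeInvolution S.γ
  nonempty : Nonempty F
  transitive : MulAction.IsPretransitive S.monodromy F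
  triangles : OnlyCycles (S.α * S.β) 3
  two_faces : OnlyCycles (S.α * S.γ) 2

/-- Degree-`d`-surfaces (`d ≥ 3`): every vertex is incident to exactly `d` triangles. -/
structure IsDegreeSurface (S : FlagSystem F) (d : ℕ) : Prop where
  isSurface : S.IsSurface
  three_le : 3 ≤ d
  degree : OnlyCycles (S.β * S.γ) d

/-- Vertices: orbits of `⟨β, γ⟩` on the flags. -/
def Vertices (S : FlagSystem F) : Type u :=
  MulAction.orbitRel.Quotient (Subgroup.closure {S.β, S.γ}) F

/-- Edges: orbits of `⟨α, γ⟩` on the flags. -/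
def Edges (S : FlagSystem F) : Type u :=
  MulAction.orbitRel.Quotient (Subgroup.closure {S.α, S.γ}) F

/-- Faces: orbits of `⟨α, β⟩` on the flags. -/
def Faces (S : FlagSystem F) : Type u :=
  MulAction.orbitRel.Quotient (Subgroup.closure {S.α, S.β}) F

/-- The geodesic dual. -/
def dual (S : FlagSystem F) : FlagSystem F where
  α := S.α
  β := S.β
  γ := S.α * S.γ

/-- Isomorphisms: bijections of the flags that intertwine the three permutations. -/
structure Iso (S : FlagSystem F) (T : FlagSystem G) where
  toEquiv : F ≃ G
  map_α : ∀ x, toEquiv (S.α x) = T.α (toEquiv x)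
  map_β : ∀ x, toEquiv (S.β x) = T.β (toEquiv x)
  map_γ : ∀ x, toEquiv (S.γ x) = T.γ (toEquiv x)

/-- Isomorphic to the geodesic dual. -/
def IsGeodesicSelfDual (S : FlagSystem F) : Prop :=
  Nonempty (Iso S S.dual)

/-- Orientability: the flags (the triangles of the barycentric subdivision) can be divided into
positive and negative ones such that adjacent flags always have opposite signs. -/
def IsOrientable (S : FlagSystem F) : Prop :=
  ∃ sign : F → Bool, ∀ x,
    sign (S.α x) ≠ sign x ∧ sign (S.β x) ≠ sign x ∧ sign (S.γ x) ≠ sign x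

/-- The Euler characteristic (for surfaces with finitely many flags). -/
noncomputable def eulerChar (S : FlagSystem F) : ℤ :=
  (Nat.card S.Vertices : ℤ) - Nat.card S.Edges + Nat.card S.Faces

/-- The surface has genus `g`. For orientable surfaces this is the usual genus, `χ = 2 - 2 * g`.
For non-orientable surfaces the convention is `χ = 1 - g`: a sphere with `g + 1` crosscaps has
genus `g`. -/
def HasGenus (S : FlagSystem F) (g : ℤ) : Prop :=
  (S.IsOrientable → S.eulerChar = 2 - 2 * g) ∧ (¬ S.IsOrientable → S.eulerChar = 1 - g)

/-- The closed non-orientable surface with Euler characteristic `1`. -/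
def IsProjectivePlane (S : FlagSystem F) : Prop :=
  ¬ S.IsOrientable ∧ S.eulerChar = 1

/-- The closed orientable surface with Euler characteristic `0`. -/
def IsTorus (S : FlagSystem F) : Prop :=
  S.IsOrientable ∧ S.eulerChar = 0

/-- The numbers of vertices, edges and faces. -/
def HasCounts (S : FlagSystem F) (vertices edges faces : ℕ) : Prop :=
  Nat.card S.Vertices = vertices ∧ Nat.card S.Edges = edges ∧ Nat.card S.Faces = faces

end FlagSystem

/-- Names of the three generators of the geodesic triangle group. -/
inductive Gen : Type
  | a
  | b
  | c

/-- The relators `a², b², c², (ab)³, (ac)², (bc)^d, (bac)^d`. -/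
def relators (d : ℕ) : Set (FreeGroup Gen) :=
  let a := FreeGroup.of Gen.a
  let b := FreeGroup.of Gen.b
  let c := FreeGroup.of Gen.c
  {a ^ 2, b ^ 2, c ^ 2, (a * b) ^ 3, (a * c) ^ 2, (b * c) ^ d, (b * a * c) ^ d}

/-- The geodesic triangle group `H_d`. -/
abbrev H (d : ℕ) : Type := PresentedGroup (relators d)

variable {d : ℕ}

/-- The generator `a` of `H_d`. -/
def genA (d : ℕ) : H d := PresentedGroup.of Gen.a

/-- The generator `b` of `H_d`. -/
def genB (d : ℕ) : H d := PresentedGroup.of Gen.b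

/-- The generator `c` of `H_d`. -/
def genC (d : ℕ) : H d := PresentedGroup.of Gen.c

/-- The images of the generators under the geodesic automorphism. -/
def sharpOnGen (d : ℕ) : Gen → H d
  | Gen.a => genA d
  | Gen.b => genB d
  | Gen.c => genA d * genC d

theorem sharpOnGen_relators (d : ℕ) :
    ∀ r ∈ relators d, FreeGroup.lift (sharpOnGen d) r = 1 := by
  have key : ∀ r ∈ relators d, PresentedGroup.mk (relators d) r = 1 := fun r hr =>
    PresentedGroup.one_of_mem hr
  have ha : genA d ^ 2 = 1 := key (FreeGroup.of Gen.a ^ 2) (by simp [relators])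
  have hb : genB d ^ 2 = 1 := key (FreeGroup.of Gen.b ^ 2) (by simp [relators])
  have hc : genC d ^ 2 = 1 := key (FreeGroup.of Gen.c ^ 2) (by simp [relators])
  have hab : (genA d * genB d) ^ 3 = 1 :=
    key ((FreeGroup.of Gen.a * FreeGroup.of Gen.b) ^ 3) (by simp [relators])
  have hac : (genA d * genC d) ^ 2 = 1 :=
    key ((FreeGroup.of Gen.a * FreeGroup.of Gen.c) ^ 2) (by simp [relators])
  have hbc : (genB d * genC d) ^ d = 1 :=
    key ((FreeGroup.of Gen.b * FreeGroup.of Gen.c) ^ d) (by simp [relators])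
  have hbac : (genB d * genA d * genC d) ^ d = 1 :=
    key ((FreeGroup.of Gen.b * FreeGroup.of Gen.a * FreeGroup.of Gen.c) ^ d)
      (by simp [relators])
  have haa : genA d * (genA d * genC d) = genC d := by
    rw [← mul_assoc, ← pow_two, ha, one_mul]
  intro r hr
  simp only [relators, Set.mem_insert_iff, Set.mem_singleton_iff] at hr
  rcases hr with rfl | rfl | rfl | rfl | rfl | rfl | rfl <;>
    simp only [map_pow, map_mul, FreeGroup.lift_apply_of, sharpOnGen]
  · exact ha
  · exact hb
  · exact hac
  · exact hab
  · rw [haa, hc]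
  · rw [← mul_assoc]; exact hbac
  · rw [mul_assoc, haa]; exact hbc

/-- The geodesic automorphism `# : H_d → H_d`, `a ↦ a`, `b ↦ b`, `c ↦ ac`. -/
def sharp (d : ℕ) : H d →* H d :=
  PresentedGroup.toGroup (sharpOnGen_relators d)

/-- The conjugate subgroup `g V g⁻¹`. -/
def conjugate (g : H d) (V : Subgroup (H d)) : Subgroup (H d) :=
  V.map (MulAut.conj g).toMonoidHom

/-- Conjugacy of subgroups. -/
def AreConjugate (V W : Subgroup (H d)) : Prop :=
  ∃ g : H d, conjugate g V = W

/-- The group-theoretic criterion for `V ≤ H_d`: no conjugate of `V` meets `⟨a⟩`, `⟨c⟩`, `⟨ab⟩`,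
`⟨ac⟩` or `⟨bc⟩` non-trivially, and the image of `V` under the geodesic automorphism is conjugate
to `V`. -/
def IsGeodesicSurfaceSubgroup (V : Subgroup (H d)) : Prop :=
  (∀ g : H d, ∀ x ∈ ({genA d, genC d, genA d * genB d, genA d * genC d, genB d * genC d} :
      Set (H d)), conjugate g⁻¹ V ⊓ Subgroup.zpowers x = ⊥) ∧
    AreConjugate (V.map (sharp d)) V

/-- The quadruple `(H_d / V, a, b, c)`, with `a`, `b`, `c` acting from the left on the cosets
`g V`. -/
noncomputable def cosetSystem (V : Subgroup (H d)) : FlagSystem (H d ⧸ V) where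
  α := MulAction.toPerm (genA d)
  β := MulAction.toPerm (genB d)
  γ := MulAction.toPerm (genC d)

/-- The family `V` lists, without repetition, all subgroups of `H_d` that satisfy the
group-theoretic criterion up to conjugacy, and the quadruples `(H_d / V i, a, b, c)` list, without
repetition, all geodesic self-dual degree-`d`-surfaces up to isomorphism. -/
structure IsClassification (d : ℕ) {n : ℕ} (V : Fin n → Subgroup (H d)) : Prop where
  criterion : ∀ i, IsGeodesicSurfaceSubgroup (V i)
  not_conjugate : ∀ i j, i ≠ j → ¬ AreConjugate (V i) (V j)
  all_subgroups : ∀ W : Subgroup (H d), IsGeodesicSurfaceSubgroup W → ∃ i, AreConjugate W (V i)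
  isDegreeSurface : ∀ i, (cosetSystem (V i)).IsDegreeSurface d
  isGeodesicSelfDual : ∀ i, (cosetSystem (V i)).IsGeodesicSelfDual
  not_isomorphic : ∀ i j, i ≠ j →
    ¬ Nonempty (FlagSystem.Iso (cosetSystem (V i)) (cosetSystem (V j)))
  all_surfaces : ∀ (F : Type u) (S : FlagSystem F), S.IsDegreeSurface d → S.IsGeodesicSelfDual →
    ∃ i, Nonempty (FlagSystem.Iso S (cosetSystem (V i)))

end GeodesicSurface

open GeodesicSurface

/-!
Let `S` be a geodesic self-dual degree-`d`-surface. An isomorphism with the geodesic dual turns the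
`d`-cycles of `βγ` into `d`-cycles of `β(αγ)`, so the three permutations satisfy the relations of
`H_d`, and `H_d` acts transitively on the flags. If `V` is the stabilizer of a flag, then `S` is
isomorphic to the coset system of `V`; the prescribed cycle lengths say that conjugates of `V` avoid
the non-trivial powers of `a`, `c`, `ab`, `ac`, `bc`, and self-duality says that `#(V)` is conjugate
to `V` (`FlagSystem.IsDegreeSurface.exists_subgroup`). Conversely such subgroups yield such surfaces,
provided that the elements `a`, `c`, `ab`, `ac`, `bc` of `H_d` have the orders `2`, `2`, `3`, `2`,
`d` (`Avoids.isDegreeSurface`), and isomorphism of surfaces is conjugacy of subgroups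
(`areConjugate_of_iso`, `AreConjugate.nonempty_iso`). It remains to find the subgroups
(`isClassification_of_subgroups`).

The order of `H_d` is bounded from above by coset enumeration over `⟨b, c⟩`, a dihedral group of
order at most `2 * d`. An enumeration is a list of steps, each of which deduces an entry of a table
that describes the action on the cosets; `CosetEnumeration.card_le_of_succeeds` shows that a closed
table bounds the number of cosets, and the kernel executes the steps. For `d = 3`, `4`, `7` the group
`H_d` collapses so far that it cannot act as required. For `d = 5`, `6`, `8`, `9` explicit
permutations on `6`, `9`, `42`, `20` points generate groups whose orders reach the upper bounds, so
that `H_d` has order `60`, `108`, `672`, `3420`, and identities in `H_d` can be decided by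
computation with permutations (`IsModel.injective_and_card`).

The subgroups are found with Sylow's theorems. If the avoided elements make up a Sylow `p`-subgroup,
then `p` does not divide the order of `V`; since `⟨a, c⟩` is a four-group consisting of avoided
elements, this excludes `p = 2` whenever `8` does not divide the order of `H_d`.

* For `d = 5` nothing remains.
* For `d = 6` the order of `V` is odd, so `V` lies in the normal subgroup of order `27` generated by
  `ab` and `cabc`. Outside its commutator subgroup, of order `3`, all elements are conjugate to
  powers of `ab`, `bc` or `bac`; the last ones are excluded by duality.
* For `d = 8` there is a central involution `z`, and `⟨b, c⟩ × ⟨z⟩` is a Sylow 2-subgroup in which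
  `z` is the only non-trivial element that is not avoided. So the 2-part of `V` is contained in `⟨z⟩`
  and the order of `V` is `1`, `2`, `7` or `14`; each of these occurs for one conjugacy class.
* For `d = 9` the order of `V` divides `95`. A subgroup of order `95` would entail that a Sylow
  `19`-subgroup is normal, which is not the case, and the subgroups of orders `5` and `19` are Sylow
  subgroups.

The dihedral groups `⟨b, c⟩`, `⟨a, c⟩`, `⟨a, b⟩` act freely on the flags, so the numbers of vertices,
edges and faces are the number of flags divided by `2 * d`, `4`, `6`. A surface is non-orientable if
`V` contains the value of a word of odd length, such as the relator `(bac) ^ d` for odd `d` or a word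
for `z`; for even `d` a subgroup of odd order yields an orientable surface.
-/

/-! ### Machine-checked coset enumeration -/

namespace CosetEnumeration

/-- The position of a generator in a row of the coset table. -/
def column : Gen → ℕ
  | .a => 0
  | .b => 1
  | .c => 2

/-- Entry of the coset table `T` in row `i` and column `g`. The table is a natural number whose
binary digits are divided into fields of 8 bits; the value `0` stands for an undefined entry. In this
form the kernel evaluates reading and writing by its built-in arithmetic of natural numbers. -/
def entry (T i : ℕ) (g : Gen) : ℕ :=
  (T >>> (8 * (3 * i + column g))) % 2 ^ 8

/-- Overwrite one entry of the coset table. Values that do not fit into a field are ignored. -/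
def record (T i : ℕ) (g : Gen) (j : ℕ) : ℕ :=
  if j < 2 ^ 8 then T ^^^ ((entry T i g ^^^ j) <<< (8 * (3 * i + column g))) else T

theorem column_lt (g : Gen) : column g < 3 := by cases g <;> decide

theorem column_injective : Function.Injective column := by
  intro g h; cases g <;> cases h <;> simp [column]

theorem entry_lt (T i : ℕ) (g : Gen) : entry T i g < 2 ^ 8 :=
  Nat.mod_lt _ (by norm_num)

theorem testBit_entry (T i : ℕ) (g : Gen) (n : ℕ) :
    (entry T i g).testBit n = (decide (n < 8) && T.testBit (8 * (3 * i + column g) + n)) := by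
  rw [entry, Nat.testBit_mod_two_pow, Nat.testBit_shiftRight]

theorem entry_record_self {T i : ℕ} {g : Gen} {j : ℕ} (hj : j < 2 ^ 8) :
    entry (record T i g j) i g = j := by
  apply Nat.eq_of_testBit_eq
  intro n
  rw [testBit_entry, record, if_pos hj, Nat.testBit_xor, Nat.testBit_shiftLeft, Nat.testBit_xor]
  by_cases hn : n < 8
  · simp [testBit_entry, hn]
  · have : j.testBit n = false := Nat.testBit_lt_two_pow (hj.trans_le
      (Nat.pow_le_pow_right (by norm_num) (not_lt.1 hn)))
    simp [hn, this]

theorem entry_record_of_ne {T i : ℕ} {g : Gen} {j i' : ℕ} {g' : Gen} (h : ¬(i' = i ∧ g' = g)) :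
    entry (record T i g j) i' g' = entry T i' g' := by
  rw [record]
  split_ifs with hj
  swap
  · rfl
  apply Nat.eq_of_testBit_eq
  intro n
  rw [testBit_entry, testBit_entry, Nat.testBit_xor, Nat.testBit_shiftLeft]
  by_cases hn : n < 8
  swap
  · simp [hn]
  have hne : 3 * i' + column g' ≠ 3 * i + column g := by
    intro he
    have h1 := column_lt g
    have h2 := column_lt g'
    exact h ⟨by omega, column_injective (by omega)⟩
  by_cases hle : 8 * (3 * i + column g) ≤ 8 * (3 * i' + column g') + n
  · have hbit : (entry T i g ^^^ j).testBit
        (8 * (3 * i' + column g') + n - 8 * (3 * i + column g)) = false :=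
      Nat.testBit_lt_two_pow ((Nat.xor_lt_two_pow (entry_lt T i g) hj).trans_le
        (Nat.pow_le_pow_right (by norm_num) (by omega)))
    simp [hbit]
  · simp [hle]

/-- Follow a word through the coset table; the result is `0` if an undefined entry is met. -/
def trace (T : ℕ) : ℕ → List Gen → ℕ
  | i, [] => i
  | i, g :: l =>
    match entry T i g with
    | 0 => 0
    | j + 1 => trace T (j + 1) l

/-- The steps of a coset enumeration. Relators are given by their position in a fixed list. -/
inductive Step
  /-- A new row is created for the image of row `i` under the generator `g`. -/
  | define (i : ℕ) (g : Gen)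
  /-- The closed walk from row `i` along the relator `k` is known except for its edge number `p`,
  which is therefore determined. -/
  | fill (i k p : ℕ)
  /-- The closed walk from row `i` along the relator `k` is known completely; the rows that are
  reached by its first `p` edges and by the other edges backwards are equal. -/
  | merge (i k p : ℕ)

/-- Copy the entry of row `v` in column `g` to row `u`. -/
def copyEntry (u v : ℕ) (T : ℕ) (g : Gen) : ℕ :=
  match entry T v g with
  | 0 => T
  | w + 1 =>
    let w' := if w + 1 = v then u else w + 1
    record (record T u g w') w' g u

/-- The effect of a step on a pair consisting of the first unused row number and the table.
Inapplicable steps are ignored. -/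
def Step.apply (R : List (List Gen)) : Step → ℕ × ℕ → ℕ × ℕ
  | .define i g, (n, T) =>
    if i < n then (n + 1, record (record T i g n) n g i) else (n, T)
  | .fill i k p, (n, T) =>
    let r := R.getD k []
    match r.drop p with
    | [] => (n, T)
    | g :: t =>
      let x := trace T i (r.take p)
      let y := trace T i t.reverse
      if i < n ∧ x ≠ 0 ∧ y ≠ 0 then (n, record (record T x g y) y g x) else (n, T)
  | .merge i k p, (n, T) =>
    let r := R.getD k []
    let x := trace T i (r.take p)
    let y := trace T i (r.drop p).reverse
    if i < n ∧ x ≠ 0 ∧ y ≠ 0 then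
      (n, [Gen.a, Gen.b, Gen.c].foldl (copyEntry (min x y) (max x y)) T)
    else (n, T)

/-- `k m`, written in such a way that evaluation by reduction evaluates `m` first: otherwise the
kernel would carry along a growing unevaluated expression for the table. -/
def force {α : Type} (m : ℕ) (k : ℕ → α) : α :=
  match m with
  | 0 => k 0
  | m + 1 => k (m + 1)

theorem force_eq {α : Type} (m : ℕ) (k : ℕ → α) : force m k = k m := by
  cases m <;> rfl

/-- Execution of a list of steps. -/
def run (R : List (List Gen)) : List Step → ℕ × ℕ → ℕ × ℕ
  | [], s => s
  | x :: l, s => force (x.apply R s).1 fun n => force (x.apply R s).2 fun T => run R l (n, T)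

/-- The initial table: row `1` is fixed by `b` and `c`. -/
def initial : ℕ × ℕ := (2, record (record 0 1 .b 1) 1 .c 1)

/-- The rows `1, …, m` of the table are complete and refer only to each other. -/
def isClosed (m T : ℕ) : Bool :=
  (List.range m).all fun i => [Gen.a, Gen.b, Gen.c].all fun g =>
    1 ≤ entry T (i + 1) g && entry T (i + 1) g ≤ m

/-- The enumeration ends with a closed table of `m` rows. -/
def succeeds (R : List (List Gen)) (m : ℕ) (l : List Step) : Bool :=
  isClosed m (run R l initial).2

section Soundness

variable {G : Type u} {X : Type v} [Group G] [MulAction G X] (s : Gen → G)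

/-- The action of a word on a point, first letter first. -/
def walk (l : List Gen) (x : X) : X := l.foldl (fun y g => s g • y) x

/-- The entries of the table describe the action of the generators on the points `f i`. -/
structure Describes (f : ℕ → X) (n T : ℕ) : Prop where
  row_lt : ∀ i g, entry T i g ≠ 0 → i < n
  entry_lt : ∀ i g, entry T i g ≠ 0 → entry T i g < n
  smul_eq : ∀ i g, entry T i g ≠ 0 → s g • f i = f (entry T i g)

variable {s}

theorem walk_append (l l' : List Gen) (x : X) :
    walk s (l ++ l') x = walk s l' (walk s l x) := by
  simp [walk]

theorem walk_reverse_walk (hs : ∀ g, s g * s g = 1) (l : List Gen) (x : X) :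
    walk s l.reverse (walk s l x) = x := by
  induction l generalizing x with
  | nil => rfl
  | cons g l ih =>
    rw [List.reverse_cons, walk_append, show walk s (g :: l) x = walk s l (s g • x) from rfl, ih]
    simp [walk, smul_smul, hs]

theorem Describes.record {f : ℕ → X} {n T i j : ℕ} {g : Gen} (h : Describes s f n T)
    (hi : i < n) (hj : j < n) (hij : s g • f i = f j) : Describes s f n (record T i g j) := by
  by_cases hj8 : j < 2 ^ 8
  · refine ⟨fun i' g' h' => ?_, fun i' g' h' => ?_, fun i' g' h' => ?_⟩ <;>
      by_cases he : i' = i ∧ g' = g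
    · exact he.1 ▸ hi
    · rw [entry_record_of_ne he] at h'
      exact h.row_lt _ _ h'
    · obtain ⟨rfl, rfl⟩ := he
      rwa [entry_record_self hj8]
    · rw [entry_record_of_ne he] at h' ⊢
      exact h.entry_lt _ _ h'
    · obtain ⟨rfl, rfl⟩ := he
      rwa [entry_record_self hj8]
    · rw [entry_record_of_ne he] at h' ⊢
      exact h.smul_eq _ _ h'
  · rwa [CosetEnumeration.record, if_neg hj8]

theorem Describes.record_record {f : ℕ → X} {n T i j : ℕ} {g : Gen} (hs : ∀ g, s g * s g = 1)
    (h : Describes s f n T) (hi : i < n) (hj : j < n) (hij : s g • f i = f j) :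
    Describes s f n (CosetEnumeration.record (CosetEnumeration.record T i g j) j g i) :=
  (h.record hi hj hij).record hj hi (by rw [← hij, smul_smul, hs, one_smul])

theorem Describes.trace {f : ℕ → X} {n T : ℕ} (h : Describes s f n T) (l : List Gen) {i : ℕ}
    (hi : i < n) (ht : trace T i l ≠ 0) :
    trace T i l < n ∧ f (trace T i l) = walk s l (f i) := by
  induction l generalizing i with
  | nil => exact ⟨hi, rfl⟩
  | cons g l ih =>
    rw [CosetEnumeration.trace] at ht ⊢
    cases he : entry T i g with
    | zero => simp [he] at ht
    | succ j =>
      have h0 : entry T i g ≠ 0 := by omega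
      have h1 := h.entry_lt i g h0
      have h2 := h.smul_eq i g h0
      rw [he] at ht h1 h2
      obtain ⟨h3, h4⟩ := ih h1 ht
      refine ⟨h3, h4.trans ?_⟩
      rw [← h2]; rfl

theorem Describes.copyEntry {f : ℕ → X} {n T p q : ℕ} (hs : ∀ g, s g * s g = 1)
    (h : Describes s f n T) (hp : p < n) (hpq : f p = f q) (g : Gen) :
    Describes s f n (copyEntry p q T g) := by
  rw [CosetEnumeration.copyEntry]
  cases he : entry T q g with
  | zero => exact h
  | succ w =>
    have h0 : entry T q g ≠ 0 := by omega
    have h1 := h.entry_lt q g h0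
    have h2 := h.smul_eq q g h0
    rw [he, ← hpq] at h2
    rw [he] at h1
    dsimp only
    split_ifs with hw
    · exact h.record_record hs hp hp (by rw [h2, hw, hpq])
    · exact h.record_record hs hp h1 h2

/-- Each step preserves the truth of the table; a definition extends the numbering of points. -/
theorem exists_describes_apply {R : List (List Gen)} (hs : ∀ g, s g * s g = 1)
    (hR : ∀ r ∈ R, ∀ x : X, walk s r x = x) (e : Step) {f : ℕ → X} {n T : ℕ}
    (hn : 1 < n) (h : Describes s f n T) :
    ∃ f' : ℕ → X, f' 1 = f 1 ∧ 1 < (e.apply R (n, T)).1 ∧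
      Describes s f' (e.apply R (n, T)).1 (e.apply R (n, T)).2 := by
  have hrel : ∀ k (x : X), walk s (R.getD k []) x = x := by
    intro k x
    by_cases hk : k < R.length
    · rw [List.getD_eq_getElem _ _ hk]
      exact hR _ (List.getElem_mem hk) x
    · rw [List.getD_eq_default _ _ (not_lt.1 hk)]
      rfl
  -- the two ends of a closed walk that is read from both sides
  have hends : ∀ k p (x : X), walk s ((R.getD k []).drop p).reverse x =
      walk s ((R.getD k []).take p) x := by
    intro k p x
    have h1 := hrel k x
    rw [← List.take_append_drop p (R.getD k []), walk_append] at h1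
    conv_lhs => rw [← h1]
    exact walk_reverse_walk hs _ _
  cases e with
  | define i g =>
    simp only [Step.apply]
    split_ifs with hi
    swap
    · exact ⟨f, rfl, hn, h⟩
    have hf : ∀ m, m < n → Function.update f n (s g • f i) m = f m := fun m hm =>
      Function.update_of_ne hm.ne _ _
    refine ⟨Function.update f n (s g • f i), hf 1 hn, by dsimp only; omega, ?_⟩
    have h' : Describes s (Function.update f n (s g • f i)) (n + 1) T := by
      refine ⟨fun i' g' h' => (h.row_lt _ _ h').trans n.lt_succ_self,
        fun i' g' h' => (h.entry_lt _ _ h').trans n.lt_succ_self, fun i' g' h' => ?_⟩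
      rw [hf _ (h.row_lt _ _ h'), hf _ (h.entry_lt _ _ h')]
      exact h.smul_eq _ _ h'
    exact h'.record_record hs (by omega) (by omega) (by rw [hf i hi, Function.update_self])
  | fill i k p =>
    refine ⟨f, rfl, ?_⟩
    simp only [Step.apply]
    have hd := hends k p (f i)
    cases hr : (R.getD k []).drop p with
    | nil => exact ⟨hn, h⟩
    | cons g t =>
      dsimp only
      split_ifs with hc
      swap
      · exact ⟨hn, h⟩
      obtain ⟨hi, hx, hy⟩ := hc
      obtain ⟨hx1, hx2⟩ := h.trace _ hi hx
      obtain ⟨hy1, hy2⟩ := h.trace _ hi hy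
      refine ⟨hn, h.record_record hs hx1 hy1 ?_⟩
      rw [hr, List.reverse_cons, walk_append, ← hy2, ← hx2] at hd
      rw [← hd]
      simp [walk, smul_smul, hs]
  | merge i k p =>
    refine ⟨f, rfl, ?_⟩
    simp only [Step.apply]
    split_ifs with hc
    swap
    · exact ⟨hn, h⟩
    obtain ⟨hi, hx, hy⟩ := hc
    obtain ⟨hx1, hx2⟩ := h.trace _ hi hx
    obtain ⟨hy1, hy2⟩ := h.trace _ hi hy
    have he := hends k p (f i)
    rw [← hy2, ← hx2] at he
    refine ⟨hn, ?_⟩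
    dsimp only [List.foldl]
    generalize trace T i (List.take p (R.getD k [])) = x at *
    generalize trace T i (List.drop p (R.getD k [])).reverse = y at *
    have h1 : min x y < n := (min_le_left _ _).trans_lt hx1
    have h2 : f (min x y) = f (max x y) := by
      rcases le_total x y with hxy | hxy <;> simp [hxy, he]
    exact ((h.copyEntry hs h1 h2 _).copyEntry hs h1 h2 _).copyEntry hs h1 h2 _

theorem exists_describes_run {R : List (List Gen)} (hs : ∀ g, s g * s g = 1)
    (hR : ∀ r ∈ R, ∀ x : X, walk s r x = x) (l : List Step) {f : ℕ → X} {n T : ℕ}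
    (hn : 1 < n) (h : Describes s f n T) :
    ∃ f' : ℕ → X, f' 1 = f 1 ∧
      Describes s f' (run R l (n, T)).1 (run R l (n, T)).2 := by
  induction l generalizing f n T with
  | nil => exact ⟨f, rfl, h⟩
  | cons e l ih =>
    obtain ⟨f₁, h1, h2, h3⟩ := exists_describes_apply hs hR e hn h
    obtain ⟨f₂, h4, h5⟩ := ih h2 h3
    refine ⟨f₂, h4.trans h1, ?_⟩
    simpa only [CosetEnumeration.run, force_eq] using h5

theorem entry_zero (i : ℕ) (g : Gen) : entry 0 i g = 0 := by simp [entry]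

/-- A successful coset enumeration bounds the number of points. -/
theorem card_le_of_succeeds {R : List (List Gen)} (hs : ∀ g, s g * s g = 1)
    (hgen : Subgroup.closure (Set.range s) = ⊤) [MulAction.IsPretransitive G X]
    (hR : ∀ r ∈ R, ∀ x : X, walk s r x = x) {x₀ : X} (hb : s .b • x₀ = x₀) (hc : s .c • x₀ = x₀)
    {m : ℕ} (hm : 0 < m) {l : List Step} (hl : succeeds R m l = true) :
    Finite X ∧ Nat.card X ≤ m := by
  have h0 : Describes s (fun _ => x₀) 2 0 :=
    ⟨fun i g h => absurd (entry_zero i g) h, fun i g h => absurd (entry_zero i g) h,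
      fun i g h => absurd (entry_zero i g) h⟩
  obtain ⟨f, hf1, hf⟩ := exists_describes_run hs hR l one_lt_two
    ((h0.record (g := .b) one_lt_two one_lt_two hb).record (g := .c) one_lt_two one_lt_two hc)
  have hclosed : ∀ i, i < m → ∀ g, ∃ j < m, s g • f (i + 1) = f (j + 1) := by
    intro i hi g
    simp only [succeeds, isClosed, List.all_eq_true, List.mem_range] at hl
    have h1 := hl i hi g (by cases g <;> simp)
    simp only [Bool.and_eq_true, decide_eq_true_eq] at h1
    have h2 := hf.smul_eq (i + 1) g (Nat.one_le_iff_ne_zero.1 h1.1)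
    refine ⟨entry (CosetEnumeration.run R l initial).2 (i + 1) g - 1, by omega, h2.trans ?_⟩
    rw [Nat.sub_add_cancel h1.1]
    rfl
  let F : Fin m → X := fun i => f (i + 1)
  have hinv : ∀ g : G, ∀ i : Fin m, ∃ j : Fin m, g • F i = F j := by
    intro g
    have hg : g ∈ Subgroup.closure (Set.range s) := hgen ▸ Subgroup.mem_top g
    induction hg using Subgroup.closure_induction'' with
    | mem x hx =>
      obtain ⟨y, rfl⟩ := hx
      intro i
      obtain ⟨j, hj, h⟩ := hclosed i i.2 y
      exact ⟨⟨j, hj⟩, h⟩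
    | inv_mem x hx =>
      obtain ⟨y, rfl⟩ := hx
      intro i
      obtain ⟨j, hj, h⟩ := hclosed i i.2 y
      refine ⟨⟨j, hj⟩, ?_⟩
      rw [inv_eq_of_mul_eq_one_right (hs y)]
      exact h
    | one => exact fun i => ⟨i, one_smul _ _⟩
    | mul x y _ _ hx hy =>
      intro i
      obtain ⟨j, hj⟩ := hy i
      obtain ⟨k, hk⟩ := hx j
      exact ⟨k, by rw [mul_smul, hj, hk]⟩
  have hsurj : Function.Surjective F := by
    intro x
    obtain ⟨g, rfl⟩ := MulAction.exists_smul_eq G x₀ x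
    obtain ⟨j, hj⟩ := hinv g ⟨0, hm⟩
    exact ⟨j, by rw [← hj]; exact congrArg _ hf1⟩
  exact ⟨Finite.of_surjective F hsurj, by
    simpa using Nat.card_le_card_of_surjective F hsurj⟩

end Soundness

end CosetEnumeration

/-! ### Subgroups generated by two involutions -/

namespace DihedralGroup

section Lift

variable {G : Type u} [Group G] {σ τ : G}

theorem mul_zpow_of_involutions (hσ : σ * σ = 1) (hτ : τ * τ = 1) (k : ℤ) :
    (σ * τ) ^ k * σ = σ * ((σ * τ) ^ k)⁻¹ := by
  have hσi : σ⁻¹ = σ := inv_eq_of_mul_eq_one_right hσ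
  have hτi : τ⁻¹ = τ := inv_eq_of_mul_eq_one_right hτ
  have h1 : σ * (σ * τ)⁻¹ * σ⁻¹ = σ * τ := by
    rw [mul_inv_rev, hσi, hτi, mul_assoc, mul_assoc, hσ, mul_one]
  conv_lhs => rw [← h1, conj_zpow, inv_zpow]
  simp

/-- The homomorphism from the dihedral group of order `2 * n` determined by two involutions
`σ`, `τ` with `(σ * τ) ^ n = 1`: the rotation `r 1` goes to `σ * τ`, the reflection `sr 0`
to `σ`. -/
def liftInvolutions (n : ℕ) (hσ : σ * σ = 1) (hτ : τ * τ = 1) (h : (σ * τ) ^ n = 1) :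
    DihedralGroup n →* G :=
  let e : ZMod n →+ Additive G := ZMod.lift n ⟨zmultiplesHom (Additive G) (.ofMul (σ * τ)), by
    rw [zmultiplesHom_apply, ← ofMul_zpow, zpow_natCast, h, ofMul_one]⟩
  let E : ZMod n → G := fun i => (e i).toMul
  have hconj : ∀ i, E i * σ = σ * (E i)⁻¹ := by
    intro i
    obtain ⟨k, rfl⟩ := ZMod.intCast_surjective i
    simpa only [E, e, ZMod.lift_coe, zmultiplesHom_apply, toMul_zsmul, toMul_ofMul] using
      mul_zpow_of_involutions hσ hτ k
  have hadd : ∀ i j, E (i + j) = E i * E j := fun i j => by simp [E]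
  have hsub : ∀ i j, E (j - i) = (E i)⁻¹ * E j := fun i j => by
    rw [sub_eq_neg_add, hadd]; simp [E]
  MonoidHom.mk' (fun
    | r i => E i
    | sr i => σ * E i) (by
    rintro (i | i) (j | j)
    · exact hadd i j
    · change σ * E (j - i) = E i * (σ * E j)
      rw [← mul_assoc, hconj, hsub, mul_assoc]
    · change σ * E (i + j) = σ * E i * E j
      rw [hadd, mul_assoc]
    · change E (j - i) = σ * E i * (σ * E j)
      rw [mul_assoc, ← mul_assoc (E i), hconj, mul_assoc, ← mul_assoc σ, hσ, one_mul, hsub])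

theorem liftInvolutions_r {n : ℕ} (hσ : σ * σ = 1) (hτ : τ * τ = 1)
    (h : (σ * τ) ^ n = 1) (k : ℤ) :
    liftInvolutions n hσ hτ h (r (k : ZMod n)) = (σ * τ) ^ k := by
  simp [liftInvolutions]

theorem liftInvolutions_sr {n : ℕ} (hσ : σ * σ = 1) (hτ : τ * τ = 1)
    (h : (σ * τ) ^ n = 1) (k : ℤ) :
    liftInvolutions n hσ hτ h (sr (k : ZMod n)) = σ * (σ * τ) ^ k := by
  simp [liftInvolutions]

theorem range_liftInvolutions {n : ℕ} (hσ : σ * σ = 1) (hτ : τ * τ = 1)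
    (h : (σ * τ) ^ n = 1) :
    (liftInvolutions n hσ hτ h).range = Subgroup.closure {σ, τ} := by
  apply le_antisymm
  · have h1 : σ ∈ Subgroup.closure {σ, τ} := Subgroup.subset_closure (by simp)
    have h2 : τ ∈ Subgroup.closure {σ, τ} := Subgroup.subset_closure (by simp)
    rintro _ ⟨i | i, rfl⟩ <;> obtain ⟨k, rfl⟩ := ZMod.intCast_surjective i
    · rw [liftInvolutions_r]
      exact zpow_mem (mul_mem h1 h2) k
    · rw [liftInvolutions_sr]
      exact mul_mem h1 (zpow_mem (mul_mem h1 h2) k)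
  · rw [Subgroup.closure_le]
    rintro x (rfl | rfl)
    · exact ⟨sr ((0 : ℤ) : ZMod n), by rw [liftInvolutions_sr, zpow_zero, mul_one]⟩
    · exact ⟨sr ((1 : ℤ) : ZMod n), by
        rw [liftInvolutions_sr, zpow_one, ← mul_assoc, hσ, one_mul]⟩

/-- The elements of a group generated by two involutions. -/
theorem mem_closure_involutions_iff (hσ : σ * σ = 1) (hτ : τ * τ = 1) {x : G} :
    x ∈ Subgroup.closure {σ, τ} ↔ ∃ k : ℤ, x = (σ * τ) ^ k ∨ x = σ * (σ * τ) ^ k := by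
  have h0 : (σ * τ) ^ orderOf (σ * τ) = 1 := pow_orderOf_eq_one _
  rw [← range_liftInvolutions hσ hτ h0]
  constructor
  · rintro ⟨i | i, rfl⟩ <;> obtain ⟨k, rfl⟩ := ZMod.intCast_surjective i
    · exact ⟨k, .inl (liftInvolutions_r hσ hτ h0 k)⟩
    · exact ⟨k, .inr (liftInvolutions_sr hσ hτ h0 k)⟩
  · rintro ⟨k, rfl | rfl⟩
    · exact ⟨_, liftInvolutions_r hσ hτ h0 k⟩
    · exact ⟨_, liftInvolutions_sr hσ hτ h0 k⟩

/-- Every reflection in a group generated by two involutions is conjugate to one of them. -/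
theorem reflection_conj (hσ : σ * σ = 1) (hτ : τ * τ = 1) (k : ℤ) :
    ∃ g : G, σ * (σ * τ) ^ k = g * σ * g⁻¹ ∨ σ * (σ * τ) ^ k = g * τ * g⁻¹ := by
  have h1 := fun m => mul_zpow_of_involutions hσ hτ m
  obtain ⟨m, rfl | rfl⟩ := Int.even_or_odd' k
  · refine ⟨((σ * τ) ^ m)⁻¹, .inl ?_⟩
    rw [inv_inv, two_mul, zpow_add, ← mul_assoc]
    congr 1
    have := h1 (-m)
    rw [zpow_neg, inv_inv] at this
    exact this.symm
  · refine ⟨((σ * τ) ^ m)⁻¹, .inr ?_⟩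
    have h2 := h1 (-m)
    rw [zpow_neg, inv_inv] at h2
    have h4 : ((σ * τ) ^ m)⁻¹ * τ = σ * (σ * τ) ^ m * (σ * τ) := by
      rw [← h2, mul_assoc, ← mul_assoc σ σ, hσ, one_mul]
    rw [inv_inv, h4, mul_assoc, mul_assoc]
    congr 1
    rw [← zpow_one_add, ← zpow_add]
    congr 1
    ring

theorem card_closure_le {n : ℕ} [NeZero n] (hσ : σ * σ = 1) (hτ : τ * τ = 1)
    (h : (σ * τ) ^ n = 1) : Finite (Subgroup.closure {σ, τ}) ∧
    Nat.card (Subgroup.closure {σ, τ}) ≤ 2 * n := by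
  rw [← range_liftInvolutions hσ hτ h, ← DihedralGroup.nat_card]
  have hs := MonoidHom.rangeRestrict_surjective (liftInvolutions n hσ hτ h)
  exact ⟨Finite.of_surjective _ hs, Nat.card_le_card_of_surjective _ hs⟩

end Lift

section Free

variable {G : Type u} [Group G] {X : Type v} [MulAction G X] {σ τ : G} {n : ℕ}

/-- If two involutions have no fixed points and their product has only `n`-cycles, then the
dihedral group that they generate acts freely. -/
theorem eq_one_of_smul_eq (hσ : σ * σ = 1) (hτ : τ * τ = 1) (h : (σ * τ) ^ n = 1)
    (hσX : ∀ x : X, σ • x ≠ x) (hτX : ∀ x : X, τ • x ≠ x)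
    (hX : ∀ (x : X) (k : ℤ), (σ * τ) ^ k • x = x → (n : ℤ) ∣ k) {g : G}
    (hg : g ∈ Subgroup.closure {σ, τ}) {x : X} (hx : g • x = x) : g = 1 := by
  obtain ⟨k, rfl | rfl⟩ := (mem_closure_involutions_iff hσ hτ).1 hg
  · obtain ⟨m, rfl⟩ := hX x k hx
    rw [zpow_mul, zpow_natCast, h, one_zpow]
  · exfalso
    obtain ⟨t, ht | ht⟩ := reflection_conj hσ hτ k <;> rw [ht, mul_smul, mul_smul] at hx
    · exact hσX (t⁻¹ • x) (by rw [eq_inv_smul_iff]; exact hx)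
    · exact hτX (t⁻¹ • x) (by rw [eq_inv_smul_iff]; exact hx)

theorem card_closure_eq [Nonempty X] (hσ : σ * σ = 1) (hτ : τ * τ = 1) (h : (σ * τ) ^ n = 1)
    (hσX : ∀ x : X, σ • x ≠ x) (hτX : ∀ x : X, τ • x ≠ x)
    (hX : ∀ (x : X) (k : ℤ), (σ * τ) ^ k • x = x → (n : ℤ) ∣ k) :
    Nat.card (Subgroup.closure {σ, τ}) = 2 * n := by
  rw [← range_liftInvolutions hσ hτ h, ← DihedralGroup.nat_card]
  refine (Nat.card_congr (MonoidHom.ofInjective (f := liftInvolutions n hσ hτ h) ?_).toEquiv).symm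
  rw [injective_iff_map_eq_one]
  obtain ⟨x⟩ := ‹Nonempty X›
  rintro (i | i) <;> obtain ⟨k, rfl⟩ := ZMod.intCast_surjective i <;> intro hk
  · rw [liftInvolutions_r] at hk
    rw [(ZMod.intCast_zmod_eq_zero_iff_dvd _ _).2 (hX x k (by rw [hk, one_smul])), r_zero]
  · exfalso
    rw [liftInvolutions_sr] at hk
    obtain ⟨t, ht | ht⟩ := reflection_conj hσ hτ k <;> rw [hk] at ht
    · have : σ = 1 := by simpa using ht.symm
      exact hσX x (by rw [this, one_smul])
    · have : τ = 1 := by simpa using ht.symm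
      exact hτX x (by rw [this, one_smul])

/-- The order of the group generated by two involutions. -/
theorem card_closure_of_orderOf (hσ : orderOf σ = 2) (hτ : orderOf τ = 2) :
    Nat.card (Subgroup.closure {σ, τ}) = 2 * orderOf (σ * τ) := by
  have h1 : ∀ ρ : G, orderOf ρ = 2 → ρ * ρ = 1 ∧ ρ ≠ 1 := by
    intro ρ hρ
    refine ⟨by rw [← pow_two, ← hρ, pow_orderOf_eq_one], ?_⟩
    rintro rfl
    simp at hρ
  refine card_closure_eq (X := G) (h1 σ hσ).1 (h1 τ hτ).1 (pow_orderOf_eq_one _)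
    (fun x => ?_) (fun x => ?_) fun x k => ?_
  · simpa using (h1 σ hσ).2
  · simpa using (h1 τ hτ).2
  · simpa using orderOf_dvd_iff_zpow_eq_one.2

end Free

end DihedralGroup

/-! ### Relations of the geodesic triangle group -/

namespace GeodesicSurface

variable {d : ℕ}

theorem relator_eq_one (d : ℕ) : ∀ r ∈ relators d, PresentedGroup.mk (relators d) r = 1 :=
  fun _ hr => PresentedGroup.one_of_mem hr

theorem genA_mul_self : genA d * genA d = 1 := by
  have : genA d ^ 2 = 1 := relator_eq_one d (FreeGroup.of Gen.a ^ 2) (by simp [relators])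
  rwa [pow_two] at this

theorem genB_mul_self : genB d * genB d = 1 := by
  have : genB d ^ 2 = 1 := relator_eq_one d (FreeGroup.of Gen.b ^ 2) (by simp [relators])
  rwa [pow_two] at this

theorem genC_mul_self : genC d * genC d = 1 := by
  have : genC d ^ 2 = 1 := relator_eq_one d (FreeGroup.of Gen.c ^ 2) (by simp [relators])
  rwa [pow_two] at this

theorem genAB_pow : (genA d * genB d) ^ 3 = 1 :=
  relator_eq_one d ((FreeGroup.of Gen.a * FreeGroup.of Gen.b) ^ 3) (by simp [relators])

theorem genAC_pow : (genA d * genC d) ^ 2 = 1 :=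
  relator_eq_one d ((FreeGroup.of Gen.a * FreeGroup.of Gen.c) ^ 2) (by simp [relators])

theorem genBC_pow : (genB d * genC d) ^ d = 1 :=
  relator_eq_one d ((FreeGroup.of Gen.b * FreeGroup.of Gen.c) ^ d) (by simp [relators])

theorem genBAC_pow : (genB d * genA d * genC d) ^ d = 1 :=
  relator_eq_one d ((FreeGroup.of Gen.b * FreeGroup.of Gen.a * FreeGroup.of Gen.c) ^ d)
    (by simp [relators])

/-- The three generators as a family. -/
def gen (d : ℕ) (g : Gen) : H d := PresentedGroup.of g

theorem gen_a : gen d .a = genA d := rfl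
theorem gen_b : gen d .b = genB d := rfl
theorem gen_c : gen d .c = genC d := rfl

theorem gen_mul_self (g : Gen) : gen d g * gen d g = 1 := by
  cases g
  exacts [genA_mul_self, genB_mul_self, genC_mul_self]

theorem closure_range_gen : Subgroup.closure (Set.range (gen d)) = ⊤ :=
  PresentedGroup.closure_range_of _

/-- The value of a word in the generators. -/
def word (d : ℕ) (l : List Gen) : H d := (l.map (gen d)).prod

theorem word_nil : word d [] = 1 := rfl

theorem word_cons (g : Gen) (l : List Gen) : word d (g :: l) = gen d g * word d l := by
  simp [word]

theorem word_append (l l' : List Gen) : word d (l ++ l') = word d l * word d l' := by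
  simp [word]

theorem word_reverse (l : List Gen) : word d l.reverse = (word d l)⁻¹ := by
  induction l with
  | nil => simp [word]
  | cons g l ih =>
    rw [List.reverse_cons, word_append, ih, word_cons g l, mul_inv_rev, word_cons, word_nil, mul_one,
      inv_eq_of_mul_eq_one_right (gen_mul_self g)]

theorem word_flatten_replicate (n : ℕ) (l : List Gen) :
    word d (List.replicate n l).flatten = word d l ^ n := by
  induction n with
  | zero => simp [word]
  | succ n ih => rw [List.replicate_succ, List.flatten_cons, word_append, ih, pow_succ']

/-! ### Bounding the order of the geodesic triangle group -/

/-- The relators of `H_d` as words, together with the squares of the generators. -/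
def relatorWords (d : ℕ) : List (List Gen) :=
  [(List.replicate 2 [Gen.a, Gen.c]).flatten, (List.replicate 3 [Gen.a, Gen.b]).flatten,
    (List.replicate d [Gen.b, Gen.c]).flatten, (List.replicate d [Gen.b, Gen.a, Gen.c]).flatten,
    [Gen.a, Gen.a], [Gen.b, Gen.b], [Gen.c, Gen.c]]

theorem word_of_mem_relatorWords {l : List Gen} (hl : l ∈ relatorWords d) : word d l = 1 := by
  simp only [relatorWords, List.mem_cons, List.not_mem_nil, or_false] at hl
  rcases hl with rfl | rfl | rfl | rfl | rfl | rfl | rfl <;>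
    simp only [word_flatten_replicate, word_cons, word_nil, mul_one, gen_mul_self]
  · exact genAC_pow
  · exact genAB_pow
  · exact genBC_pow
  · rw [← mul_assoc]; exact genBAC_pow

theorem walk_gen {X : Type v} [MulAction (H d) X] (l : List Gen) (x : X) :
    CosetEnumeration.walk (gen d) l x = (word d l)⁻¹ • x := by
  rw [← word_reverse]
  induction l generalizing x with
  | nil => simp [CosetEnumeration.walk, word]
  | cons g l ih =>
    rw [List.reverse_cons, word_append, mul_smul, word_cons, word_nil, mul_one, ← ih]
    rfl

/-- A successful coset enumeration over `⟨b, c⟩` bounds the order of `H_d`. -/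
theorem card_le_of_enumeration [NeZero d] {m : ℕ} (hm : 0 < m)
    {l : List CosetEnumeration.Step}
    (hl : CosetEnumeration.succeeds (relatorWords d) m l = true) :
    Finite (H d) ∧ Nat.card (H d) ≤ 2 * d * m := by
  let D : Subgroup (H d) := Subgroup.closure {genB d, genC d}
  obtain ⟨hD, hDcard⟩ := DihedralGroup.card_closure_le (genB_mul_self (d := d)) genC_mul_self
    genBC_pow
  have hfix : ∀ g ∈ D, g • ((1 : H d) : H d ⧸ D) = ((1 : H d) : H d ⧸ D) := by
    intro g hg
    rw [MulAction.Quotient.smul_coe, smul_eq_mul, mul_one]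
    exact (QuotientGroup.eq.2 (by simpa using hg)).symm
  obtain ⟨hfin, hcard⟩ := CosetEnumeration.card_le_of_succeeds (X := H d ⧸ D)
    (gen_mul_self (d := d)) closure_range_gen
    (fun r hr x => by rw [walk_gen, word_of_mem_relatorWords hr, inv_one, one_smul])
    (hfix _ (Subgroup.subset_closure (by simp [gen_b])))
    (hfix _ (Subgroup.subset_closure (by simp [gen_c]))) hm hl
  have hmul : Nat.card D * D.index = Nat.card (H d) := D.card_mul_index
  have hindex : D.index = Nat.card (H d ⧸ D) := rfl
  have h0 : Nat.card (H d) ≠ 0 := by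
    rw [← hmul, hindex]
    exact mul_ne_zero Nat.card_pos.ne' Nat.card_pos.ne'
  exact ⟨Nat.finite_of_card_ne_zero h0, by
    rw [← hmul, hindex]; exact Nat.mul_le_mul hDcard hcard⟩

end GeodesicSurface

/-! ### Coset enumerations in degrees three to nine -/

namespace GeodesicSurface

section Enumerations

open CosetEnumeration

/-- Steps of a coset enumeration for `H_3` over `⟨b, c⟩`. -/
def enumerationThree : List Step :=
  [.define 1 .a, .fill 1 0 1, .define 2 .b, .fill 1 1 2, .fill 2 3 2, .merge 3 2 6, .merge 1 4 2]

/-- Steps of a coset enumeration for `H_4` over `⟨b, c⟩`. -/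
def enumerationFour : List Step :=
  [.define 1 .a, .fill 1 0 1, .define 2 .b, .fill 1 1 2, .define 3 .c, .fill 3 0 2, .fill 2 3 3,
   .merge 4 2 8, .merge 2 5 2, .merge 1 4 2]

/-- Steps of a coset enumeration for `H_5` over `⟨b, c⟩`. -/
def enumerationFive : List Step :=
  [.define 1 .a, .fill 1 0 1, .define 2 .b, .fill 1 1 2, .define 3 .c, .fill 3 0 2, .define 4 .b,
   .define 5 .a, .fill 5 1 1, .fill 4 3 2]

/-- Steps of a coset enumeration for `H_6` over `⟨b, c⟩`. -/
def enumerationSix : List Step :=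
  [.define 1 .a, .fill 1 0 1, .define 2 .b, .fill 1 1 2, .define 3 .c, .fill 3 0 2, .define 4 .b,
   .define 5 .a, .fill 5 1 1, .define 5 .c, .define 6 .c, .fill 5 0 2, .fill 4 3 3, .define 7 .b,
   .fill 8 1 2, .fill 7 2 1]

/-- Steps of a coset enumeration for `H_7` over `⟨b, c⟩`. -/
def enumerationSeven : List Step :=
  [.define 1 .a, .fill 1 0 1, .define 2 .b, .fill 1 1 2, .define 3 .c, .fill 3 0 2, .define 4 .b,
   .define 5 .a, .fill 5 1 1, .define 5 .c, .define 6 .c, .fill 5 0 2, .define 7 .b,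
   .define 8 .b, .define 9 .a, .define 9 .c, .fill 7 2 2, .define 10 .a, .fill 10 1 1,
   .fill 8 3 2, .define 11 .c, .fill 9 0 2, .merge 12 3 21, .merge 13 5 2, .merge 9 4 2,
   .merge 7 5 2, .merge 5 6 2, .merge 4 5 2, .merge 3 6 2, .merge 4 3 21, .merge 2 5 2,
   .merge 1 4 2]

/-- Steps of a coset enumeration for `H_8` over `⟨b, c⟩`. -/
def enumerationEight : List Step :=
  [.define 1 .a, .fill 1 0 1, .define 2 .b, .fill 1 1 2, .define 3 .c, .fill 3 0 2, .define 4 .b,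
   .define 5 .a, .fill 5 1 1, .define 5 .c, .define 6 .c, .fill 5 0 2, .define 7 .b,
   .define 8 .b, .define 9 .a, .define 9 .c, .define 10 .a, .fill 10 1 1, .define 10 .c,
   .define 11 .c, .fill 9 0 2, .define 12 .b, .fill 12 2 1, .define 13 .c, .fill 10 0 2,
   .fill 8 3 3, .define 14 .b, .fill 17 1 2, .define 15 .b, .define 16 .a, .fill 16 0 1,
   .define 18 .c, .fill 18 0 2, .define 19 .a, .fill 19 1 1, .define 19 .c, .define 21 .b,
   .define 22 .c, .fill 19 0 2, .define 23 .b, .define 24 .a, .fill 24 1 1, .define 24 .c,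
   .fill 21 2 2, .define 25 .b, .define 26 .a, .define 26 .c, .fill 23 2 2, .define 27 .c,
   .fill 24 0 2, .define 29 .a, .fill 29 1 1, .define 29 .c, .define 30 .c, .fill 26 0 2,
   .define 32 .b, .fill 28 1 2, .define 33 .c, .fill 29 0 2, .fill 25 3 3, .define 34 .b,
   .fill 37 1 2, .define 35 .b, .fill 31 1 2, .fill 35 3 2, .define 38 .c, .fill 38 0 2,
   .define 40 .b, .fill 40 2 1, .define 41 .a, .fill 41 0 1, .fill 41 1 1]

/-- Steps of a coset enumeration for `H_9` over `⟨b, c⟩`. -/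
def enumerationNine : List Step :=
  [.define 1 .a, .fill 1 0 1, .define 2 .b, .fill 1 1 2, .define 3 .c, .fill 3 0 2, .define 4 .b,
   .define 5 .a, .fill 5 1 1, .define 5 .c, .define 7 .a, .fill 7 0 1, .define 8 .b,
   .define 7 .b, .define 10 .a, .define 9 .a, .fill 9 1 1, .define 12 .c, .define 9 .c,
   .fill 12 0 2, .define 11 .c, .define 15 .a, .fill 15 0 1, .define 13 .b, .define 17 .c,
   .fill 17 3 25, .define 18 .b, .define 19 .a, .fill 19 1 1, .define 20 .c, .define 19 .c,
   .fill 20 0 2, .define 16 .b, .define 23 .c, .fill 16 2 2, .define 24 .a, .define 25 .b,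
   .fill 24 1 2, .define 25 .c, .fill 24 0 2, .define 15 .b, .define 28 .a, .fill 28 1 1,
   .define 29 .c, .define 28 .c, .fill 29 0 2, .define 26 .c, .fill 26 0 2, .define 21 .b,
   .define 22 .b, .define 34 .a, .define 33 .a, .fill 33 1 1, .define 33 .c, .define 37 .a,
   .fill 37 0 1, .define 34 .c, .define 39 .a, .fill 39 0 1, .define 37 .b, .fill 37 2 1,
   .define 41 .a, .fill 41 0 1, .define 42 .b, .define 43 .a, .fill 43 1 1, .define 43 .c,
   .define 45 .a, .fill 45 0 1, .define 45 .b, .define 46 .b, .define 47 .a, .define 49 .b,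
   .fill 47 1 2, .define 50 .c, .define 51 .a, .fill 51 0 1, .define 49 .c, .define 53 .a,
   .fill 53 0 1, .fill 47 3 24, .define 54 .b, .fill 53 1 2, .define 55 .c, .fill 55 0 2,
   .define 32 .b, .define 57 .a, .fill 57 1 1, .define 58 .c, .define 59 .a, .fill 59 0 1,
   .define 30 .b, .define 61 .a, .define 31 .b, .define 62 .b, .fill 61 1 2, .define 61 .c,
   .define 64 .c, .define 66 .a, .fill 66 0 1, .define 62 .c, .fill 61 0 2, .define 68 .b,
   .define 69 .c, .fill 69 3 25, .define 65 .b, .define 70 .b, .fill 69 1 2, .define 72 .c,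
   .define 73 .a, .fill 73 0 1, .define 67 .b, .define 75 .c, .define 76 .b, .define 39 .b,
   .fill 39 2 1, .define 78 .a, .define 77 .a, .fill 77 0 1, .define 40 .b, .define 79 .b,
   .fill 78 1 2, .define 82 .c, .define 81 .c, .fill 82 0 2, .define 75 .a, .define 76 .a,
   .fill 76 0 1, .define 85 .b, .define 66 .b, .fill 67 1 2, .define 87 .c, .define 89 .a,
   .fill 89 0 1, .define 86 .b, .define 80 .b, .fill 77 1 2, .define 91 .c, .define 93 .a,
   .fill 93 0 1, .define 59 .b, .define 95 .c, .define 83 .b, .fill 83 3 1, .define 97 .c,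
   .fill 96 0 2, .define 98 .b, .define 60 .b, .fill 59 1 2, .define 100 .c, .define 101 .a,
   .fill 101 0 1, .define 84 .b, .define 103 .a, .fill 103 1 1, .define 103 .c, .define 104 .c,
   .fill 103 0 2, .define 89 .b, .define 107 .c, .fill 107 3 25, .define 108 .b, .define 90 .b,
   .fill 89 1 2, .define 110 .c, .define 111 .a, .fill 111 0 1, .define 52 .b, .define 51 .b,
   .define 114 .a, .define 115 .b, .fill 114 1 2, .define 113 .c, .define 116 .c, .fill 113 0 2,
   .define 114 .c, .define 115 .c, .fill 114 0 2, .define 120 .b, .define 121 .a, .define 122 .c,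
   .fill 120 3 3, .define 121 .c, .fill 122 0 2, .define 124 .b, .define 125 .a, .fill 125 1 1,
   .define 126 .c, .define 125 .c, .fill 126 0 2, .define 122 .b, .define 119 .b, .fill 120 1 2,
   .define 130 .c, .define 129 .c, .fill 130 0 2, .define 131 .b, .fill 131 2 1, .define 132 .b,
   .define 133 .a, .fill 133 0 1, .define 135 .b, .fill 133 1 2, .define 136 .c, .define 137 .a,
   .fill 137 0 1, .define 112 .b, .define 139 .c, .fill 112 2 2, .define 139 .a, .define 141 .c,
   .fill 139 0 2, .define 137 .b, .define 142 .b, .fill 140 1 2, .define 141 .b, .define 145 .a,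
   .fill 145 1 1, .define 143 .c, .define 144 .c, .fill 143 0 2, .define 145 .c, .define 146 .c,
   .fill 145 0 2, .define 147 .b, .define 106 .b, .define 151 .a, .fill 147 3 2, .define 152 .a,
   .fill 152 0 1, .define 105 .b, .define 155 .a, .fill 155 1 1, .define 153 .b, .fill 153 2 1,
   .define 148 .b, .fill 147 1 2, .fill 158 0 3, .define 156 .c, .fill 154 2 2, .define 159 .a,
   .fill 159 0 1, .define 160 .b, .fill 159 1 2, .define 117 .b, .fill 117 2 1, .fill 117 3 1,
   .fill 162 1 3, .define 128 .b, .fill 128 2 1, .define 163 .a, .fill 163 0 1, .define 164 .b,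
   .define 165 .a, .fill 165 1 1, .define 56 .b, .define 167 .a, .fill 167 1 1, .fill 56 3 2,
   .define 166 .c, .define 165 .c, .fill 166 0 2, .define 73 .b, .define 171 .c, .define 172 .a,
   .fill 171 3 24, .define 173 .c, .fill 172 0 2, .define 172 .b, .define 175 .a, .fill 175 1 1,
   .define 150 .b, .fill 150 2 1, .define 176 .c, .fill 175 0 2, .define 102 .b, .define 179 .c,
   .fill 102 2 2, .define 180 .a, .fill 180 1 1, .define 179 .a, .fill 179 0 1, .define 101 .b,
   .define 183 .c, .fill 101 2 2, .fill 183 3 25, .define 149 .b, .define 178 .b, .fill 177 1 2,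
   .define 185 .c, .fill 149 2 2, .define 186 .c, .fill 185 0 2, .define 188 .b, .fill 187 1 2,
   .define 189 .c, .fill 189 0 2, .fill 188 2 2]

theorem card_H_3_le : Finite (H 3) ∧ Nat.card (H 3) ≤ 6 :=
  card_le_of_enumeration (m := 1) (by decide) (l := enumerationThree) (by decide +kernel)

theorem card_H_4_le : Finite (H 4) ∧ Nat.card (H 4) ≤ 8 :=
  card_le_of_enumeration (m := 1) (by decide) (l := enumerationFour) (by decide +kernel)

theorem card_H_5_le : Finite (H 5) ∧ Nat.card (H 5) ≤ 60 :=
  card_le_of_enumeration (m := 6) (by decide) (l := enumerationFive) (by decide +kernel)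

theorem card_H_6_le : Finite (H 6) ∧ Nat.card (H 6) ≤ 108 :=
  card_le_of_enumeration (m := 9) (by decide) (l := enumerationSix) (by decide +kernel)

theorem card_H_7_le : Finite (H 7) ∧ Nat.card (H 7) ≤ 14 :=
  card_le_of_enumeration (m := 1) (by decide) (l := enumerationSeven) (by decide +kernel)

theorem card_H_8_le : Finite (H 8) ∧ Nat.card (H 8) ≤ 672 :=
  card_le_of_enumeration (m := 42) (by decide) (l := enumerationEight) (by decide +kernel)

theorem card_H_9_le : Finite (H 9) ∧ Nat.card (H 9) ≤ 3420 :=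
  card_le_of_enumeration (m := 190) (by decide) (l := enumerationNine) (by decide +kernel)

end Enumerations

end GeodesicSurface

namespace GeodesicSurface

/-! ### Permutations with cycles of constant length -/

section Cycles

variable {F : Type u} {σ : Equiv.Perm F} {n : ℕ}

theorem OnlyCycles.zpow_apply_eq_iff (h : OnlyCycles σ n) (x : F) (k : ℤ) :
    (σ ^ k) x = x ↔ (n : ℤ) ∣ k := by
  have := MulAction.zpow_smul_eq_iff_minimalPeriod_dvd (a := σ) (b := x) (n := k)
  rw [← h x]
  exact this

theorem OnlyCycles.pow_eq_one (h : OnlyCycles σ n) : σ ^ n = 1 := by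
  ext x
  have := (h.zpow_apply_eq_iff x n).2 dvd_rfl
  rwa [zpow_natCast] at this

theorem onlyCycles_of_pow_apply_eq_iff (h : ∀ x (k : ℕ), (σ ^ k) x = x ↔ n ∣ k) :
    OnlyCycles σ n := by
  intro x
  refine Nat.dvd_right_iff_eq.1 fun k => ?_
  rw [← h x k, ← Function.isPeriodicPt_iff_minimalPeriod_dvd, Function.IsPeriodicPt,
    Function.IsFixedPt, Equiv.Perm.iterate_eq_pow]

theorem IsFreeInvolution.onlyCycles (h : IsFreeInvolution σ) : OnlyCycles σ 2 := fun x =>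
  Function.minimalPeriod_eq_prime (p := 2) (h x).1 (h x).2

theorem IsFreeInvolution.mul_self (h : IsFreeInvolution σ) : σ * σ = 1 :=
  Equiv.ext fun x => (h x).1

/-- Each orbit of a group generated by two free involutions, whose product has only `n`-cycles,
consists of `2 * n` points. -/
theorem card_eq_card_orbits_mul [Nonempty F] {τ : Equiv.Perm F} (hσ : IsFreeInvolution σ)
    (hτ : IsFreeInvolution τ) (h : OnlyCycles (σ * τ) n) :
    Nat.card F =
      Nat.card (MulAction.orbitRel.Quotient (Subgroup.closure {σ, τ}) F) * (2 * n) := by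
  have hX : ∀ (x : F) (k : ℤ), (σ * τ) ^ k • x = x → (n : ℤ) ∣ k := fun x k =>
    (h.zpow_apply_eq_iff x k).1
  rw [← DihedralGroup.card_closure_eq (X := F) hσ.mul_self hτ.mul_self h.pow_eq_one
    (fun x => (hσ x).2) (fun x => (hτ x).2) hX, ← Nat.card_prod]
  refine Nat.card_congr (MulAction.selfEquivOrbitsQuotientProd fun x => ?_)
  rw [eq_bot_iff]
  rintro ⟨g, hg⟩ hgx
  exact Subtype.ext (DihedralGroup.eq_one_of_smul_eq (X := F) hσ.mul_self hτ.mul_self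
    h.pow_eq_one (fun x => (hσ x).2) (fun x => (hτ x).2) hX hg hgx)

end Cycles

namespace FlagSystem

variable {F : Type u} {G : Type v} {d : ℕ}

/-- The numbers of vertices, edges and faces in terms of the number of flags. -/
theorem IsDegreeSurface.hasCounts {S : FlagSystem F} (hS : S.IsDegreeSurface d) {v e f : ℕ}
    (hv : Nat.card F = v * (2 * d)) (he : Nat.card F = e * 4) (hf : Nat.card F = f * 6) :
    S.HasCounts v e f := by
  obtain ⟨⟨hα, hβ, hγ, _, _, hαβ, hαγ⟩, hd, hβγ⟩ := hS
  have h1 := card_eq_card_orbits_mul hβ hγ hβγ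
  have h2 := card_eq_card_orbits_mul hα hγ hαγ
  have h3 := card_eq_card_orbits_mul hα hβ hαβ
  exact ⟨Nat.eq_of_mul_eq_mul_right (by omega) (h1.symm.trans hv),
    Nat.eq_of_mul_eq_mul_right (by omega) (h2.symm.trans he),
    Nat.eq_of_mul_eq_mul_right (by omega) (h3.symm.trans hf)⟩

theorem HasCounts.eulerChar_eq {S : FlagSystem F} {v e f : ℕ} (h : S.HasCounts v e f) :
    S.eulerChar = v - e + f := by
  obtain ⟨h1, h2, h3⟩ := h
  rw [eulerChar, h1, h2, h3]

/-- The inverse isomorphism. -/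
def Iso.symm {S : FlagSystem F} {T : FlagSystem G} (e : Iso S T) : Iso T S where
  toEquiv := e.toEquiv.symm
  map_α x := by rw [Equiv.symm_apply_eq, e.map_α, Equiv.apply_symm_apply]
  map_β x := by rw [Equiv.symm_apply_eq, e.map_β, Equiv.apply_symm_apply]
  map_γ x := by rw [Equiv.symm_apply_eq, e.map_γ, Equiv.apply_symm_apply]

/-- The composition of isomorphisms. -/
def Iso.trans {K : Type*} {S : FlagSystem F} {T : FlagSystem G} {U : FlagSystem K} (e : Iso S T)
    (f : Iso T U) : Iso S U where
  toEquiv := e.toEquiv.trans f.toEquiv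
  map_α x := by simp [e.map_α, f.map_α]
  map_β x := by simp [e.map_β, f.map_β]
  map_γ x := by simp [e.map_γ, f.map_γ]

end FlagSystem

/-! ### The geodesic automorphism and conjugacy of subgroups -/

section Group

variable {d : ℕ}

theorem sharp_genA : sharp d (genA d) = genA d := PresentedGroup.toGroup.of _
theorem sharp_genB : sharp d (genB d) = genB d := PresentedGroup.toGroup.of _
theorem sharp_genC : sharp d (genC d) = genA d * genC d := PresentedGroup.toGroup.of _

theorem sharp_sharp (h : H d) : sharp d (sharp d h) = h := by
  have : (sharp d).comp (sharp d) = MonoidHom.id (H d) := by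
    refine PresentedGroup.ext fun g => ?_
    cases g
    · change sharp d (sharp d (genA d)) = genA d
      rw [sharp_genA, sharp_genA]
    · change sharp d (sharp d (genB d)) = genB d
      rw [sharp_genB, sharp_genB]
    · change sharp d (sharp d (genC d)) = genC d
      rw [sharp_genC, map_mul, sharp_genA, sharp_genC, ← mul_assoc, genA_mul_self, one_mul]
  exact DFunLike.congr_fun this h

theorem sharp_injective : Function.Injective (sharp d) :=
  Function.LeftInverse.injective sharp_sharp

theorem mem_map_sharp {V : Subgroup (H d)} {h : H d} : h ∈ V.map (sharp d) ↔ sharp d h ∈ V := by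
  constructor
  · rintro ⟨v, hv, rfl⟩
    rwa [sharp_sharp]
  · exact fun hh => ⟨_, hh, sharp_sharp h⟩

theorem mem_conjugate {V : Subgroup (H d)} {g h : H d} :
    h ∈ conjugate g V ↔ g⁻¹ * h * g ∈ V := by
  constructor
  · rintro ⟨v, hv, rfl⟩
    simpa [mul_assoc] using hv
  · exact fun hh => ⟨_, hh, by simp [mul_assoc]⟩

theorem card_conjugate (V : Subgroup (H d)) (g : H d) :
    Nat.card (conjugate g V) = Nat.card V :=
  Subgroup.card_map_of_injective (MulEquiv.injective _)

theorem card_map_sharp (V : Subgroup (H d)) : Nat.card (V.map (sharp d)) = Nat.card V :=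
  Subgroup.card_map_of_injective sharp_injective

theorem AreConjugate.card_eq {V W : Subgroup (H d)} (h : AreConjugate V W) :
    Nat.card V = Nat.card W := by
  obtain ⟨g, rfl⟩ := h
  exact (card_conjugate V g).symm

/-- The generators of the cyclic subgroups in the criterion. -/
def testElements (d : ℕ) : Set (H d) :=
  {genA d, genC d, genA d * genB d, genA d * genC d, genB d * genC d}

/-- No conjugate of a non-trivial power of a test element lies in `V`. -/
def Avoids (V : Subgroup (H d)) : Prop :=
  ∀ x ∈ testElements d, ∀ (g : H d) (k : ℤ), g * x ^ k * g⁻¹ ∈ V → x ^ k = 1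

theorem isGeodesicSurfaceSubgroup_iff {V : Subgroup (H d)} :
    IsGeodesicSurfaceSubgroup V ↔ Avoids V ∧ AreConjugate (V.map (sharp d)) V := by
  refine and_congr_left fun _ => ⟨fun h x hx g k hk => ?_, fun h g x hx => ?_⟩
  · rw [← Subgroup.mem_bot, ← h g x hx]
    exact ⟨mem_conjugate.2 (by rwa [inv_inv]), zpow_mem (Subgroup.mem_zpowers x) k⟩
  · rw [eq_bot_iff]
    rintro _ ⟨hy, k, rfl⟩
    exact h x hx g k (by simpa using mem_conjugate.1 hy)

/-- The orders of the relevant elements of `H_d` are those prescribed by the presentation. -/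
structure HasFullOrders (d : ℕ) : Prop where
  three_le : 3 ≤ d
  orderOf_a : orderOf (genA d) = 2
  orderOf_c : orderOf (genC d) = 2
  orderOf_ab : orderOf (genA d * genB d) = 3
  orderOf_ac : orderOf (genA d * genC d) = 2
  orderOf_bc : orderOf (genB d * genC d) = d

theorem genB_eq_conj : genB d = (genA d * genB d) * genA d * (genA d * genB d)⁻¹ := by
  have h := genAB_pow (d := d)
  rw [pow_succ, pow_two, mul_eq_one_iff_eq_inv] at h
  rw [← h]
  simp only [mul_assoc]
  rw [← mul_assoc (genA d) (genA d), genA_mul_self, one_mul, ← mul_assoc (genB d) (genB d),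
    genB_mul_self, one_mul, ← mul_assoc (genA d) (genA d), genA_mul_self, one_mul]

end Group

/-! ### Surfaces and subgroups -/

section Correspondence

variable {d : ℕ}

theorem coset_smul_eq_iff {V : Subgroup (H d)} {h g : H d} :
    h • (g : H d ⧸ V) = g ↔ g⁻¹ * h * g ∈ V := by
  rw [MulAction.Quotient.smul_coe, smul_eq_mul, eq_comm, QuotientGroup.eq, mul_assoc]

/-- A test element acts on the cosets of an avoiding subgroup with cycles of constant length. -/
theorem Avoids.onlyCycles {V : Subgroup (H d)} (hV : Avoids V) {x : H d}
    (hx : x ∈ testElements d) :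
    OnlyCycles (MulAction.toPerm x : Equiv.Perm (H d ⧸ V)) (orderOf x) := by
  refine onlyCycles_of_pow_apply_eq_iff fun q k => ?_
  obtain ⟨g, rfl⟩ := QuotientGroup.mk_surjective q
  have h1 : (MulAction.toPerm x : Equiv.Perm (H d ⧸ V)) ^ k = MulAction.toPerm (x ^ k) :=
    (map_pow (MulAction.toPermHom (H d) (H d ⧸ V)) x k).symm
  rw [h1, MulAction.toPerm_apply, coset_smul_eq_iff, orderOf_dvd_iff_pow_eq_one]
  constructor
  · intro h
    have := hV x hx g⁻¹ k (by rwa [inv_inv, zpow_natCast])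
    rwa [zpow_natCast] at this
  · intro h
    rw [h, mul_one, inv_mul_cancel]
    exact V.one_mem

theorem isFreeInvolution_of_onlyCycles {F : Type u} {σ : Equiv.Perm F} (h : OnlyCycles σ 2) :
    IsFreeInvolution σ := by
  intro x
  have h1 := (h.zpow_apply_eq_iff x 2).2 (by norm_num)
  have h2 := mt (h.zpow_apply_eq_iff x 1).1 (by norm_num)
  exact ⟨h1, by simpa using h2⟩

theorem toPerm_mul {V : Subgroup (H d)} (x y : H d) :
    (MulAction.toPerm x * MulAction.toPerm y : Equiv.Perm (H d ⧸ V)) = MulAction.toPerm (x * y) :=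
  (map_mul (MulAction.toPermHom (H d) (H d ⧸ V)) x y).symm

theorem Avoids.isDegreeSurface (ho : HasFullOrders d) {V : Subgroup (H d)} (hV : Avoids V) :
    (cosetSystem V).IsDegreeSurface d := by
  have hα : IsFreeInvolution (cosetSystem V).α := isFreeInvolution_of_onlyCycles
    (ho.orderOf_a ▸ hV.onlyCycles (x := genA d) (by simp [testElements]))
  have hγ : IsFreeInvolution (cosetSystem V).γ := isFreeInvolution_of_onlyCycles
    (ho.orderOf_c ▸ hV.onlyCycles (x := genC d) (by simp [testElements]))
  have hαβ : OnlyCycles ((cosetSystem V).α * (cosetSystem V).β) 3 := by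
    have := hV.onlyCycles (x := genA d * genB d) (by simp [testElements])
    rwa [ho.orderOf_ab, ← toPerm_mul] at this
  have hαγ : OnlyCycles ((cosetSystem V).α * (cosetSystem V).γ) 2 := by
    have := hV.onlyCycles (x := genA d * genC d) (by simp [testElements])
    rwa [ho.orderOf_ac, ← toPerm_mul] at this
  have hβγ : OnlyCycles ((cosetSystem V).β * (cosetSystem V).γ) d := by
    have := hV.onlyCycles (x := genB d * genC d) (by simp [testElements])
    rwa [ho.orderOf_bc, ← toPerm_mul] at this
  refine ⟨⟨hα, fun q => ⟨?_, fun hq => ?_⟩, hγ, ⟨((1 : H d) : H d ⧸ V)⟩, ⟨fun p q => ?_⟩,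
    hαβ, hαγ⟩, ho.three_le, hβγ⟩
  · change genB d • genB d • q = q
    rw [smul_smul, genB_mul_self, one_smul]
  · refine (hα ((genA d * genB d)⁻¹ • q)).2 ?_
    change genB d • q = q at hq
    change genA d • (genA d * genB d)⁻¹ • q = (genA d * genB d)⁻¹ • q
    rw [eq_inv_smul_iff, smul_smul, smul_smul, ← genB_eq_conj, hq]
  · obtain ⟨h, rfl⟩ := MulAction.exists_smul_eq (H d) p q
    refine ⟨⟨MulAction.toPermHom (H d) (H d ⧸ V) h, ?_⟩, rfl⟩
    have hmem : h ∈ Subgroup.closure (Set.range (gen d)) :=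
      closure_range_gen ▸ Subgroup.mem_top h
    have hmap := Subgroup.mem_map_of_mem (MulAction.toPermHom (H d) (H d ⧸ V)) hmem
    rw [MonoidHom.map_closure] at hmap
    refine Subgroup.closure_mono ?_ hmap
    rintro _ ⟨_, ⟨g, rfl⟩, rfl⟩
    cases g
    exacts [.inl rfl, .inr (.inl rfl), .inr (.inr rfl)]

theorem isGeodesicSelfDual_of_areConjugate {V : Subgroup (H d)}
    (hV : AreConjugate (V.map (sharp d)) V) : (cosetSystem V).IsGeodesicSelfDual := by
  obtain ⟨g, hg⟩ := hV
  have hmem : ∀ h, h ∈ V ↔ g * sharp d h * g⁻¹ ∈ V := by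
    intro h
    conv_rhs => rw [← hg, mem_conjugate, mem_map_sharp]
    simp [mul_assoc, sharp_sharp]
  have hiff : ∀ h k : H d, ((h : H d ⧸ V) = k) ↔
      ((sharp d h * g⁻¹ : H d) : H d ⧸ V) = (sharp d k * g⁻¹ : H d) := by
    intro h k
    rw [QuotientGroup.eq, QuotientGroup.eq, hmem]
    simp [mul_assoc]
  let f : H d ⧸ V → H d ⧸ V := Quotient.lift (fun h => ((sharp d h * g⁻¹ : H d) : H d ⧸ V))
    fun h k hhk => (hiff h k).1 (Quotient.sound hhk)
  have hf : ∀ h : H d, f (h : H d ⧸ V) = (sharp d h * g⁻¹ : H d) := fun h => rfl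
  have hbij : Function.Bijective f := by
    constructor
    · intro p q hpq
      obtain ⟨h, rfl⟩ := QuotientGroup.mk_surjective p
      obtain ⟨k, rfl⟩ := QuotientGroup.mk_surjective q
      exact (hiff h k).2 hpq
    · intro q
      obtain ⟨k, rfl⟩ := QuotientGroup.mk_surjective q
      exact ⟨(sharp d (k * g) : H d), by rw [hf, sharp_sharp, mul_inv_cancel_right]⟩
  have hsmul : ∀ (h : H d) (q : H d ⧸ V), f (h • q) = sharp d h • f q := by
    intro h q
    obtain ⟨k, rfl⟩ := QuotientGroup.mk_surjective q
    rw [MulAction.Quotient.smul_coe, hf, hf, MulAction.Quotient.smul_coe, smul_eq_mul,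
      smul_eq_mul, map_mul, mul_assoc]
  refine ⟨⟨Equiv.ofBijective f hbij, fun q => ?_, fun q => ?_, fun q => ?_⟩⟩
  · exact (hsmul _ q).trans (by rw [sharp_genA]; rfl)
  · exact (hsmul _ q).trans (by rw [sharp_genB]; rfl)
  · exact (hsmul _ q).trans (by rw [sharp_genC, mul_smul]; rfl)

/-- Conjugate subgroups yield isomorphic coset systems. -/
theorem AreConjugate.nonempty_iso {V W : Subgroup (H d)} (h : AreConjugate V W) :
    Nonempty (FlagSystem.Iso (cosetSystem V) (cosetSystem W)) := by
  obtain ⟨g, rfl⟩ := h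
  have hiff : ∀ h k : H d, ((h : H d ⧸ V) = k) ↔
      ((h * g⁻¹ : H d) : H d ⧸ conjugate g V) = (k * g⁻¹ : H d) := by
    intro h k
    rw [QuotientGroup.eq, QuotientGroup.eq, mem_conjugate]
    simp [mul_assoc]
  let f : H d ⧸ V → H d ⧸ conjugate g V :=
    Quotient.lift (fun h => ((h * g⁻¹ : H d) : H d ⧸ conjugate g V))
      fun h k hhk => (hiff h k).1 (Quotient.sound hhk)
  have hf : ∀ h : H d, f (h : H d ⧸ V) = (h * g⁻¹ : H d) := fun h => rfl
  have hbij : Function.Bijective f := by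
    constructor
    · intro p q hpq
      obtain ⟨h, rfl⟩ := QuotientGroup.mk_surjective p
      obtain ⟨k, rfl⟩ := QuotientGroup.mk_surjective q
      exact (hiff h k).2 hpq
    · intro q
      obtain ⟨k, rfl⟩ := QuotientGroup.mk_surjective q
      exact ⟨(k * g : H d), by rw [hf, mul_inv_cancel_right]⟩
  have hsmul : ∀ (h : H d) (q : H d ⧸ V), f (h • q) = h • f q := by
    intro h q
    obtain ⟨k, rfl⟩ := QuotientGroup.mk_surjective q
    rw [MulAction.Quotient.smul_coe, hf, hf, MulAction.Quotient.smul_coe, smul_eq_mul,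
      smul_eq_mul, mul_assoc]
  exact ⟨⟨Equiv.ofBijective f hbij, hsmul _, hsmul _, hsmul _⟩⟩

/-- An isomorphism of coset systems commutes with the action of the whole group. -/
theorem iso_smul {V W : Subgroup (H d)} (e : FlagSystem.Iso (cosetSystem V) (cosetSystem W))
    (h : H d) (q : H d ⧸ V) : e.toEquiv (h • q) = h • e.toEquiv q := by
  have hh : h ∈ Subgroup.closure (Set.range (gen d)) := closure_range_gen ▸ Subgroup.mem_top h
  induction hh using Subgroup.closure_induction'' generalizing q with
  | mem x hx =>
    obtain ⟨g, rfl⟩ := hx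
    cases g
    exacts [e.map_α q, e.map_β q, e.map_γ q]
  | inv_mem x hx =>
    obtain ⟨g, rfl⟩ := hx
    rw [inv_eq_of_mul_eq_one_right (gen_mul_self g)]
    cases g
    exacts [e.map_α q, e.map_β q, e.map_γ q]
  | one => rw [one_smul, one_smul]
  | mul x y _ _ hx hy => rw [mul_smul, hx, hy, mul_smul]

theorem areConjugate_of_iso {V W : Subgroup (H d)}
    (e : FlagSystem.Iso (cosetSystem V) (cosetSystem W)) : AreConjugate V W := by
  obtain ⟨g, hg⟩ := QuotientGroup.mk_surjective (e.toEquiv ((1 : H d) : H d ⧸ V))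
  refine ⟨g⁻¹, ?_⟩
  ext h
  rw [mem_conjugate, inv_inv]
  have h1 : g * h * g⁻¹ ∈ V ↔ (g * h * g⁻¹) • ((1 : H d) : H d ⧸ V) = (1 : H d) := by
    rw [coset_smul_eq_iff]; simp
  rw [h1, ← e.toEquiv.apply_eq_iff_eq, iso_smul, ← hg]
  change (g * h * g⁻¹) • (g : H d ⧸ W) = g ↔ _
  rw [coset_smul_eq_iff]
  simp [mul_assoc]

end Correspondence

end GeodesicSurface

namespace GeodesicSurface

/-! ### The subgroup of a surface -/

section FromSurface

variable {F : Type u} {S : FlagSystem F} {d : ℕ}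

namespace FlagSystem

theorem IsDegreeSurface.onlyCycles_dual (hS : S.IsDegreeSurface d) (e : Iso S S.dual) :
    OnlyCycles (S.β * (S.α * S.γ)) d := by
  intro y
  obtain ⟨x, rfl⟩ := e.toEquiv.surjective y
  rw [← hS.degree x, Function.minimalPeriod_eq_minimalPeriod_iff]
  have hstep : ∀ z, e.toEquiv ((S.β * S.γ) z) = (S.β * (S.α * S.γ)) (e.toEquiv z) := fun z =>
    (e.map_β _).trans (congrArg S.β (e.map_γ z))
  intro n
  have hn : ∀ z, e.toEquiv ((⇑(S.β * S.γ))^[n] z) =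
      (⇑(S.β * (S.α * S.γ)))^[n] (e.toEquiv z) := fun z =>
    (Function.Semiconj.iterate_right (f := e.toEquiv) hstep n) z
  rw [Function.IsPeriodicPt, Function.IsFixedPt, ← hn, e.toEquiv.apply_eq_iff_eq]
  rfl

/-- The permutations of a flag system, indexed by the generators of `H_d`. -/
def perm (S : FlagSystem F) : Gen → Equiv.Perm F
  | .a => S.α
  | .b => S.β
  | .c => S.γ

theorem IsDegreeSurface.lift_relators (hS : S.IsDegreeSurface d) (e : Iso S S.dual) :
    ∀ r ∈ relators d, FreeGroup.lift S.perm r = 1 := by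
  intro r hr
  simp only [relators, Set.mem_insert_iff, Set.mem_singleton_iff] at hr
  rcases hr with rfl | rfl | rfl | rfl | rfl | rfl | rfl <;>
    simp only [map_pow, map_mul, FreeGroup.lift_apply_of, perm]
  · exact hS.isSurface.involution_α.onlyCycles.pow_eq_one
  · exact hS.isSurface.involution_β.onlyCycles.pow_eq_one
  · exact hS.isSurface.involution_γ.onlyCycles.pow_eq_one
  · exact hS.isSurface.triangles.pow_eq_one
  · exact hS.isSurface.two_faces.pow_eq_one
  · exact hS.degree.pow_eq_one
  · rw [mul_assoc]
    exact (hS.onlyCycles_dual e).pow_eq_one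

/-- The action of `H_d` on the flags of a geodesic self-dual degree-`d`-surface. -/
def IsDegreeSurface.hom (hS : S.IsDegreeSurface d) (e : Iso S S.dual) : H d →* Equiv.Perm F :=
  PresentedGroup.toGroup (hS.lift_relators e)

theorem IsDegreeSurface.hom_gen (hS : S.IsDegreeSurface d) (e : Iso S S.dual) (g : Gen) :
    hS.hom e (gen d g) = S.perm g :=
  PresentedGroup.toGroup.of _

/-- Test elements act on the flags with cycles of constant length. -/
theorem IsDegreeSurface.exists_onlyCycles (hS : S.IsDegreeSurface d) (e : Iso S S.dual)
    {x : H d} (hx : x ∈ testElements d) : ∃ n, x ^ n = 1 ∧ OnlyCycles (hS.hom e x) n := by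
  have ha : hS.hom e (genA d) = S.α := hS.hom_gen e .a
  have hb : hS.hom e (genB d) = S.β := hS.hom_gen e .b
  have hc : hS.hom e (genC d) = S.γ := hS.hom_gen e .c
  rcases hx with rfl | rfl | rfl | rfl | rfl
  · exact ⟨2, by rw [pow_two, genA_mul_self], by
      rw [ha]; exact hS.isSurface.involution_α.onlyCycles⟩
  · exact ⟨2, by rw [pow_two, genC_mul_self], by
      rw [hc]; exact hS.isSurface.involution_γ.onlyCycles⟩
  · exact ⟨3, genAB_pow, by rw [map_mul, ha, hb]; exact hS.isSurface.triangles⟩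
  · exact ⟨2, genAC_pow, by rw [map_mul, ha, hc]; exact hS.isSurface.two_faces⟩
  · exact ⟨d, genBC_pow, by rw [map_mul, hb, hc]; exact hS.degree⟩

theorem IsDegreeSurface.hasFullOrders (hS : S.IsDegreeSurface d) (e : Iso S S.dual) :
    HasFullOrders d := by
  have ha : hS.hom e (genA d) = S.α := hS.hom_gen e .a
  have hb : hS.hom e (genB d) = S.β := hS.hom_gen e .b
  have hc : hS.hom e (genC d) = S.γ := hS.hom_gen e .c
  obtain ⟨x₀⟩ := hS.isSurface.nonempty
  have key : ∀ (x : H d) (n : ℕ), x ^ n = 1 → OnlyCycles (hS.hom e x) n → orderOf x = n := by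
    intro x n h1 h2
    refine Nat.dvd_antisymm (orderOf_dvd_of_pow_eq_one h1) ?_
    rw [← Int.natCast_dvd_natCast, ← h2.zpow_apply_eq_iff x₀, zpow_natCast, ← map_pow,
      pow_orderOf_eq_one, map_one, Equiv.Perm.one_apply]
  refine ⟨hS.three_le, key _ _ (by rw [pow_two, genA_mul_self]) ?_,
    key _ _ (by rw [pow_two, genC_mul_self]) ?_, key _ _ genAB_pow ?_, key _ _ genAC_pow ?_,
    key _ _ genBC_pow ?_⟩
  · rw [ha]; exact hS.isSurface.involution_α.onlyCycles
  · rw [hc]; exact hS.isSurface.involution_γ.onlyCycles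
  · rw [map_mul, ha, hb]; exact hS.isSurface.triangles
  · rw [map_mul, ha, hc]; exact hS.isSurface.two_faces
  · rw [map_mul, hb, hc]; exact hS.degree

theorem IsDegreeSurface.exists_hom_apply_eq (hS : S.IsDegreeSurface d) (e : Iso S S.dual)
    (x y : F) : ∃ h : H d, hS.hom e h x = y := by
  have := hS.isSurface.transitive
  obtain ⟨⟨g, hg⟩, rfl⟩ := MulAction.exists_smul_eq S.monodromy x y
  have hle : S.monodromy ≤ (hS.hom e).range := by
    rw [monodromy, Subgroup.closure_le]
    rintro _ (rfl | rfl | rfl)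
    exacts [⟨_, hS.hom_gen e .a⟩, ⟨_, hS.hom_gen e .b⟩, ⟨_, hS.hom_gen e .c⟩]
  obtain ⟨h, rfl⟩ := hle hg
  exact ⟨h, rfl⟩

/-- The isomorphism with the geodesic dual is semilinear with respect to the geodesic
automorphism. -/
theorem IsDegreeSurface.iso_hom_apply (hS : S.IsDegreeSurface d) (e : Iso S S.dual)
    (h : H d) (x : F) : e.toEquiv (hS.hom e h x) = hS.hom e (sharp d h) (e.toEquiv x) := by
  have hgen : ∀ (g : Gen) x, e.toEquiv (hS.hom e (gen d g) x) =
      hS.hom e (sharp d (gen d g)) (e.toEquiv x) := by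
    intro g x
    rw [hS.hom_gen]
    cases g
    · rw [gen_a, sharp_genA, ← gen_a, hS.hom_gen]
      exact e.map_α x
    · rw [gen_b, sharp_genB, ← gen_b, hS.hom_gen]
      exact e.map_β x
    · rw [gen_c, sharp_genC, map_mul, ← gen_a, ← gen_c, hS.hom_gen, hS.hom_gen]
      exact e.map_γ x
  have hh : h ∈ Subgroup.closure (Set.range (gen d)) := closure_range_gen ▸ Subgroup.mem_top h
  induction hh using Subgroup.closure_induction'' generalizing x with
  | mem y hy =>
    obtain ⟨g, rfl⟩ := hy
    exact hgen g x
  | inv_mem y hy =>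
    obtain ⟨g, rfl⟩ := hy
    rw [inv_eq_of_mul_eq_one_right (gen_mul_self g)]
    exact hgen g x
  | one => simp
  | mul y z _ _ hy hz => rw [map_mul, Equiv.Perm.mul_apply, hy, hz, map_mul, map_mul]; rfl

/-- Every geodesic self-dual degree-`d`-surface arises from a subgroup as in the criterion,
namely from the stabilizer of a flag. -/
theorem IsDegreeSurface.exists_subgroup (hS : S.IsDegreeSurface d) (e : Iso S S.dual) :
    ∃ V : Subgroup (H d), IsGeodesicSurfaceSubgroup V ∧ Nonempty (Iso S (cosetSystem V)) := by
  obtain ⟨x₀⟩ := hS.isSurface.nonempty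
  let V : Subgroup (H d) := (MulAction.stabilizer (Equiv.Perm F) x₀).comap (hS.hom e)
  have hV : ∀ h, h ∈ V ↔ hS.hom e h x₀ = x₀ := fun h => Iff.rfl
  refine ⟨V, isGeodesicSurfaceSubgroup_iff.2 ⟨fun x hx g k hk => ?_, ?_⟩, ?_⟩
  · obtain ⟨n, hn, hc⟩ := hS.exists_onlyCycles e hx
    rw [hV, map_mul, map_mul, map_inv, Equiv.Perm.mul_apply, Equiv.Perm.mul_apply,
      ← Equiv.Perm.eq_inv_iff_eq, map_zpow, hc.zpow_apply_eq_iff] at hk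
    obtain ⟨m, rfl⟩ := hk
    rw [zpow_mul, zpow_natCast, hn, one_zpow]
  · -- the stabilizer of the image of `x₀` is both `#V` and a conjugate of `V`
    obtain ⟨t, ht⟩ := hS.exists_hom_apply_eq e (e.toEquiv x₀) x₀
    refine ⟨t, ?_⟩
    ext h
    rw [mem_conjugate, mem_map_sharp, hV, ← e.toEquiv.apply_eq_iff_eq, hS.iso_hom_apply,
      sharp_sharp, map_mul, map_mul, map_inv, Equiv.Perm.mul_apply, Equiv.Perm.mul_apply, ht,
      Equiv.Perm.inv_eq_iff_eq, ht, hV]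
  · have hiff : ∀ h k : H d, ((h : H d ⧸ V) = k) ↔ hS.hom e h x₀ = hS.hom e k x₀ := by
      intro h k
      rw [QuotientGroup.eq, hV, map_mul, map_inv, Equiv.Perm.mul_apply,
        Equiv.Perm.inv_eq_iff_eq, eq_comm]
    let f : H d ⧸ V → F := Quotient.lift (fun h => hS.hom e h x₀)
      fun h k hhk => (hiff h k).1 (Quotient.sound hhk)
    have hf : ∀ h : H d, f (h : H d ⧸ V) = hS.hom e h x₀ := fun h => rfl
    have hbij : Function.Bijective f := by
      constructor
      · intro p q hpq
        obtain ⟨h, rfl⟩ := QuotientGroup.mk_surjective p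
        obtain ⟨k, rfl⟩ := QuotientGroup.mk_surjective q
        exact (hiff h k).2 hpq
      · intro y
        obtain ⟨h, hh⟩ := hS.exists_hom_apply_eq e x₀ y
        exact ⟨h, hh⟩
    have hsmul : ∀ (g : Gen) (q : H d ⧸ V), f (gen d g • q) = S.perm g (f q) := by
      intro g q
      obtain ⟨k, rfl⟩ := QuotientGroup.mk_surjective q
      rw [MulAction.Quotient.smul_coe, hf, hf, smul_eq_mul, map_mul, hS.hom_gen]
      rfl
    exact ⟨Iso.symm ⟨Equiv.ofBijective f hbij, hsmul .a, hsmul .b, hsmul .c⟩⟩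

end FlagSystem

end FromSurface

/-! ### Orientability -/

section Orientability

variable {d : ℕ}

/-- A word of odd length in the subgroup obstructs orientability. -/
theorem not_isOrientable_of_odd_word {V : Subgroup (H d)} (l : List Gen)
    (hodd : l.length.bodd = true) (hl : word d l ∈ V) : ¬ (cosetSystem V).IsOrientable := by
  rintro ⟨s, hs⟩
  have hgen : ∀ (g : Gen) (q : H d ⧸ V), s (gen d g • q) = !s q := by
    intro g q
    rw [Bool.eq_not]
    cases g
    exacts [(hs q).1, (hs q).2.1, (hs q).2.2]
  have hword : ∀ (l : List Gen) (q : H d ⧸ V), s (word d l • q) = (s q ^^ l.length.bodd) := by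
    intro l q
    induction l with
    | nil => simp [word]
    | cons g l ih =>
      rw [word_cons, mul_smul, hgen, ih, List.length_cons, Nat.bodd_succ, Bool.xor_not]
  have h1 := hword l ((1 : H d) : H d ⧸ V)
  rw [coset_smul_eq_iff.2 (by simpa using hl), hodd] at h1
  simp at h1

/-- For odd `d` the relator `(bac) ^ d` has odd length. -/
theorem not_isOrientable_of_odd (hd : Odd d) (V : Subgroup (H d)) :
    ¬ (cosetSystem V).IsOrientable := by
  refine not_isOrientable_of_odd_word (List.replicate d [Gen.b, Gen.a, Gen.c]).flatten ?_ ?_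
  · obtain ⟨k, rfl⟩ := hd
    simp [Nat.bodd_mul, Nat.bodd_add, show Nat.bodd 2 = false from rfl]
  · rw [word_of_mem_relatorWords (by simp [relatorWords])]
    exact V.one_mem

/-- For even `d`, the homomorphism that sends the three generators to `-1`. -/
def signHom (hd : Even d) : H d →* ℤˣ :=
  PresentedGroup.toGroup (f := fun _ => -1) (by
    intro r hr
    simp only [relators, Set.mem_insert_iff, Set.mem_singleton_iff] at hr
    rcases hr with rfl | rfl | rfl | rfl | rfl | rfl | rfl <;>
      simp [hd.neg_one_pow])

theorem signHom_gen (hd : Even d) (g : Gen) : signHom hd (gen d g) = -1 :=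
  PresentedGroup.toGroup.of _

theorem isOrientable_of_le_ker (hd : Even d) {V : Subgroup (H d)} (hV : V ≤ (signHom hd).ker) :
    (cosetSystem V).IsOrientable := by
  let f : H d ⧸ V → ℤˣ := Quotient.lift (signHom hd) fun h k hhk => by
    have h1 : signHom hd (h⁻¹ * k) = 1 := hV (QuotientGroup.leftRel_apply.1 hhk)
    rw [map_mul, map_inv, inv_mul_eq_one] at h1
    exact h1
  have hf : ∀ (g : Gen) (q : H d ⧸ V), f (gen d g • q) = - f q := by
    intro g q
    obtain ⟨h, rfl⟩ := QuotientGroup.mk_surjective q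
    change signHom hd (gen d g * h) = - signHom hd h
    rw [map_mul, signHom_gen, neg_one_mul]
  have hne : ∀ (g : Gen) (q : H d ⧸ V),
      decide (f (gen d g • q) = 1) ≠ decide (f q = 1) := by
    intro g q
    rw [hf]
    rcases Int.units_eq_one_or (f q) with h | h <;> rw [h] <;> decide
  exact ⟨fun q => decide (f q = 1), fun q => ⟨hne .a q, hne .b q, hne .c q⟩⟩

/-- Elements of odd order lie in the kernel of the sign homomorphism. -/
theorem isOrientable_of_odd_card (hd : Even d) [Finite (H d)] {V : Subgroup (H d)}
    (hV : Odd (Nat.card V)) : (cosetSystem V).IsOrientable := by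
  refine isOrientable_of_le_ker hd fun v hv => ?_
  have h1 : v ^ Nat.card V = 1 :=
    congrArg Subtype.val (pow_card_eq_one' (G := V) (x := ⟨v, hv⟩))
  have h2 : signHom hd v ^ Nat.card V = 1 := by rw [← map_pow, h1, map_one]
  rcases Int.units_eq_one_or (signHom hd v) with h | h
  · exact h
  · rw [h, hV.neg_one_pow] at h2
    exact absurd h2 (by decide)

end Orientability

/-! ### From the classification of subgroups to the classification of surfaces -/

section Classification

variable {d : ℕ}

/-- Only the list of subgroups has to be verified. Subgroups of different orders are not conjugate,
so it suffices that the orders in the list are distinct. -/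
theorem isClassification_of_subgroups (ho : HasFullOrders d) {n : ℕ}
    {V : Fin n → Subgroup (H d)} (hV : ∀ i, Avoids (V i))
    (hsharp : ∀ i, AreConjugate ((V i).map (sharp d)) (V i))
    (hinj : Function.Injective fun i => Nat.card (V i))
    (hall : ∀ W : Subgroup (H d), IsGeodesicSurfaceSubgroup W → ∃ i, AreConjugate W (V i)) :
    IsClassification.{u} d V where
  criterion i := isGeodesicSurfaceSubgroup_iff.2 ⟨hV i, hsharp i⟩
  not_conjugate i j hij h := hij (hinj h.card_eq)
  all_subgroups := hall
  isDegreeSurface i := (hV i).isDegreeSurface ho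
  isGeodesicSelfDual i := isGeodesicSelfDual_of_areConjugate (hsharp i)
  not_isomorphic i j hij h := hij (hinj (h.elim areConjugate_of_iso).card_eq)
  all_surfaces F S hS hdual := by
    obtain ⟨e⟩ := hdual
    obtain ⟨W, hW, ⟨f⟩⟩ := hS.exists_subgroup e
    obtain ⟨i, hi⟩ := hall W hW
    obtain ⟨g⟩ := hi.nonempty_iso
    exact ⟨i, ⟨f.trans g⟩⟩

theorem HasFullOrders.orderOf_b (ho : HasFullOrders d) : orderOf (genB d) = 2 := by
  rw [genB_eq_conj, ← MulAut.conj_apply, MulEquiv.orderOf_eq, ho.orderOf_a]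

theorem HasFullOrders.card_closure_ac (ho : HasFullOrders d) :
    Nat.card (Subgroup.closure {genA d, genC d}) = 4 := by
  rw [DihedralGroup.card_closure_of_orderOf ho.orderOf_a ho.orderOf_c, ho.orderOf_ac]

theorem HasFullOrders.card_closure_bc (ho : HasFullOrders d) :
    Nat.card (Subgroup.closure {genB d, genC d}) = 2 * d := by
  rw [DihedralGroup.card_closure_of_orderOf ho.orderOf_b ho.orderOf_c, ho.orderOf_bc]

theorem HasFullOrders.four_dvd_card (ho : HasFullOrders d) : 4 ∣ Nat.card (H d) :=
  ho.card_closure_ac ▸ Subgroup.card_subgroup_dvd_card _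

theorem HasFullOrders.two_mul_dvd_card (ho : HasFullOrders d) : 2 * d ∣ Nat.card (H d) :=
  ho.card_closure_bc ▸ Subgroup.card_subgroup_dvd_card _

theorem HasFullOrders.three_dvd_card (ho : HasFullOrders d) : 3 ∣ Nat.card (H d) :=
  ho.orderOf_ab ▸ orderOf_dvd_natCard _

/-- There are no surfaces if `H_d` is too small: a surface forces `12` and `2 * d` to divide the
order of `H_d`, which the bound `2 * d` does not permit for `d = 3`, `4`, `7`. -/
theorem not_isGeodesicSelfDual_of_card (hcard : Finite (H d) ∧ Nat.card (H d) ≤ 2 * d * 1)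
    (hd : d = 3 ∨ d = 4 ∨ d = 7) {F : Type u} {S : FlagSystem F} (hS : S.IsDegreeSurface d) :
    ¬ S.IsGeodesicSelfDual := by
  rintro ⟨e⟩
  have ho := hS.hasFullOrders e
  obtain ⟨hfin, hle⟩ := hcard
  have h1 : 0 < Nat.card (H d) := Nat.card_pos
  have h2 := ho.four_dvd_card
  have h3 := ho.three_dvd_card
  have h4 := Nat.le_of_dvd h1 (Nat.Coprime.mul_dvd_of_dvd_of_dvd (by norm_num) h2 h3)
  obtain ⟨k, hk⟩ := ho.two_mul_dvd_card
  rcases hd with rfl | rfl | rfl <;> omega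

end Classification

end GeodesicSurface

/-! ### Consequences of Sylow's theorems -/

/-- If `K` has the order of a Sylow `p`-subgroup, then each `p`-subgroup is conjugate to a subgroup
of `K`. -/
theorem IsPGroup.exists_conj_mem {G : Type u} [Group G] [Finite G] {p : ℕ} [Fact p.Prime]
    {K Q : Subgroup G} (hQ : IsPGroup p Q)
    (hK : Nat.card K = p ^ (Nat.card G).factorization p) :
    ∃ g : G, ∀ x ∈ Q, g * x * g⁻¹ ∈ K := by
  obtain ⟨P, hP⟩ := hQ.exists_le_sylow
  obtain ⟨g, hg⟩ := MulAction.exists_smul_eq G P (Sylow.ofCard K hK)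
  refine ⟨g, fun x hx => ?_⟩
  have h1 : g * x * g⁻¹ ∈ (g • P : Sylow p G) :=
    Subgroup.smul_mem_pointwise_smul x (MulAut.conj g) _ (hP hx)
  rw [hg] at h1
  exact h1

namespace GeodesicSurface

section Subgroups

variable {d : ℕ}

theorem factorization_eq_of_eq_mul {n p k m : ℕ} (hp : p.Prime) (hn : n = p ^ k * m)
    (hm : ¬ p ∣ m) : n.factorization p = k := by
  have hm0 : m ≠ 0 := fun h => hm (h ▸ dvd_zero p)
  rw [hn, Nat.factorization_mul (pow_ne_zero _ hp.ne_zero) hm0, Finsupp.add_apply,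
    hp.factorization_pow, Finsupp.single_eq_same, Nat.factorization_eq_zero_of_not_dvd hm, add_zero]

theorem dvd_of_dvd_pow_mul {n p k m : ℕ} (hp : p.Prime) (h : n ∣ p ^ k * m) (hn : ¬ p ∣ n) :
    n ∣ m :=
  (Nat.Coprime.pow_right k ((hp.coprime_iff_not_dvd.2 hn).symm)).dvd_of_dvd_mul_left h

theorem HasFullOrders.gens_ne_one (ho : HasFullOrders d) :
    genA d ≠ 1 ∧ genB d ≠ 1 ∧ genC d ≠ 1 := by
  refine ⟨fun h => ?_, fun h => ?_, fun h => ?_⟩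
  · have := ho.orderOf_a
    simp [h] at this
  · have := ho.orderOf_b
    simp [h] at this
  · have := ho.orderOf_c
    simp [h] at this

theorem Avoids.eq_one_of_zpow {W : Subgroup (H d)} (hW : Avoids W) {x : H d}
    (hx : x ∈ testElements d) {y : H d} (hy : y ∈ Subgroup.zpowers x) {g : H d}
    (hg : g * y * g⁻¹ ∈ W) : y = 1 := by
  obtain ⟨k, rfl⟩ := hy
  exact hW x hx g k hg

theorem Avoids.conj_genA_notMem (ho : HasFullOrders d) {W : Subgroup (H d)} (hW : Avoids W)
    (g : H d) : g * genA d * g⁻¹ ∉ W := fun h =>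
  ho.gens_ne_one.1
    (hW.eq_one_of_zpow (by simp [testElements]) (Subgroup.mem_zpowers (genA d)) h)

theorem Avoids.conj_genC_notMem (ho : HasFullOrders d) {W : Subgroup (H d)} (hW : Avoids W)
    (g : H d) : g * genC d * g⁻¹ ∉ W := fun h =>
  ho.gens_ne_one.2.2
    (hW.eq_one_of_zpow (by simp [testElements]) (Subgroup.mem_zpowers (genC d)) h)

theorem Avoids.conj_genB_notMem (ho : HasFullOrders d) {W : Subgroup (H d)} (hW : Avoids W)
    (g : H d) : g * genB d * g⁻¹ ∉ W := by
  intro h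
  rw [genB_eq_conj] at h
  refine hW.conj_genA_notMem ho (g * (genA d * genB d)) ?_
  rw [mul_inv_rev]
  simpa only [mul_assoc] using h

/-- No conjugate of a non-trivial element of `⟨a, c⟩` lies in an avoiding subgroup. -/
theorem Avoids.eq_one_of_mem_closure_ac (ho : HasFullOrders d) {W : Subgroup (H d)}
    (hW : Avoids W) {y : H d} (hy : y ∈ Subgroup.closure {genA d, genC d}) {g : H d}
    (hg : g * y * g⁻¹ ∈ W) : y = 1 := by
  obtain ⟨k, rfl | rfl⟩ :=
    (DihedralGroup.mem_closure_involutions_iff genA_mul_self genC_mul_self).1 hy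
  · exact hW _ (by simp [testElements]) g k hg
  · exfalso
    obtain ⟨t, ht | ht⟩ := DihedralGroup.reflection_conj (genA_mul_self (d := d)) genC_mul_self k
    · rw [ht] at hg
      exact hW.conj_genA_notMem ho (g * t) (by rw [mul_inv_rev]; simpa only [mul_assoc] using hg)
    · rw [ht] at hg
      exact hW.conj_genC_notMem ho (g * t) (by rw [mul_inv_rev]; simpa only [mul_assoc] using hg)

/-- No conjugate of a non-trivial element of `⟨b, c⟩` lies in an avoiding subgroup. -/
theorem Avoids.eq_one_of_mem_closure_bc (ho : HasFullOrders d) {W : Subgroup (H d)}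
    (hW : Avoids W) {y : H d} (hy : y ∈ Subgroup.closure {genB d, genC d}) {g : H d}
    (hg : g * y * g⁻¹ ∈ W) : y = 1 := by
  obtain ⟨k, rfl | rfl⟩ :=
    (DihedralGroup.mem_closure_involutions_iff genB_mul_self genC_mul_self).1 hy
  · exact hW _ (by simp [testElements]) g k hg
  · exfalso
    obtain ⟨t, ht | ht⟩ := DihedralGroup.reflection_conj (genB_mul_self (d := d)) genC_mul_self k
    · rw [ht] at hg
      exact hW.conj_genB_notMem ho (g * t) (by rw [mul_inv_rev]; simpa only [mul_assoc] using hg)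
    · rw [ht] at hg
      exact hW.conj_genC_notMem ho (g * t) (by rw [mul_inv_rev]; simpa only [mul_assoc] using hg)

/-- If a Sylow `p`-subgroup consists of elements whose conjugates are avoided by `W`, then `p` does
not divide the order of `W`. -/
theorem not_dvd_card_of_sylow [Finite (H d)] {W K : Subgroup (H d)} {p : ℕ} (hp : p.Prime)
    (hK : Nat.card K = p ^ (Nat.card (H d)).factorization p)
    (hKW : ∀ y ∈ K, ∀ g, g * y * g⁻¹ ∈ W → y = 1) : ¬ p ∣ Nat.card W := by
  have := Fact.mk hp
  intro hdvd
  obtain ⟨⟨x, hxW⟩, hx⟩ := exists_prime_orderOf_dvd_card' (G := W) p hdvd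
  rw [Subgroup.orderOf_mk] at hx
  have hQ : IsPGroup p (Subgroup.zpowers x) :=
    IsPGroup.of_card (n := 1) (by rw [Nat.card_zpowers, hx, pow_one])
  obtain ⟨g, hg⟩ := hQ.exists_conj_mem hK
  have h1 := hKW _ (hg x (Subgroup.mem_zpowers x)) g⁻¹ (by
    simpa only [mul_assoc, inv_mul_cancel_left, inv_inv, inv_mul_cancel, mul_one] using hxW)
  rw [conj_eq_one_iff] at h1
  rw [h1, orderOf_one] at hx
  exact hp.one_lt.ne hx

theorem Avoids.not_two_dvd_card [Finite (H d)] (ho : HasFullOrders d) {W : Subgroup (H d)}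
    (hW : Avoids W) (h2 : (Nat.card (H d)).factorization 2 = 2) : ¬ 2 ∣ Nat.card W :=
  not_dvd_card_of_sylow Nat.prime_two (by rw [h2, ho.card_closure_ac]; rfl) fun _ hy _ hg =>
    hW.eq_one_of_mem_closure_ac ho hy hg

theorem Avoids.not_dvd_card_of_test [Finite (H d)] {W : Subgroup (H d)} (hW : Avoids W)
    {x : H d} (hx : x ∈ testElements d) {p : ℕ} (hp : p.Prime)
    (hcard : orderOf x = p ^ (Nat.card (H d)).factorization p) : ¬ p ∣ Nat.card W :=
  not_dvd_card_of_sylow hp (by rw [Nat.card_zpowers, hcard]) fun _ hy _ hg =>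
    hW.eq_one_of_zpow hx hy hg

theorem HasFullOrders.orderOf_dvd (ho : HasFullOrders d) {x : H d} (hx : x ∈ testElements d) :
    orderOf x ∣ 6 * d := by
  rcases hx with rfl | rfl | rfl | rfl | rfl
  · rw [ho.orderOf_a]; exact ⟨3 * d, by ring⟩
  · rw [ho.orderOf_c]; exact ⟨3 * d, by ring⟩
  · rw [ho.orderOf_ab]; exact ⟨2 * d, by ring⟩
  · rw [ho.orderOf_ac]; exact ⟨3 * d, by ring⟩
  · rw [ho.orderOf_bc]; exact ⟨6, by ring⟩

/-- Subgroups of order prime to the orders of the test elements avoid all their conjugates. -/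
theorem avoids_of_coprime (ho : HasFullOrders d) {V : Subgroup (H d)}
    (hV : (Nat.card V).Coprime (6 * d)) : Avoids V := by
  intro x hx g k hk
  have h1 : orderOf (x ^ k) ∣ Nat.card V := by
    rw [← MulEquiv.orderOf_eq (MulAut.conj g) (x ^ k), MulAut.conj_apply]
    exact (Subgroup.orderOf_mk _ hk) ▸ orderOf_dvd_natCard (⟨_, hk⟩ : V)
  have hpow : orderOf (x ^ k) ∣ orderOf x := orderOf_dvd_of_pow_eq_one (by
    rw [← zpow_natCast, zpow_comm, zpow_natCast, pow_orderOf_eq_one, one_zpow])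
  exact orderOf_eq_one_iff.1 (Nat.eq_one_of_dvd_coprimes hV h1 (hpow.trans (ho.orderOf_dvd hx)))

theorem avoids_bot : Avoids (⊥ : Subgroup (H d)) := by
  intro x _ g k hk
  rwa [Subgroup.mem_bot, conj_eq_one_iff] at hk

theorem areConjugate_of_le [Finite (H d)] {V W : Subgroup (H d)} (hcard : Nat.card V = Nat.card W)
    {g : H d} (hg : ∀ x ∈ V, g * x * g⁻¹ ∈ W) : AreConjugate V W := by
  refine ⟨g, Subgroup.eq_of_le_of_card_ge ?_ ?_⟩
  · rintro _ ⟨x, hx, rfl⟩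
    exact hg x hx
  · rw [card_conjugate, hcard]

theorem areConjugate_of_sylow [Finite (H d)] {V W : Subgroup (H d)} {p : ℕ} (hp : p.Prime)
    (hV : Nat.card V = p ^ (Nat.card (H d)).factorization p)
    (hW : Nat.card W = p ^ (Nat.card (H d)).factorization p) : AreConjugate V W := by
  have := Fact.mk hp
  obtain ⟨g, hg⟩ := (IsPGroup.of_card hV).exists_conj_mem hW
  exact areConjugate_of_le (hV.trans hW.symm) hg

theorem AreConjugate.of_eq {V W : Subgroup (H d)} (h : V = W) : AreConjugate V W := by
  subst h
  refine ⟨1, ?_⟩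
  ext x
  simp [mem_conjugate]

theorem eq_bot_of_card_eq_one {W : Subgroup (H d)} (hW : Nat.card W = 1) : W = ⊥ :=
  Subgroup.card_eq_one.1 hW

theorem areConjugate_sharp_bot :
    AreConjugate ((⊥ : Subgroup (H d)).map (sharp d)) (⊥ : Subgroup (H d)) :=
  .of_eq (Subgroup.map_bot _)

theorem exists_subgroup_card_eq [Finite (H d)] {p : ℕ} (hp : p.Prime)
    (hdvd : p ∣ Nat.card (H d)) : ∃ y : H d, orderOf y = p ∧ Nat.card (Subgroup.zpowers y) = p := by
  have := Fact.mk hp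
  obtain ⟨y, hy⟩ := exists_prime_orderOf_dvd_card' (G := H d) p hdvd
  exact ⟨y, hy, by rw [Nat.card_zpowers, hy]⟩

end Subgroups

/-! ### Finite models of the geodesic triangle group -/

section Model

variable {d : ℕ} {M : Type u} [Group M]

/-- Three elements of a group satisfy the relations of `H_d`, and the orders of the relevant
products are as large as these relations permit. -/
structure IsModel (d : ℕ) (p : Gen → M) : Prop where
  three_le : 3 ≤ d
  relation : ∀ l ∈ relatorWords d, (l.map p).prod = 1
  ne_one : ∀ g, p g ≠ 1
  ab_ne_one : p .a * p .b ≠ 1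
  ac_ne_one : p .a * p .c ≠ 1
  bc_pow_ne_one : ∀ k < d, 0 < k → (p .b * p .c) ^ k ≠ 1

namespace IsModel

variable {p : Gen → M}

theorem prod_replicate (l : List Gen) (n : ℕ) :
    ((List.replicate n l).flatten.map p).prod = (l.map p).prod ^ n := by
  simp [List.map_flatten, List.prod_flatten]

theorem lift_relators (h : IsModel d p) : ∀ r ∈ relators d, FreeGroup.lift p r = 1 := by
  have h1 := h.relation
  simp only [relatorWords, List.forall_mem_cons, prod_replicate, List.map_cons, List.map_nil,
    List.prod_cons, List.prod_nil, mul_one] at h1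
  obtain ⟨hac, hab, hbc, hbac, ha, hb, hc, -⟩ := h1
  intro r hr
  simp only [relators, Set.mem_insert_iff, Set.mem_singleton_iff] at hr
  rcases hr with rfl | rfl | rfl | rfl | rfl | rfl | rfl <;>
    simp only [map_pow, map_mul, FreeGroup.lift_apply_of, pow_two (p _)]
  exacts [ha, hb, hc, hab, hac, hbc, by rw [mul_assoc]; exact hbac]

/-- The homomorphism from `H_d` to a model. -/
def hom (h : IsModel d p) : H d →* M := PresentedGroup.toGroup h.lift_relators

theorem hom_gen (h : IsModel d p) (g : Gen) : h.hom (gen d g) = p g :=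
  PresentedGroup.toGroup.of _

theorem hom_word (h : IsModel d p) (l : List Gen) : h.hom (word d l) = (l.map p).prod := by
  rw [word, map_list_prod, List.map_map]
  congr 2
  exact funext h.hom_gen

theorem mul_self (h : IsModel d p) (g : Gen) : p g * p g = 1 := by
  rw [← h.hom_gen, ← map_mul, gen_mul_self, map_one]

theorem orderOf_gen (h : IsModel d p) (g : Gen) : orderOf (p g) = 2 :=
  orderOf_eq_prime (by rw [pow_two, h.mul_self]) (h.ne_one g)

theorem orderOf_bc (h : IsModel d p) : orderOf (p .b * p .c) = d := by
  refine (orderOf_eq_iff (by have := h.three_le; omega)).2 ⟨?_, h.bc_pow_ne_one⟩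
  rw [← h.hom_gen, ← h.hom_gen, ← map_mul, ← map_pow, gen_b, gen_c, genBC_pow, map_one]

theorem orderOf_ab (h : IsModel d p) : orderOf (p .a * p .b) = 3 := by
  refine orderOf_eq_prime ?_ h.ab_ne_one
  rw [← h.hom_gen, ← h.hom_gen, ← map_mul, ← map_pow, gen_a, gen_b, genAB_pow, map_one]

theorem orderOf_ac (h : IsModel d p) : orderOf (p .a * p .c) = 2 := by
  refine orderOf_eq_prime ?_ h.ac_ne_one
  rw [← h.hom_gen, ← h.hom_gen, ← map_mul, ← map_pow, gen_a, gen_c, genAC_pow, map_one]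

theorem hasFullOrders (h : IsModel d p) : HasFullOrders d := by
  have key : ∀ (x : H d) (n : ℕ), x ^ n = 1 → orderOf (h.hom x) = n → orderOf x = n :=
    fun x n h1 h2 => Nat.dvd_antisymm (orderOf_dvd_of_pow_eq_one h1) (h2 ▸ orderOf_map_dvd h.hom x)
  refine ⟨h.three_le, key _ _ (by rw [pow_two, genA_mul_self]) ?_,
    key _ _ (by rw [pow_two, genC_mul_self]) ?_, key _ _ genAB_pow ?_, key _ _ genAC_pow ?_,
    key _ _ genBC_pow ?_⟩
  · rw [← gen_a, h.hom_gen, h.orderOf_gen]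
  · rw [← gen_c, h.hom_gen, h.orderOf_gen]
  · rw [← gen_a, ← gen_b, map_mul, h.hom_gen, h.hom_gen, h.orderOf_ab]
  · rw [← gen_a, ← gen_c, map_mul, h.hom_gen, h.hom_gen, h.orderOf_ac]
  · rw [← gen_b, ← gen_c, map_mul, h.hom_gen, h.hom_gen, h.orderOf_bc]

/-- If the order of a model is at least the known bound for the order of `H_d`, then the model is
faithful. -/
theorem injective_and_card (h : IsModel d p) [Finite M] {N : ℕ} (hN : N ∣ Nat.card h.hom.range)
    (hle : Finite (H d) ∧ Nat.card (H d) ≤ N) :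
    Function.Injective h.hom ∧ Nat.card (H d) = N := by
  obtain ⟨hfin, hle⟩ := hle
  have h1 : N ≤ Nat.card h.hom.range := Nat.le_of_dvd Nat.card_pos hN
  have hs := h.hom.rangeRestrict_surjective
  have h2 := Nat.card_le_card_of_surjective _ hs
  refine ⟨?_, by omega⟩
  have h3 := (hs.bijective_of_nat_card_le (by omega)).injective
  exact fun x y hxy => h3 (Subtype.ext hxy)

theorem word_eq (h : IsModel d p) (hinj : Function.Injective h.hom) {l l' : List Gen}
    (hl : (l.map p).prod = (l'.map p).prod) : word d l = word d l' :=
  hinj (by rw [h.hom_word, h.hom_word, hl])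

theorem word_ne (h : IsModel d p) {l l' : List Gen}
    (hl : (l.map p).prod ≠ (l'.map p).prod) : word d l ≠ word d l' :=
  fun he => hl (by rw [← h.hom_word, ← h.hom_word, he])

/-- A transitive permutation model in which `b` and `c` fix a point has at least `2 * d` elements
for each point. Transitivity is tested by a descent to the fixed point. -/
theorem dvd_card_range {m : ℕ} [NeZero m] {p : Gen → Equiv.Perm (Fin m)} (h : IsModel d p)
    (hb : p .b 0 = 0) (hc : p .c 0 = 0)
    (hdesc : ∀ q : Fin m, q ≠ 0 → p .a q < q ∨ p .b q < q ∨ p .c q < q) :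
    2 * d * m ∣ Nat.card h.hom.range := by
  let R := h.hom.range
  have hmem : ∀ g, p g ∈ R := fun g => ⟨gen d g, h.hom_gen g⟩
  have horbit : ∀ q : Fin m, ∃ r : R, r • (0 : Fin m) = q := by
    intro q
    induction q using WellFoundedLT.induction with
    | ind q ih =>
      by_cases hq : q = 0
      · exact ⟨1, by rw [one_smul, hq]⟩
      · obtain ⟨g, hg⟩ : ∃ g, p g q < q := by
          rcases hdesc q hq with hg | hg | hg
          exacts [⟨_, hg⟩, ⟨_, hg⟩, ⟨_, hg⟩]
        obtain ⟨r, hr⟩ := ih _ hg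
        refine ⟨⟨p g, hmem g⟩ * r, ?_⟩
        rw [mul_smul, hr]
        change (p g * p g) q = q
        rw [h.mul_self]
        rfl
  have htrans : MulAction.IsPretransitive R (Fin m) := ⟨fun x y => by
    obtain ⟨r, rfl⟩ := horbit x
    obtain ⟨s, rfl⟩ := horbit y
    exact ⟨s * r⁻¹, by rw [smul_smul, inv_mul_cancel_right]⟩⟩
  let D : Subgroup R := Subgroup.closure {⟨p .b, hmem .b⟩, ⟨p .c, hmem .c⟩}
  have hD : Nat.card D = 2 * d := by
    have := DihedralGroup.card_closure_of_orderOf (G := R) (σ := ⟨p .b, hmem .b⟩)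
      (τ := ⟨p .c, hmem .c⟩) (by rw [Subgroup.orderOf_mk, h.orderOf_gen])
      (by rw [Subgroup.orderOf_mk, h.orderOf_gen])
    rw [this]
    congr 1
    exact (Subgroup.orderOf_mk _ (mul_mem (hmem .b) (hmem .c))).trans h.orderOf_bc
  have hle : D ≤ MulAction.stabilizer R (0 : Fin m) := by
    rw [Subgroup.closure_le]
    rintro _ (rfl | rfl)
    exacts [hb, hc]
  rw [← (MulAction.stabilizer R (0 : Fin m)).card_mul_index,
    MulAction.index_stabilizer_of_transitive, Nat.card_fin, ← hD]
  exact Nat.mul_dvd_mul_right (Subgroup.card_dvd_of_le hle) m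

end IsModel

end Model

end GeodesicSurface

namespace GeodesicSurface

/-! ### Words in the generators and cyclic subgroups -/

section Words

variable {d : ℕ}

/-- The word that the geodesic automorphism substitutes for a generator. -/
def sharpWord : Gen → List Gen
  | .a => [.a]
  | .b => [.b]
  | .c => [.a, .c]

theorem sharp_word (l : List Gen) : sharp d (word d l) = word d (l.flatMap sharpWord) := by
  induction l with
  | nil => simp [word]
  | cons g l ih =>
    rw [word_cons, map_mul, ih, List.flatMap_cons, word_append]
    congr 1
    cases g
    · simp [sharpWord, word, gen_a, sharp_genA]
    · simp [sharpWord, word, gen_b, sharp_genB]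
    · simp [sharpWord, word, gen_a, gen_c, sharp_genC]

theorem normal_zpowers_of_gen {x : H d}
    (hx : ∀ g, gen d g * x * (gen d g)⁻¹ ∈ Subgroup.zpowers x) : (Subgroup.zpowers x).Normal := by
  have hgen : ∀ g, ∀ y ∈ Subgroup.zpowers x, gen d g * y * (gen d g)⁻¹ ∈ Subgroup.zpowers x := by
    rintro g _ ⟨k, rfl⟩
    rw [← conj_zpow]
    exact zpow_mem (hx g) k
  refine ⟨fun y hy h => ?_⟩
  have hh : h ∈ Subgroup.closure (Set.range (gen d)) := closure_range_gen ▸ Subgroup.mem_top h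
  induction hh using Subgroup.closure_induction'' generalizing y with
  | mem z hz =>
    obtain ⟨g, rfl⟩ := hz
    exact hgen g y hy
  | inv_mem z hz =>
    obtain ⟨g, rfl⟩ := hz
    rw [inv_eq_of_mul_eq_one_right (gen_mul_self g)]
    exact hgen g y hy
  | one => simpa using hy
  | mul z w _ _ hz hw =>
    rw [mul_inv_rev]
    simpa only [mul_assoc] using hz _ (hw y hy)

theorem card_coset_mul [Finite (H d)] (V : Subgroup (H d)) {m n : ℕ} (hV : Nat.card V = m)
    (hH : Nat.card (H d) = m * n) : Nat.card (H d ⧸ V) = n := by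
  have h1 := V.card_mul_index
  rw [hV, hH] at h1
  exact Nat.eq_of_mul_eq_mul_left (hV ▸ Nat.card_pos) h1

theorem HasFullOrders.hasCounts (ho : HasFullOrders d) {V : Subgroup (H d)} (hV : Avoids V)
    {n v e f : ℕ} (hn : Nat.card (H d ⧸ V) = n) (hv : n = v * (2 * d)) (he : n = e * 4)
    (hf : n = f * 6) : (cosetSystem V).HasCounts v e f :=
  (hV.isDegreeSurface ho).hasCounts (hn.trans hv) (hn.trans he) (hn.trans hf)

/-- The test elements as words. -/
def testWords : List (List Gen) := [[.a], [.c], [.a, .b], [.a, .c], [.b, .c]]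

theorem exists_testWord {d : ℕ} {x : H d} (hx : x ∈ testElements d) :
    ∃ l ∈ testWords, x = word d l := by
  rcases hx with rfl | rfl | rfl | rfl | rfl
  · exact ⟨[.a], by simp [testWords], by simp [word, gen_a]⟩
  · exact ⟨[.c], by simp [testWords], by simp [word, gen_c]⟩
  · exact ⟨[.a, .b], by simp [testWords], by simp [word, gen_a, gen_b]⟩
  · exact ⟨[.a, .c], by simp [testWords], by simp [word, gen_a, gen_c]⟩
  · exact ⟨[.b, .c], by simp [testWords], by simp [word, gen_b, gen_c]⟩

theorem IsModel.word_notMem_zpowers {M : Type u} [Group M] {p : Gen → M} (h : IsModel d p)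
    {x : H d} (hx : x ∈ testElements d) {w : List Gen}
    (hw : ∀ l ∈ testWords, ∀ j < 6 * d,
      (w.map p).prod ≠ ((List.replicate j l).flatten.map p).prod) :
    word d w ∉ Subgroup.zpowers x := by
  have hd : (6 * d : ℕ) ≠ 0 := by have := h.three_le; omega
  have hxd : x ^ (6 * d) = 1 := orderOf_dvd_iff_pow_eq_one.1 (h.hasFullOrders.orderOf_dvd hx)
  obtain ⟨l, hl, rfl⟩ := exists_testWord hx
  rintro ⟨k, hk⟩
  have h0 : 0 ≤ k % (6 * d : ℕ) := Int.emod_nonneg _ (by exact_mod_cast hd)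
  have h1 : word d l ^ k = word d l ^ (k % (6 * d : ℕ)).toNat := by
    conv_lhs => rw [← Int.emod_add_mul_ediv k (6 * d : ℕ), zpow_add, zpow_mul]
    rw [zpow_natCast, hxd, one_zpow, mul_one, ← zpow_natCast, Int.toNat_of_nonneg h0]
  have h2 : (k % (6 * d : ℕ)).toNat < 6 * d := by
    have := Int.emod_lt_of_pos k (b := (6 * d : ℕ)) (by omega)
    omega
  refine h.word_ne (hw l hl _ h2) ?_
  rw [word_flatten_replicate, ← h1]
  exact hk.symm

end Words

/-! ### Degree five -/

section Five

/-- `H_5` as a permutation group on six points. -/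
def modelFive : Gen → Equiv.Perm (Fin 6)
  | .a => Function.Involutive.toPerm ![1, 0, 2, 3, 5, 4] (by unfold Function.Involutive; decide)
  | .b => Function.Involutive.toPerm ![0, 2, 1, 4, 3, 5] (by unfold Function.Involutive; decide)
  | .c => Function.Involutive.toPerm ![0, 1, 3, 2, 5, 4] (by unfold Function.Involutive; decide)

theorem isModel_five : IsModel 5 modelFive where
  three_le := by norm_num
  relation := by decide +kernel
  ne_one g := by cases g <;> decide +kernel
  ab_ne_one := by decide +kernel
  ac_ne_one := by decide +kernel
  bc_pow_ne_one := by decide +kernel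

instance : Finite (H 5) := card_H_5_le.1

theorem card_H_five : Nat.card (H 5) = 60 :=
  (isModel_five.injective_and_card
    (isModel_five.dvd_card_range (by decide) (by decide) (by decide +kernel)) card_H_5_le).2

/-- Each Sylow subgroup of `H_5` is conjugate to `⟨a, c⟩`, `⟨ab⟩` or `⟨bc⟩`. -/
theorem Avoids.eq_bot_five {W : Subgroup (H 5)} (hW : Avoids W) : W = ⊥ := by
  have ho := isModel_five.hasFullOrders
  have hcard := card_H_five
  have h2 := hW.not_two_dvd_card ho
    (factorization_eq_of_eq_mul (m := 15) Nat.prime_two hcard (by norm_num))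
  have h3 := hW.not_dvd_card_of_test (x := genA 5 * genB 5) (by simp [testElements])
    Nat.prime_three (by
      rw [factorization_eq_of_eq_mul (m := 20) (k := 1) Nat.prime_three hcard (by norm_num),
        ho.orderOf_ab, pow_one])
  have h5 := hW.not_dvd_card_of_test (x := genB 5 * genC 5) (by simp [testElements])
    Nat.prime_five (by
      rw [factorization_eq_of_eq_mul (m := 12) (k := 1) Nat.prime_five hcard (by norm_num),
        ho.orderOf_bc, pow_one])
  have hdvd : Nat.card W ∣ 2 ^ 2 * (3 ^ 1 * (5 ^ 1 * 1)) :=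
    (show Nat.card (H 5) = 2 ^ 2 * (3 ^ 1 * (5 ^ 1 * 1)) from hcard) ▸ W.card_subgroup_dvd_card
  exact eq_bot_of_card_eq_one (Nat.dvd_one.1 (dvd_of_dvd_pow_mul Nat.prime_five
    (dvd_of_dvd_pow_mul Nat.prime_three (dvd_of_dvd_pow_mul Nat.prime_two hdvd h2) h3) h5))

theorem isClassification_five : IsClassification.{u} 5 ![⊥] := by
  refine isClassification_of_subgroups isModel_five.hasFullOrders ?_ ?_ ?_ fun W hW =>
    ⟨0, .of_eq (isGeodesicSurfaceSubgroup_iff.1 hW).1.eq_bot_five⟩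
  · simpa using avoids_bot
  · simpa using areConjugate_sharp_bot
  · exact Function.injective_of_subsingleton _

theorem hasCounts_five : (cosetSystem (⊥ : Subgroup (H 5))).HasCounts 6 15 10 :=
  isModel_five.hasFullOrders.hasCounts avoids_bot (n := 60)
    (card_coset_mul _ Subgroup.card_bot card_H_five) rfl rfl rfl

end Five

end GeodesicSurface

namespace GeodesicSurface

/-! ### Degree six -/

section Six

/-- `H_6` as a permutation group on the nine vertices of a torus. -/
def modelSix : Gen → Equiv.Perm (Fin 9)
  | .a => Function.Involutive.toPerm ![1, 0, 2, 3, 5, 4, 7, 6, 8]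
      (by unfold Function.Involutive; decide)
  | .b => Function.Involutive.toPerm ![0, 2, 1, 4, 3, 5, 8, 7, 6]
      (by unfold Function.Involutive; decide)
  | .c => Function.Involutive.toPerm ![0, 1, 3, 2, 6, 7, 4, 5, 8]
      (by unfold Function.Involutive; decide)

theorem isModel_six : IsModel 6 modelSix where
  three_le := by norm_num
  relation := by decide +kernel
  ne_one g := by cases g <;> decide +kernel
  ab_ne_one := by decide +kernel
  ac_ne_one := by decide +kernel
  bc_pow_ne_one := by decide +kernel

instance : Finite (H 6) := card_H_6_le.1

theorem injective_and_card_six : Function.Injective isModel_six.hom ∧ Nat.card (H 6) = 108 :=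
  isModel_six.injective_and_card
    (isModel_six.dvd_card_range (by decide) (by decide) (by decide +kernel)) card_H_6_le

/-- Two words have the same value in `H_6` if they induce the same permutation of the vertices. -/
theorem word_six_eq {l l' : List Gen} (h : (l.map modelSix).prod = (l'.map modelSix).prod) :
    word 6 l = word 6 l' :=
  isModel_six.word_eq injective_and_card_six.1 h

/-- The commutator of the rotations `ab` and `cabc` of order three. -/
def centralWordSix : List Gen := [.a, .b, .c, .a, .b, .c, .b, .a, .c, .b, .a, .c]

/-- The words `n ^ i * (ab) ^ j * (cabc) ^ k`, where `n` is the commutator of `ab` and `cabc`. -/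
def oddWord (x : Fin 3 × Fin 3 × Fin 3) : List Gen :=
  (List.replicate x.1 centralWordSix).flatten ++ (List.replicate x.2.1 [Gen.a, Gen.b]).flatten ++
    (List.replicate x.2.2 [Gen.c, Gen.a, Gen.b, Gen.c]).flatten

/-- The subgroup of order `27` is listed without repetition. -/
theorem oddWord_injective : Function.Injective fun x => word 6 (oddWord x) := by
  intro x y hxy
  by_contra hne
  refine isModel_six.word_ne ?_ hxy
  revert x y
  have : ∀ x y, x ≠ y → ((oddWord x).map modelSix).prod ≠ ((oddWord y).map modelSix).prod := by
    decide +kernel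
  exact fun x y _ h => this x y h

/-- For even `d`, the homomorphism that sends `a`, `b` to `1` and `c` to `-1`. -/
def colourHom {d : ℕ} (hd : Even d) : H d →* ℤˣ :=
  PresentedGroup.toGroup (f := fun | .a => 1 | .b => 1 | .c => -1) (by
    intro r hr
    simp only [relators, Set.mem_insert_iff, Set.mem_singleton_iff] at hr
    rcases hr with rfl | rfl | rfl | rfl | rfl | rfl | rfl <;>
      simp [hd.neg_one_pow])

/-- The homomorphism from `H_6` to its largest elementary abelian 2-quotient. -/
def abHomSix : H 6 →* ℤˣ × ℤˣ :=
  (signHom (d := 6) (by decide)).prod (colourHom (d := 6) (by decide))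

theorem abHomSix_gen : abHomSix (gen 6 .a) = (-1, 1) ∧ abHomSix (gen 6 .b) = (-1, 1) ∧
    abHomSix (gen 6 .c) = (-1, -1) :=
  ⟨Prod.ext (PresentedGroup.toGroup.of _) (PresentedGroup.toGroup.of _),
    Prod.ext (PresentedGroup.toGroup.of _) (PresentedGroup.toGroup.of _),
    Prod.ext (PresentedGroup.toGroup.of _) (PresentedGroup.toGroup.of _)⟩

theorem card_ker_abHomSix : Nat.card abHomSix.ker = 27 := by
  have hsurj : Function.Surjective abHomSix := by
    obtain ⟨ha, -, hc⟩ := abHomSix_gen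
    rintro ⟨x, y⟩
    rcases Int.units_eq_one_or x with rfl | rfl <;> rcases Int.units_eq_one_or y with rfl | rfl
    · exact ⟨1, map_one _⟩
    · exact ⟨gen 6 .a * gen 6 .c, by rw [map_mul, ha, hc]; rfl⟩
    · exact ⟨_, ha⟩
    · exact ⟨_, hc⟩
  have h1 := abHomSix.ker.card_mul_index
  rw [Subgroup.index_ker, MonoidHom.range_eq_top.2 hsurj, Subgroup.card_top,
    injective_and_card_six.2] at h1
  have h2 : Nat.card (ℤˣ × ℤˣ) = 4 := by
    rw [Nat.card_prod, Nat.card_eq_fintype_card]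
    rfl
  rw [h2] at h1
  omega

theorem oddWord_mem_ker (x : Fin 3 × Fin 3 × Fin 3) : word 6 (oddWord x) ∈ abHomSix.ker := by
  obtain ⟨ha, hb, hc⟩ := abHomSix_gen
  have h : ∀ l, abHomSix (word 6 l) = (l.map fun g => abHomSix (gen 6 g)).prod := fun l => by
    rw [word, map_list_prod, List.map_map]; rfl
  have h' : (fun g => abHomSix (gen 6 g)) =
      fun | .a => (-1, 1) | .b => (-1, 1) | .c => (-1, -1) := by
    funext g
    cases g
    exacts [ha, hb, hc]
  rw [MonoidHom.mem_ker, h, h']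
  revert x
  decide +kernel

theorem exists_oddWord {x : H 6} (hx : x ∈ abHomSix.ker) : ∃ y, x = word 6 (oddWord y) := by
  let f : Fin 3 × Fin 3 × Fin 3 → abHomSix.ker := fun y => ⟨_, oddWord_mem_ker y⟩
  have hf : Function.Bijective f := by
    rw [Nat.bijective_iff_injective_and_card]
    refine ⟨fun y z hyz => oddWord_injective (congrArg Subtype.val hyz), ?_⟩
    rw [card_ker_abHomSix]
    simp
  obtain ⟨y, hy⟩ := hf.2 ⟨x, hx⟩
  exact ⟨y, (congrArg Subtype.val hy).symm⟩

/-- A subgroup of order three: translations of the torus with nine vertices. -/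
def normalSix : Subgroup (H 6) := Subgroup.zpowers (word 6 centralWordSix)

theorem orderOf_centralWordSix : orderOf (word 6 centralWordSix) = 3 := by
  refine orderOf_eq_prime ?_ (isModel_six.word_ne (l' := []) (by decide +kernel))
  rw [← word_flatten_replicate]
  exact word_six_eq (l' := []) (by decide +kernel)

theorem card_normalSix : Nat.card normalSix = 3 := by
  rw [normalSix, Nat.card_zpowers, orderOf_centralWordSix]

theorem normalSix_normal : normalSix.Normal := by
  refine normal_zpowers_of_gen fun g => ?_
  rw [inv_eq_of_mul_eq_one_right (gen_mul_self g)]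
  have h : gen 6 g * word 6 centralWordSix * gen 6 g = word 6 ([g] ++ centralWordSix ++ [g]) := by
    simp [word, mul_assoc]
  rw [h]
  have h1 : word 6 ([g] ++ centralWordSix ++ [g]) = word 6 centralWordSix ∨
      word 6 ([g] ++ centralWordSix ++ [g]) = word 6 centralWordSix.reverse := by
    cases g
    · exact .inl (word_six_eq (by decide +kernel))
    · exact .inl (word_six_eq (by decide +kernel))
    · exact .inr (word_six_eq (by decide +kernel))
  rcases h1 with h1 | h1 <;> rw [h1]
  · exact Subgroup.mem_zpowers _
  · rw [word_reverse]
    exact inv_mem (Subgroup.mem_zpowers _)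

theorem map_sharp_normalSix : normalSix.map (sharp 6) = normalSix := by
  rw [normalSix, MonoidHom.map_zpowers, sharp_word,
    word_six_eq (l' := centralWordSix.reverse) (by decide +kernel), word_reverse,
    Subgroup.zpowers_inv]

theorem centralWordSix_notMem_zpowers {x : H 6} (hx : x ∈ testElements 6) :
    word 6 centralWordSix ∉ Subgroup.zpowers x :=
  isModel_six.word_notMem_zpowers hx (by decide +kernel)

theorem avoids_normalSix : Avoids normalSix := by
  intro x hx g k hk
  have h1 : x ^ k ∈ normalSix := by
    have := normalSix_normal.conj_mem _ hk g⁻¹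
    simpa [mul_assoc] using this
  by_contra hne
  -- a non-trivial element of a group of order three generates it
  have h2 : Subgroup.zpowers (x ^ k) = normalSix := by
    refine Subgroup.eq_of_le_of_card_ge (by simpa using h1) ?_
    have hdvd := Subgroup.card_dvd_of_le
      (show Subgroup.zpowers (x ^ k) ≤ normalSix by simpa using h1)
    rw [card_normalSix, Nat.card_zpowers] at hdvd
    rw [card_normalSix, Nat.card_zpowers]
    rcases (Nat.dvd_prime Nat.prime_three).1 hdvd with h | h
    · exact absurd (orderOf_eq_one_iff.1 h) hne
    · exact h.ge
  refine centralWordSix_notMem_zpowers hx ?_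
  have h3 : word 6 centralWordSix ∈ Subgroup.zpowers (x ^ k) :=
    h2 ▸ Subgroup.mem_zpowers (word 6 centralWordSix)
  exact (Subgroup.zpowers_le.2 (zpow_mem (Subgroup.mem_zpowers x) k)) h3

/-- Conjugators and roots that show that all elements `n ^ i * (ab) ^ j * (cabc) ^ k` with
`(j, k) ≠ (0, 0)` are conjugate to non-trivial powers of `ab`, `(bc)²` or `(bac)²`. -/
theorem oddWord_conj : ∀ x : Fin 3 × Fin 3 × Fin 3, x.2 ≠ 0 →
    ∃ g ∈ [[], [.a, .b, .c], [.c, .b, .a, .c], [.c], [.b, .c], [.a, .c, .b, .c]],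
    ∃ t ∈ [[Gen.a, .b], [.b, .c, .b, .c], [.b, .a, .c, .b, .a, .c]], ∃ e ∈ [1, 2],
      ((oddWord x).map modelSix).prod =
        ((g ++ (List.replicate e t).flatten ++ g.reverse).map modelSix).prod := by
  decide +kernel

/-- The criterion forces `V` into the subgroup of order three. This is the only degree in which the
duality condition, and not just the avoidance of the test elements, restricts `V`: it excludes the
powers of `bac`. -/
theorem IsGeodesicSurfaceSubgroup.le_normalSix {W : Subgroup (H 6)}
    (hW : IsGeodesicSurfaceSubgroup W) : W ≤ normalSix := by
  obtain ⟨hWa, h, hh⟩ := isGeodesicSurfaceSubgroup_iff.1 hW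
  have h2 := hWa.not_two_dvd_card isModel_six.hasFullOrders
    (factorization_eq_of_eq_mul (m := 27) Nat.prime_two injective_and_card_six.2 (by norm_num))
  intro x hx
  have hker : x ∈ abHomSix.ker := by
    have h4 : abHomSix x ^ 2 = 1 := by
      rcases abHomSix x with ⟨y, z⟩
      simp [Prod.ext_iff]
    have h5 : abHomSix x ^ Nat.card W = 1 := by
      rw [← map_pow, show x ^ Nat.card W = 1 from
        congrArg Subtype.val (pow_card_eq_one' (G := W) (x := ⟨x, hx⟩)), map_one]
    have h6 := Nat.dvd_gcd (orderOf_dvd_of_pow_eq_one h4) (orderOf_dvd_of_pow_eq_one h5)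
    rw [(Nat.prime_two.coprime_iff_not_dvd.2 h2 : Nat.gcd 2 (Nat.card W) = 1), Nat.dvd_one,
      orderOf_eq_one_iff] at h6
    exact h6
  obtain ⟨y, rfl⟩ := exists_oddWord hker
  by_cases hy : y.2 = 0
  · obtain ⟨i, jk⟩ := y
    obtain rfl : jk = 0 := hy
    have : oddWord (i, 0) = (List.replicate i centralWordSix).flatten := by simp [oddWord]
    rw [this, word_flatten_replicate]
    exact pow_mem (Subgroup.mem_zpowers _) _
  · -- such an element is trivial, as `W` avoids powers of `ab`, `bc` and, by duality, of `bac`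
    obtain ⟨g, -, t, ht, e, -, he⟩ := oddWord_conj y hy
    have he' := word_six_eq he
    rw [word_append, word_append, word_reverse, word_flatten_replicate] at he'
    suffices h1 : word 6 t ^ e = 1 by
      rw [he', h1, mul_one, mul_inv_cancel]
      exact one_mem _
    rw [he'] at hx
    simp only [List.mem_cons, List.not_mem_nil, or_false] at ht
    rcases ht with rfl | rfl | rfl
    · have h0 : word 6 [.a, .b] = genA 6 * genB 6 := by simp [word, gen_a, gen_b]
      rw [h0, ← zpow_natCast] at hx ⊢
      exact hWa _ (by simp [testElements]) _ _ hx
    · have h0 : word 6 [.b, .c, .b, .c] ^ e = (genB 6 * genC 6) ^ (2 * e) := by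
        rw [pow_mul]; simp [word, gen_b, gen_c, pow_two, mul_assoc]
      rw [h0, ← zpow_natCast] at hx ⊢
      exact hWa _ (by simp [testElements]) _ _ hx
    · have h0 : sharp 6 (word 6 [.b, .a, .c, .b, .a, .c] ^ e) = (genB 6 * genC 6) ^ (2 * e) := by
        rw [pow_mul, map_pow, sharp_word,
          word_six_eq (l' := [.b, .c, .b, .c]) (by decide +kernel)]
        simp [word, gen_b, gen_c, pow_two, mul_assoc]
      have h7 := Subgroup.mem_map_of_mem (sharp 6) hx
      rw [map_mul, map_mul, h0, map_inv, ← zpow_natCast] at h7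
      have h8 : h * sharp 6 (word 6 g) * (genB 6 * genC 6) ^ ((2 * e : ℕ) : ℤ) *
          (h * sharp 6 (word 6 g))⁻¹ ∈ W := by
        rw [← hh, mem_conjugate]
        simpa only [mul_inv_rev, mul_assoc, inv_mul_cancel_left, inv_mul_cancel, mul_one] using h7
      have h9 := hWa _ (by simp [testElements]) _ _ h8
      rw [zpow_natCast, ← h0] at h9
      exact sharp_injective (h9.trans (map_one _).symm)

theorem isClassification_six : IsClassification.{u} 6 ![⊥, normalSix] := by
  refine isClassification_of_subgroups isModel_six.hasFullOrders ?_ ?_ ?_ fun W hW => ?_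
  · rw [Fin.forall_fin_two]
    exact ⟨avoids_bot, avoids_normalSix⟩
  · rw [Fin.forall_fin_two]
    exact ⟨areConjugate_sharp_bot, .of_eq map_sharp_normalSix⟩
  · intro i j hij
    fin_cases i <;> fin_cases j <;> simp_all [card_normalSix]
  · have hle := hW.le_normalSix
    have hdvd := Subgroup.card_dvd_of_le hle
    rw [card_normalSix] at hdvd
    rcases (Nat.dvd_prime Nat.prime_three).1 hdvd with h | h
    · exact ⟨0, .of_eq (eq_bot_of_card_eq_one h)⟩
    · exact ⟨1, .of_eq (Subgroup.eq_of_le_of_card_ge hle (card_normalSix.trans h.symm).le)⟩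

theorem hasCounts_six : (cosetSystem (⊥ : Subgroup (H 6))).HasCounts 9 27 18 :=
  isModel_six.hasFullOrders.hasCounts avoids_bot (n := 108)
    (card_coset_mul _ Subgroup.card_bot injective_and_card_six.2) rfl rfl rfl

theorem hasCounts_normalSix : (cosetSystem normalSix).HasCounts 3 9 6 :=
  isModel_six.hasFullOrders.hasCounts avoids_normalSix (n := 36)
    (card_coset_mul _ card_normalSix injective_and_card_six.2) rfl rfl rfl

end Six

end GeodesicSurface

namespace GeodesicSurface

/-! ### Degree eight -/

section Eight

/-- `H_8` as a permutation group on the 42 vertices of a surface. -/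
def modelEight : Gen → Equiv.Perm (Fin 42)
  | .a => Function.Involutive.toPerm ![1, 0, 2, 3, 5, 4, 7, 6, 10, 12, 8, 14, 9, 16, 11, 19, 13,
      17, 21, 15, 20, 18, 24, 26, 22, 29, 23, 31, 32, 25, 34, 27, 28, 36, 30, 35, 33, 37, 38, 39,
      41, 40] (by unfold Function.Involutive; decide +kernel)
  | .b => Function.Involutive.toPerm ![0, 2, 1, 4, 3, 5, 8, 9, 6, 7, 12, 15, 10, 17, 18, 11, 16,
      13, 14, 21, 23, 19, 25, 20, 28, 22, 26, 27, 24, 32, 30, 35, 29, 37, 38, 31, 36, 33, 34, 40,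
      39, 41] (by unfold Function.Involutive; decide +kernel)
  | .c => Function.Involutive.toPerm ![0, 1, 3, 2, 6, 7, 4, 5, 11, 13, 14, 8, 16, 9, 10, 15, 12,
      20, 22, 19, 17, 24, 18, 27, 21, 30, 31, 23, 33, 34, 25, 26, 36, 28, 29, 38, 32, 39, 35, 37,
      40, 41] (by unfold Function.Involutive; decide +kernel)

theorem isModel_eight : IsModel 8 modelEight where
  three_le := by norm_num
  relation := by decide +kernel
  ne_one g := by cases g <;> decide +kernel
  ab_ne_one := by decide +kernel
  ac_ne_one := by decide +kernel
  bc_pow_ne_one := by decide +kernel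

instance : Finite (H 8) := card_H_8_le.1

theorem injective_and_card_eight : Function.Injective isModel_eight.hom ∧ Nat.card (H 8) = 672 :=
  isModel_eight.injective_and_card
    (isModel_eight.dvd_card_range (by decide) (by decide) (by decide +kernel)) card_H_8_le

/-- Two words have the same value in `H_8` if they induce the same permutation of the vertices. -/
theorem word_eight_eq {l l' : List Gen}
    (h : (l.map modelEight).prod = (l'.map modelEight).prod) : word 8 l = word 8 l' :=
  isModel_eight.word_eq injective_and_card_eight.1 h

/-- A word for the central involution of `H_8`: the product of `b` and a conjugate of
`(bc) ^ 4`. -/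
def centralWordEight : List Gen :=
  .b :: ([.a, .c, .b, .c, .b, .c, .b, .a] ++ (List.replicate 4 [Gen.b, .c]).flatten ++
    [.a, .b, .c, .b, .c, .b, .c, .a])

/-- The central involution of `H_8`. -/
def centralEight : H 8 := word 8 centralWordEight

theorem centralEight_commute (h : H 8) : Commute centralEight h := by
  have hh : h ∈ Subgroup.closure (Set.range (gen 8)) := closure_range_gen ▸ Subgroup.mem_top h
  refine Subgroup.closure_le (K := Subgroup.centralizer {centralEight}) |>.2 ?_ hh _ rfl
  rintro _ ⟨g, rfl⟩
  rw [SetLike.mem_coe, Subgroup.mem_centralizer_singleton_iff]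
  have h1 : word 8 (g :: centralWordEight) = word 8 (centralWordEight ++ [g]) := by
    refine word_eight_eq ?_
    cases g <;> decide +kernel
  rwa [word_cons, word_append, word_cons, word_nil, mul_one] at h1

theorem centralEight_conj (g : H 8) : g * centralEight * g⁻¹ = centralEight := by
  rw [← (centralEight_commute g).eq, mul_inv_cancel_right]

theorem centralEight_mul_self : centralEight * centralEight = 1 := by
  rw [centralEight, ← word_append]
  exact word_eight_eq (l' := []) (by decide +kernel)

theorem orderOf_centralEight : orderOf centralEight = 2 :=
  orderOf_eq_prime (by rw [pow_two, centralEight_mul_self])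
    (isModel_eight.word_ne (l' := []) (by decide +kernel))

theorem sharp_centralEight : sharp 8 centralEight = centralEight := by
  rw [centralEight, sharp_word]
  exact word_eight_eq (by decide +kernel)

theorem mem_zpowers_centralEight {x : H 8} (hx : x ∈ Subgroup.zpowers centralEight) :
    x = 1 ∨ x = centralEight := by
  obtain ⟨k, rfl⟩ := hx
  have h2 : centralEight ^ (2 : ℤ) = 1 :=
    (zpow_ofNat centralEight 2).trans (by rw [pow_two, centralEight_mul_self])
  obtain ⟨m, rfl | rfl⟩ := Int.even_or_odd' k
  · left
    simp only [zpow_mul, h2, one_zpow]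
  · right
    simp only [zpow_add, zpow_mul, h2, one_zpow, one_mul, zpow_one]

theorem centralEight_notMem_zpowers {x : H 8} (hx : x ∈ testElements 8) :
    centralEight ∉ Subgroup.zpowers x :=
  isModel_eight.word_notMem_zpowers hx (by decide +kernel)

/-- Multiplication by the central involution carries `b`, `c` and `(bc) ^ 4` to conjugates of
`(bc) ^ 4`, `ac` and `a`. -/
theorem mul_centralEight_conj :
    (∃ g, genB 8 * centralEight = g * (genB 8 * genC 8) ^ 4 * g⁻¹) ∧
    (∃ g, genC 8 * centralEight = g * (genA 8 * genC 8) * g⁻¹) ∧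
    (∃ g, (genB 8 * genC 8) ^ 4 * centralEight = g * genA 8 * g⁻¹) := by
  have hbc : (genB 8 * genC 8) ^ 4 = word 8 (List.replicate 4 [Gen.b, .c]).flatten := by
    rw [word_flatten_replicate]; simp [word, gen_b, gen_c]
  have hac : genA 8 * genC 8 = word 8 [.a, .c] := by simp [word, gen_a, gen_c]
  have ha : genA 8 = word 8 [.a] := by simp [word, gen_a]
  have hb : genB 8 = word 8 [.b] := by simp [word, gen_b]
  have hc : genC 8 = word 8 [.c] := by simp [word, gen_c]
  refine ⟨⟨word 8 [.a, .c, .b, .c, .b, .c, .b, .a], ?_⟩,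
    ⟨word 8 [.b, .a, .c, .b, .a, .c, .b, .c, .b, .c, .b], ?_⟩,
    ⟨word 8 [.a, .b, .c, .b, .c, .b, .c, .b], ?_⟩⟩
  · rw [hbc, hb, centralEight, ← word_reverse, ← word_append, ← word_append, ← word_append]
    exact word_eight_eq (by decide +kernel)
  · rw [hac, hc, centralEight, ← word_reverse, ← word_append, ← word_append, ← word_append]
    exact word_eight_eq (by decide +kernel)
  · rw [hbc, ha, centralEight, ← word_reverse, ← word_append, ← word_append, ← word_append]
    exact word_eight_eq (by decide +kernel)

instance normal_zpowers_centralEight : (Subgroup.zpowers centralEight).Normal :=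
  normal_zpowers_of_gen fun g => by
    rw [centralEight_conj]; exact Subgroup.mem_zpowers _

theorem centralEight_notMem_closure :
    centralEight ∉ Subgroup.closure {genB 8, genC 8} := by
  have hb : centralEight ≠ genB 8 := by
    have := isModel_eight.word_ne (l := centralWordEight) (l' := [.b]) (by decide +kernel)
    simpa [word, centralEight, gen_b] using this
  have hc : centralEight ≠ genC 8 := by
    have := isModel_eight.word_ne (l := centralWordEight) (l' := [.c]) (by decide +kernel)
    simpa [word, centralEight, gen_c] using this
  have hconj : ∀ {x g : H 8}, centralEight = g * x * g⁻¹ → centralEight = x := by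
    intro x g hx
    have h1 := centralEight_conj g⁻¹
    rw [hx] at h1
    rw [hx, ← h1]
    simp [mul_assoc]
  intro h
  obtain ⟨k, hk | hk⟩ :=
    (DihedralGroup.mem_closure_involutions_iff genB_mul_self genC_mul_self).1 h
  · exact centralEight_notMem_zpowers (x := genB 8 * genC 8) (by simp [testElements])
      ⟨k, hk.symm⟩
  · obtain ⟨t, ht | ht⟩ := DihedralGroup.reflection_conj (genB_mul_self (d := 8)) genC_mul_self k
    · exact hb (hconj (hk.trans ht))
    · exact hc (hconj (hk.trans ht))

/-- A Sylow 2-subgroup of `H_8`: the direct product of `⟨b, c⟩` and the centre. -/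
def sylowEight : Subgroup (H 8) :=
  Subgroup.closure {genB 8, genC 8} ⊔ Subgroup.zpowers centralEight

theorem card_sylowEight : Nat.card sylowEight = 32 := by
  let D : Subgroup (H 8) := Subgroup.closure {genB 8, genC 8}
  let Z : Subgroup (H 8) := Subgroup.zpowers centralEight
  have hcomm : ∀ (x : D) (y : Z), Commute (D.subtype x) (Z.subtype y) := by
    rintro x ⟨_, k, rfl⟩
    exact ((centralEight_commute _).zpow_left k).symm
  have hinj : Function.Injective (MonoidHom.noncommCoprod D.subtype Z.subtype hcomm) := by
    rw [MonoidHom.noncommCoprod_injective]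
    refine ⟨D.subtype_injective, Z.subtype_injective, ?_⟩
    rw [D.range_subtype, Z.range_subtype, Subgroup.disjoint_def]
    intro x hx hz
    rcases mem_zpowers_centralEight hz with h | h
    · exact h
    · exact absurd (h ▸ hx) centralEight_notMem_closure
  have hrange : (MonoidHom.noncommCoprod D.subtype Z.subtype hcomm).range = sylowEight := by
    rw [MonoidHom.noncommCoprod_range, D.range_subtype, Z.range_subtype]
    rfl
  rw [← hrange, ← Nat.card_congr (MonoidHom.ofInjective hinj).toEquiv, Nat.card_prod,
    isModel_eight.hasFullOrders.card_closure_bc, Nat.card_zpowers, orderOf_centralEight]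

/-- The elements of the Sylow 2-subgroup, apart from the central involution, are avoided. -/
theorem Avoids.mem_sylowEight {W : Subgroup (H 8)} (hW : Avoids W) {y g : H 8}
    (hy : y ∈ sylowEight) (hg : g * y * g⁻¹ ∈ W) : y = 1 ∨ y = centralEight := by
  have ho := isModel_eight.hasFullOrders
  obtain ⟨r, hr, t, ht, rfl⟩ := Subgroup.mem_sup_of_normal_right.1 hy
  rcases mem_zpowers_centralEight ht with rfl | rfl
  · rw [mul_one] at hg ⊢
    exact .inl (hW.eq_one_of_mem_closure_bc ho hr hg)
  right
  obtain ⟨⟨u, hu⟩, ⟨v, hv⟩, ⟨w, hw⟩⟩ := mul_centralEight_conj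
  have hconj : ∀ s x : H 8, s * x * s⁻¹ * centralEight = s * (x * centralEight) * s⁻¹ := by
    intro s x
    rw [mul_assoc, ← (centralEight_commute s⁻¹).eq]
    simp only [mul_assoc]
  have htwice : ∀ s t x : H 8, s * (t * x * t⁻¹) * s⁻¹ = (s * t) * x * (s * t)⁻¹ := by
    intro s t x
    rw [mul_inv_rev]
    simp only [mul_assoc]
  obtain ⟨k, rfl | rfl⟩ :=
    (DihedralGroup.mem_closure_involutions_iff genB_mul_self genC_mul_self).1 hr
  · -- the square of a rotation times the centre is a rotation
    have hsq : g * (genB 8 * genC 8) ^ (2 * k) * g⁻¹ ∈ W := by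
      have h1 := mul_mem hg hg
      rw [conj_mul, (centralEight_commute _).mul_mul_mul_comm, centralEight_mul_self,
        mul_one, ← zpow_add, ← two_mul] at h1
      exact h1
    have h2 := hW (genB 8 * genC 8) (by simp [testElements]) g (2 * k) hsq
    rw [← orderOf_dvd_iff_zpow_eq_one, ho.orderOf_bc] at h2
    obtain ⟨m, rfl⟩ : (4 : ℤ) ∣ k := by omega
    have h8 : (genB 8 * genC 8) ^ (8 : ℤ) = 1 := genBC_pow (d := 8)
    obtain ⟨j, rfl | rfl⟩ := Int.even_or_odd' m
    · rw [show 4 * (2 * j) = 8 * j by ring, zpow_mul, h8, one_zpow, one_mul]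
    · exfalso
      rw [show 4 * (2 * j + 1) = 8 * j + 4 by ring, zpow_add, zpow_mul, h8, one_zpow, one_mul,
        show (genB 8 * genC 8) ^ (4 : ℤ) = (genB 8 * genC 8) ^ 4 from rfl, hw, htwice] at hg
      exact hW.conj_genA_notMem ho _ hg
  · exfalso
    obtain ⟨t, ht | ht⟩ := DihedralGroup.reflection_conj (genB_mul_self (d := 8)) genC_mul_self k
    · rw [ht, hconj, hu, htwice, htwice] at hg
      have h1 := hW (genB 8 * genC 8) (by simp [testElements]) _ 4 hg
      rw [← orderOf_dvd_iff_zpow_eq_one, ho.orderOf_bc] at h1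
      omega
    · rw [ht, hconj, hv, htwice, htwice] at hg
      have h1 := hW.eq_one_of_zpow (x := genA 8 * genC 8) (by simp [testElements])
        (Subgroup.mem_zpowers _) hg
      have h2 := ho.orderOf_ac
      rw [h1, orderOf_one] at h2
      omega

theorem factorization_card_eight : (Nat.card (H 8)).factorization 2 = 5 ∧
    (Nat.card (H 8)).factorization 3 = 1 ∧ (Nat.card (H 8)).factorization 7 = 1 := by
  have h := injective_and_card_eight.2
  exact ⟨factorization_eq_of_eq_mul (m := 21) Nat.prime_two h (by norm_num),
    factorization_eq_of_eq_mul (m := 224) Nat.prime_three h (by norm_num),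
    factorization_eq_of_eq_mul (m := 96) (by norm_num) h (by norm_num)⟩

theorem Avoids.le_of_isPGroup {W Q : Subgroup (H 8)} (hW : Avoids W) (hQW : Q ≤ W)
    (hQ : IsPGroup 2 Q) : Q ≤ Subgroup.zpowers centralEight := by
  obtain ⟨g, hg⟩ := hQ.exists_conj_mem (K := sylowEight) (by
    rw [card_sylowEight, factorization_card_eight.1]; rfl)
  intro x hx
  have h1 : g⁻¹ * (g * x * g⁻¹) * g⁻¹⁻¹ = x := by simp [mul_assoc]
  rcases hW.mem_sylowEight (g := g⁻¹) (hg x hx) (h1.symm ▸ hQW hx) with h | h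
  · rw [conj_eq_one_iff] at h
    rw [h]
    exact one_mem _
  · rw [← h1, h, centralEight_conj]
    exact Subgroup.mem_zpowers _

theorem Avoids.card_mem_eight {W : Subgroup (H 8)} (hW : Avoids W) :
    Nat.card W ∈ ({1, 2, 7, 14} : Finset ℕ) := by
  have ho := isModel_eight.hasFullOrders
  have h3 := hW.not_dvd_card_of_test (x := genA 8 * genB 8) (by simp [testElements])
    Nat.prime_three (by rw [factorization_card_eight.2.1, ho.orderOf_ab, pow_one])
  have h4 : ¬ 4 ∣ Nat.card W := by
    intro hdvd
    obtain ⟨Q, hQ⟩ := Sylow.exists_subgroup_card_pow_prime (G := W) 2 (n := 2) hdvd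
    have h1 : Nat.card (Q.map W.subtype) = 2 ^ 2 := by
      rw [Subgroup.card_map_of_injective W.subtype_injective, hQ]
    have h2 := Subgroup.card_dvd_of_le
      (hW.le_of_isPGroup (Subgroup.map_subtype_le Q) (IsPGroup.of_card h1))
    rw [h1, Nat.card_zpowers, orderOf_centralEight] at h2
    omega
  have hdvd : Nat.card W ∣ 3 ^ 1 * 224 :=
    (show Nat.card (H 8) = 3 ^ 1 * 224 from injective_and_card_eight.2) ▸
      W.card_subgroup_dvd_card
  have hmem : Nat.card W ∈ Nat.divisors 224 :=
    Nat.mem_divisors.2 ⟨dvd_of_dvd_pow_mul Nat.prime_three hdvd h3, by norm_num⟩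
  have hall : ∀ n ∈ Nat.divisors 224, ¬ 4 ∣ n → n ∈ ({1, 2, 7, 14} : Finset ℕ) := by
    decide +kernel
  exact hall _ hmem h4

theorem Avoids.centralEight_mem {W : Subgroup (H 8)} (hW : Avoids W) (h2 : 2 ∣ Nat.card W) :
    centralEight ∈ W := by
  obtain ⟨⟨x, hxW⟩, hx⟩ := exists_prime_orderOf_dvd_card' (G := W) 2 h2
  rw [Subgroup.orderOf_mk] at hx
  have hle := hW.le_of_isPGroup (Subgroup.zpowers_le.2 hxW)
    (IsPGroup.of_card (n := 1) (by rw [Nat.card_zpowers, hx, pow_one]))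
  rcases mem_zpowers_centralEight (hle (Subgroup.mem_zpowers x)) with h | h
  · rw [h, orderOf_one] at hx
    omega
  · exact h ▸ hxW

/-- Subgroups whose order divides `14` avoid the test elements: these have no conjugate that is the
central involution. -/
theorem avoids_of_unique_involution {V : Subgroup (H 8)} (hcard : Nat.card V ∣ 14)
    (hV : ∀ y ∈ V, y ^ 2 = 1 → y = 1 ∨ y = centralEight) : Avoids V := by
  have ho := isModel_eight.hasFullOrders
  intro x hx g k hk
  have h14 : (x ^ k) ^ 14 = 1 := by
    have h1 : (g * x ^ k * g⁻¹) ^ 14 = 1 := orderOf_dvd_iff_pow_eq_one.1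
      (((Subgroup.orderOf_mk (H := V) _ hk) ▸
        orderOf_dvd_natCard (⟨_, hk⟩ : V)).trans hcard)
    rwa [conj_pow, conj_eq_one_iff] at h1
  have h48 : (x ^ k) ^ 48 = 1 := by
    rw [← zpow_natCast, zpow_comm, zpow_natCast,
      orderOf_dvd_iff_pow_eq_one.1 (ho.orderOf_dvd hx), one_zpow]
  have h2 : (x ^ k) ^ 2 = 1 := orderOf_dvd_iff_pow_eq_one.1
    (Nat.dvd_gcd (orderOf_dvd_of_pow_eq_one h14) (orderOf_dvd_of_pow_eq_one h48))
  rcases hV _ hk (by rw [conj_pow, h2, mul_one, mul_inv_cancel]) with h | h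
  · rwa [conj_eq_one_iff] at h
  · refine absurd ⟨k, ?_⟩ (centralEight_notMem_zpowers hx)
    have h3 : x ^ k = g⁻¹ * (g * x ^ k * g⁻¹) * g⁻¹⁻¹ := by simp [mul_assoc]
    rw [h, centralEight_conj] at h3
    exact h3

/-- An element of order seven in `H_8`. -/
theorem exists_orderOf_eq_seven : ∃ y : H 8, orderOf y = 7 ∧ Nat.card (Subgroup.zpowers y) = 7 :=
  exists_subgroup_card_eq (by norm_num) (by rw [injective_and_card_eight.2]; norm_num)

section Order

variable {y : H 8}

theorem orderOf_mul_centralEight (hy : orderOf y = 7) : orderOf (y * centralEight) = 14 := by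
  have h := (centralEight_commute y).symm.orderOf_mul_eq_mul_orderOf_of_coprime
    (by rw [hy, orderOf_centralEight]; norm_num)
  rw [h, hy, orderOf_centralEight]

theorem mul_centralEight_pow_seven (hy : orderOf y = 7) :
    (y * centralEight) ^ 7 = centralEight := by
  rw [(centralEight_commute y).symm.mul_pow, ← hy, pow_orderOf_eq_one, one_mul, hy,
    show 7 = 2 * 3 + 1 from rfl, pow_succ, pow_mul, pow_two, centralEight_mul_self, one_pow,
    one_mul]

theorem centralEight_mem_fourteen (hy : orderOf y = 7) :
    centralEight ∈ Subgroup.zpowers (y * centralEight) := by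
  have h := pow_mem (Subgroup.mem_zpowers (y * centralEight)) 7
  rwa [mul_centralEight_pow_seven hy] at h

theorem card_fourteen (hy : orderOf y = 7) :
    Nat.card (Subgroup.zpowers (y * centralEight)) = 14 := by
  rw [Nat.card_zpowers, orderOf_mul_centralEight hy]

theorem avoids_fourteen (hy : orderOf y = 7) :
    Avoids (Subgroup.zpowers (y * centralEight)) := by
  refine avoids_of_unique_involution (card_fourteen hy).dvd ?_
  rintro _ ⟨k, rfl⟩ hk
  have h1 : (y * centralEight) ^ (k * 2) = 1 := by
    rw [zpow_mul]; exact hk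
  rw [← orderOf_dvd_iff_zpow_eq_one, orderOf_mul_centralEight hy] at h1
  obtain ⟨m, rfl⟩ : (7 : ℤ) ∣ k := by omega
  refine mem_zpowers_centralEight ⟨m, ?_⟩
  change centralEight ^ m = (y * centralEight) ^ (7 * m)
  rw [zpow_mul, show (y * centralEight) ^ (7 : ℤ) = (y * centralEight) ^ 7 from rfl,
    mul_centralEight_pow_seven hy]

/-- Up to conjugacy there is only one subgroup of order `14` that contains the centre. -/
theorem areConjugate_fourteen (hy : orderOf y = 7) {W : Subgroup (H 8)} (hW : Nat.card W = 14)
    (hz : centralEight ∈ W) : AreConjugate W (Subgroup.zpowers (y * centralEight)) := by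
  have h7 : Nat.Prime 7 := by norm_num
  have := Fact.mk h7
  obtain ⟨⟨x, hxW⟩, hx⟩ := exists_prime_orderOf_dvd_card' (G := W) 7 (by rw [hW]; norm_num)
  rw [Subgroup.orderOf_mk] at hx
  obtain ⟨g, hg⟩ := areConjugate_of_sylow (V := Subgroup.zpowers x) (W := Subgroup.zpowers y) h7
    (by rw [factorization_card_eight.2.2, Nat.card_zpowers, hx, pow_one])
    (by rw [factorization_card_eight.2.2, Nat.card_zpowers, hy, pow_one])
  refine ⟨g, (Subgroup.eq_of_le_of_card_ge (Subgroup.zpowers_le.2 ?_) ?_).symm⟩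
  · have h1 : y ∈ conjugate g (Subgroup.zpowers x) := hg ▸ Subgroup.mem_zpowers y
    refine mul_mem (Subgroup.map_mono (Subgroup.zpowers_le.2 hxW) h1) ?_
    rw [mem_conjugate]
    have h2 := centralEight_conj g⁻¹
    rw [inv_inv] at h2
    rwa [h2]
  · rw [card_conjugate, hW, card_fourteen hy]

theorem areConjugate_sharp_fourteen (hy : orderOf y = 7) :
    AreConjugate ((Subgroup.zpowers (y * centralEight)).map (sharp 8))
      (Subgroup.zpowers (y * centralEight)) := by
  refine areConjugate_fourteen hy (by rw [card_map_sharp, card_fourteen hy]) ?_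
  rw [mem_map_sharp, sharp_centralEight]
  exact centralEight_mem_fourteen hy

theorem areConjugate_seven (hy : orderOf y = 7) {W : Subgroup (H 8)} (hW : Nat.card W = 7) :
    AreConjugate W (Subgroup.zpowers y) :=
  areConjugate_of_sylow (p := 7) (by norm_num) (by rw [factorization_card_eight.2.2, hW, pow_one])
    (by rw [factorization_card_eight.2.2, Nat.card_zpowers, hy, pow_one])

theorem avoids_seven (hy : orderOf y = 7) : Avoids (Subgroup.zpowers y) :=
  avoids_of_coprime isModel_eight.hasFullOrders (by rw [Nat.card_zpowers, hy]; norm_num)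

theorem avoids_zpowers_centralEight : Avoids (Subgroup.zpowers centralEight) :=
  avoids_of_unique_involution (by rw [Nat.card_zpowers, orderOf_centralEight]; norm_num)
    fun _ hy _ => mem_zpowers_centralEight hy

theorem isClassification_eight (hy : orderOf y = 7) :
    IsClassification.{u} 8 ![⊥, Subgroup.zpowers centralEight, Subgroup.zpowers y,
      Subgroup.zpowers (y * centralEight)] := by
  have h14 := orderOf_mul_centralEight hy
  refine isClassification_of_subgroups isModel_eight.hasFullOrders ?_ ?_ ?_ fun W hW => ?_
  · simp only [Fin.forall_fin_succ]
    exact ⟨avoids_bot, avoids_zpowers_centralEight, avoids_seven hy, avoids_fourteen hy,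
      fun i => i.elim0⟩
  · simp only [Fin.forall_fin_succ]
    refine ⟨areConjugate_sharp_bot, .of_eq ?_, areConjugate_seven hy ?_,
      areConjugate_sharp_fourteen hy, fun i => i.elim0⟩
    · change (Subgroup.zpowers centralEight).map (sharp 8) = Subgroup.zpowers centralEight
      rw [MonoidHom.map_zpowers, sharp_centralEight]
    · change Nat.card ((Subgroup.zpowers y).map (sharp 8)) = 7
      rw [card_map_sharp, Nat.card_zpowers, hy]
  · intro i j hij
    fin_cases i <;> fin_cases j <;> simp_all [orderOf_centralEight]
  · have hWa := (isGeodesicSurfaceSubgroup_iff.1 hW).1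
    have hcard := hWa.card_mem_eight
    simp only [Finset.mem_insert, Finset.mem_singleton] at hcard
    rcases hcard with h | h | h | h
    · exact ⟨0, .of_eq (eq_bot_of_card_eq_one h)⟩
    · refine ⟨1, .of_eq (Subgroup.eq_of_le_of_card_ge
        (Subgroup.zpowers_le.2 (hWa.centralEight_mem (by rw [h]))) ?_).symm⟩
      rw [h, Nat.card_zpowers, orderOf_centralEight]
    · exact ⟨2, areConjugate_seven hy h⟩
    · exact ⟨3, areConjugate_fourteen hy h (hWa.centralEight_mem (by rw [h]; norm_num))⟩

end Order

end Eight

end GeodesicSurface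

namespace GeodesicSurface

/-! ### Degree nine -/

section Nine

/-- `H_9` as a permutation group on twenty points: the projective special linear group on the
projective line over the field with 19 elements. -/
def modelNine : Gen → Equiv.Perm (Fin 20)
  | .a => Function.Involutive.toPerm
      ![5, 8, 19, 15, 18, 0, 10, 16, 1, 12, 6, 14, 9, 17, 11, 3, 7, 13, 4, 2]
      (by unfold Function.Involutive; decide +kernel)
  | .b => Function.Involutive.toPerm
      ![5, 13, 15, 9, 11, 0, 17, 18, 10, 3, 8, 4, 19, 1, 16, 2, 14, 6, 7, 12]
      (by unfold Function.Involutive; decide +kernel)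
  | .c => Function.Involutive.toPerm
      ![3, 17, 6, 0, 11, 15, 2, 12, 13, 16, 19, 4, 7, 8, 18, 5, 9, 1, 14, 10]
      (by unfold Function.Involutive; decide +kernel)

theorem isModel_nine : IsModel 9 modelNine where
  three_le := by norm_num
  relation := by decide +kernel
  ne_one g := by cases g <;> decide +kernel
  ab_ne_one := by decide +kernel
  ac_ne_one := by decide +kernel
  bc_pow_ne_one := by decide +kernel

instance : Finite (H 9) := card_H_9_le.1

/-- A word of order five in `H_9`. -/
def wordFive : List Gen := [.a, .b, .c, .b, .c, .b, .c, .b, .c]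

/-- A word of order nineteen in `H_9`. -/
def wordNineteen : List Gen := [.a, .b, .a, .c, .b, .c, .b, .a, .c, .b, .c, .b, .c, .b, .c]

theorem orderOf_model_nineteen : orderOf ((wordNineteen.map modelNine).prod) = 19 :=
  have : Fact (Nat.Prime 19) := ⟨by norm_num⟩
  orderOf_eq_prime (by decide +kernel) (by decide +kernel)

theorem injective_and_card_nine :
    Function.Injective isModel_nine.hom ∧ Nat.card (H 9) = 3420 := by
  refine isModel_nine.injective_and_card ?_ card_H_9_le
  let R := isModel_nine.hom.range
  have hgen : ∀ g, modelNine g ∈ R := fun g => ⟨gen 9 g, isModel_nine.hom_gen g⟩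
  have hword : ∀ l : List Gen, (l.map modelNine).prod ∈ R := fun l =>
    ⟨word 9 l, isModel_nine.hom_word l⟩
  have h4 : 4 ∣ Nat.card R := by
    have h1 : Nat.card (Subgroup.closure {modelNine .a, modelNine .c}) = 4 := by
      rw [DihedralGroup.card_closure_of_orderOf (isModel_nine.orderOf_gen _)
        (isModel_nine.orderOf_gen _), isModel_nine.orderOf_ac]
    rw [← h1]
    refine Subgroup.card_dvd_of_le ((Subgroup.closure_le _).2 ?_)
    rintro _ (rfl | rfl)
    exacts [hgen _, hgen _]
  have h9 : 9 ∣ Nat.card R :=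
    isModel_nine.orderOf_bc ▸ R.orderOf_dvd_natCard (mul_mem (hgen .b) (hgen .c))
  have h5 : 5 ∣ Nat.card R := by
    have : Fact (Nat.Prime 5) := ⟨Nat.prime_five⟩
    have h1 : orderOf ((wordFive.map modelNine).prod) = 5 :=
      orderOf_eq_prime (by decide +kernel) (by decide +kernel)
    exact h1 ▸ R.orderOf_dvd_natCard (hword wordFive)
  have h19 : 19 ∣ Nat.card R :=
    orderOf_model_nineteen ▸ R.orderOf_dvd_natCard (hword wordNineteen)
  change 4 * 9 * 5 * 19 ∣ Nat.card R
  exact Nat.Coprime.mul_dvd_of_dvd_of_dvd (by norm_num) (Nat.Coprime.mul_dvd_of_dvd_of_dvd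
    (by norm_num) (Nat.Coprime.mul_dvd_of_dvd_of_dvd (by norm_num) h4 h9) h5) h19

theorem factorization_card_nine : (Nat.card (H 9)).factorization 2 = 2 ∧
    (Nat.card (H 9)).factorization 3 = 2 ∧ (Nat.card (H 9)).factorization 5 = 1 ∧
    (Nat.card (H 9)).factorization 19 = 1 := by
  have h := injective_and_card_nine.2
  exact ⟨factorization_eq_of_eq_mul (m := 855) Nat.prime_two h (by norm_num),
    factorization_eq_of_eq_mul (m := 380) Nat.prime_three h (by norm_num),
    factorization_eq_of_eq_mul (m := 684) Nat.prime_five h (by norm_num),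
    factorization_eq_of_eq_mul (m := 180) (by norm_num) h (by norm_num)⟩

/-- In the action on the projective line an element of order `19` has a single fixed point, which
`a` moves. -/
theorem not_normal_of_card_nineteen {P : Subgroup (H 9)} (hP : Nat.card P = 19) : ¬ P.Normal := by
  intro hn
  let y : H 9 := word 9 wordNineteen
  have hy : orderOf y = 19 := by
    rw [← orderOf_injective isModel_nine.hom injective_and_card_nine.1, isModel_nine.hom_word,
      orderOf_model_nineteen]
  obtain ⟨g, hg⟩ := areConjugate_of_sylow (V := P) (W := Subgroup.zpowers y) (p := 19)
    (by norm_num) (by rw [factorization_card_nine.2.2.2, hP, pow_one])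
    (by rw [factorization_card_nine.2.2.2, Nat.card_zpowers, hy, pow_one])
  have hPy : P = Subgroup.zpowers y := by
    rw [← hg]
    ext x
    rw [mem_conjugate]
    refine ⟨fun h => ?_, fun h => ?_⟩
    · simpa using hn.conj_mem x h g⁻¹
    · simpa [mul_assoc] using hn.conj_mem _ h g
  have hfix : ∀ x ∈ Subgroup.zpowers y, isModel_nine.hom x 10 = 10 := by
    have h1 : isModel_nine.hom y 10 = 10 := by
      rw [isModel_nine.hom_word]
      decide +kernel
    rintro _ ⟨k, rfl⟩
    change isModel_nine.hom (y ^ k) 10 = 10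
    rw [map_zpow]
    exact Equiv.Perm.zpow_apply_eq_self_of_apply_eq_self h1 k
  have h2 := hfix _ (hPy ▸ hn.conj_mem y (hPy ▸ Subgroup.mem_zpowers y) (genA 9))
  rw [inv_eq_of_mul_eq_one_right genA_mul_self, show genA 9 = word 9 [.a] by simp [word, gen_a],
    ← word_append, ← word_append, isModel_nine.hom_word] at h2
  revert h2
  decide +kernel

/-- A subgroup of order `95` would normalize a Sylow `19`-subgroup, and then the number of Sylow
`19`-subgroups would divide `36`, so that there would be only one. -/
theorem card_ne_ninety_five (W : Subgroup (H 9)) : Nat.card W ≠ 95 := by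
  intro hW
  have h19 : Nat.Prime 19 := by norm_num
  have := Fact.mk h19
  obtain ⟨⟨x, hxW⟩, hx⟩ := exists_prime_orderOf_dvd_card' (G := W) 19 (by rw [hW]; norm_num)
  rw [Subgroup.orderOf_mk] at hx
  have hcard : Nat.card (Subgroup.zpowers x) = 19 := by rw [Nat.card_zpowers, hx]
  let P : Sylow 19 (H 9) := Sylow.ofCard (Subgroup.zpowers x)
    (by rw [factorization_card_nine.2.2.2, hcard, pow_one])
  have hPW : (P : Subgroup (H 9)) ≤ W := Subgroup.zpowers_le.2 hxW
  have hPcard : Nat.card P = 19 := hcard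
  -- by Sylow's theorem a group of order `95` has only one subgroup of order `19`
  have hsub : Nat.card (Sylow 19 W) = 1 := by
    have h1 := (P.subtype hPW).card_dvd_index
    have h2 := card_sylow_modEq_one 19 W
    have h3 := (P.subtype hPW).card_mul_index
    have h4 : Nat.card (P.subtype hPW) = 19 := by
      rw [Sylow.card_eq_multiplicity, hW]
      rw [factorization_eq_of_eq_mul (k := 1) (m := 5) h19 (by norm_num) (by norm_num), pow_one]
    rw [h4, hW] at h3
    have h5 : (P.subtype hPW : Subgroup W).index = 5 := by omega
    rw [h5] at h1
    have h6 := Nat.le_of_dvd (by norm_num) h1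
    rw [Nat.ModEq] at h2
    omega
  have : Subsingleton (Sylow 19 W) := (Nat.card_eq_one_iff_unique.1 hsub).1
  have hnormal : (P.subtype hPW : Subgroup W).Normal := (P.subtype hPW).normal_of_subsingleton
  rw [Sylow.coe_subtype, Subgroup.normal_subgroupOf_iff_le_normalizer hPW] at hnormal
  -- so its normalizer has an index that divides `36` and is `1` modulo `19`, hence equals `1`
  have hindex : (Subgroup.normalizer ((P : Subgroup (H 9)) : Set (H 9))).index = 1 := by
    have h1 := Subgroup.index_dvd_of_le hnormal
    have h2 := W.card_mul_index
    rw [hW, injective_and_card_nine.2] at h2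
    have h3 : W.index = 36 := by omega
    have h4 := card_sylow_modEq_one 19 (H 9)
    rw [P.card_eq_index_normalizer] at h4
    rw [h3] at h1
    have h5 := Nat.le_of_dvd (by norm_num) h1
    change (Subgroup.normalizer ((P : Subgroup (H 9)) : Set (H 9))).index % 19 = 1 % 19 at h4
    generalize (Subgroup.normalizer ((P : Subgroup (H 9)) : Set (H 9))).index = n at *
    obtain h | h : n = 1 ∨ n = 20 := by omega
    · exact h
    · rw [h] at h1
      omega
  exact not_normal_of_card_nineteen hPcard
    (Subgroup.normalizer_eq_top_iff.1 (Subgroup.index_eq_one.1 hindex))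

theorem Avoids.card_mem_nine {W : Subgroup (H 9)} (hW : Avoids W) :
    Nat.card W = 1 ∨ Nat.card W = 5 ∨ Nat.card W = 19 := by
  have ho := isModel_nine.hasFullOrders
  have h2 := hW.not_two_dvd_card ho factorization_card_nine.1
  have h3 := hW.not_dvd_card_of_test (x := genB 9 * genC 9) (by simp [testElements])
    Nat.prime_three (by rw [factorization_card_nine.2.1, ho.orderOf_bc]; rfl)
  have hdvd : Nat.card W ∣ 2 ^ 2 * (3 ^ 2 * 95) :=
    (show Nat.card (H 9) = 2 ^ 2 * (3 ^ 2 * 95) from injective_and_card_nine.2) ▸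
      W.card_subgroup_dvd_card
  have hmem : Nat.card W ∈ Nat.divisors 95 := Nat.mem_divisors.2
    ⟨dvd_of_dvd_pow_mul Nat.prime_three (dvd_of_dvd_pow_mul Nat.prime_two hdvd h2) h3,
      by norm_num⟩
  have hall : ∀ n ∈ Nat.divisors 95, n = 1 ∨ n = 5 ∨ n = 19 ∨ n = 95 := by decide +kernel
  rcases hall _ hmem with h | h | h | h
  · exact .inl h
  · exact .inr (.inl h)
  · exact .inr (.inr h)
  · exact absurd h (card_ne_ninety_five W)

theorem exists_subgroup_nine {p : ℕ} (hp : p = 5 ∨ p = 19) :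
    ∃ V : Subgroup (H 9), Nat.card V = p := by
  have hp' : p.Prime ∧ p ∣ Nat.card (H 9) := by
    rw [injective_and_card_nine.2]
    rcases hp with rfl | rfl <;> norm_num
  obtain ⟨y, -, hy⟩ := exists_subgroup_card_eq hp'.1 hp'.2
  exact ⟨_, hy⟩

theorem areConjugate_nine {p : ℕ} (hp : p = 5 ∨ p = 19) {V W : Subgroup (H 9)}
    (hV : Nat.card V = p) (hW : Nat.card W = p) : AreConjugate V W := by
  rcases hp with rfl | rfl
  · exact areConjugate_of_sylow Nat.prime_five
      (by rw [factorization_card_nine.2.2.1, hV, pow_one])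
      (by rw [factorization_card_nine.2.2.1, hW, pow_one])
  · exact areConjugate_of_sylow (p := 19) (by norm_num)
      (by rw [factorization_card_nine.2.2.2, hV, pow_one])
      (by rw [factorization_card_nine.2.2.2, hW, pow_one])

theorem avoids_nine {p : ℕ} (hp : p = 5 ∨ p = 19) {V : Subgroup (H 9)} (hV : Nat.card V = p) :
    Avoids V :=
  avoids_of_coprime isModel_nine.hasFullOrders (by rw [hV]; rcases hp with rfl | rfl <;> norm_num)

theorem isClassification_nine {V₅ V₁₉ : Subgroup (H 9)} (h5 : Nat.card V₅ = 5)
    (h19 : Nat.card V₁₉ = 19) : IsClassification.{u} 9 ![⊥, V₅, V₁₉] := by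
  refine isClassification_of_subgroups isModel_nine.hasFullOrders ?_ ?_ ?_ fun W hW => ?_
  · simp only [Fin.forall_fin_succ]
    exact ⟨avoids_bot, avoids_nine (.inl rfl) h5, avoids_nine (.inr rfl) h19, fun i => i.elim0⟩
  · simp only [Fin.forall_fin_succ]
    exact ⟨areConjugate_sharp_bot, areConjugate_nine (.inl rfl) ((card_map_sharp _).trans h5) h5,
      areConjugate_nine (.inr rfl) ((card_map_sharp _).trans h19) h19, fun i => i.elim0⟩
  · intro i j hij
    fin_cases i <;> fin_cases j <;> simp_all
  · rcases (isGeodesicSurfaceSubgroup_iff.1 hW).1.card_mem_nine with h | h | h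
    · exact ⟨0, .of_eq (eq_bot_of_card_eq_one h)⟩
    · exact ⟨1, areConjugate_nine (.inl rfl) h h5⟩
    · exact ⟨2, areConjugate_nine (.inr rfl) h h19⟩

end Nine

/-! ### Indices and genera -/

theorem index_eq_of_card {d m n : ℕ} [Finite (H d)] {V : Subgroup (H d)} (hV : Nat.card V = m)
    (hH : Nat.card (H d) = m * n) : V.index = n :=
  card_coset_mul V hV hH

theorem FlagSystem.HasGenus.of_isOrientable {F : Type u} {S : FlagSystem F} {g : ℤ}
    (h : S.IsOrientable) (hg : S.eulerChar = 2 - 2 * g) : S.HasGenus g :=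
  ⟨fun _ => hg, fun h' => absurd h h'⟩

theorem FlagSystem.HasGenus.of_not_isOrientable {F : Type u} {S : FlagSystem F} {g : ℤ}
    (h : ¬ S.IsOrientable) (hg : S.eulerChar = 1 - g) : S.HasGenus g :=
  ⟨fun h' => absurd h' h, fun _ => hg⟩

end GeodesicSurface

/-- The complete list of geodesic self-dual degree-`d`-surfaces for `3 ≤ d < 10`. -/
theorem mainTheorem10 :
    -- there are none for `d = 3, 4, 7`
    (∀ d : ℕ, d = 3 ∨ d = 4 ∨ d = 7 → ∀ (F : Type u) (S : FlagSystem F),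
      S.IsDegreeSurface d → ¬ S.IsGeodesicSelfDual) ∧
    -- `d = 5`: one surface
    (IsClassification.{u} 5 ![⊥] ∧
      (cosetSystem (⊥ : Subgroup (H 5))).HasCounts 6 15 10 ∧
      (cosetSystem (⊥ : Subgroup (H 5))).IsProjectivePlane) ∧
    -- `d = 6`: two surfaces
    (∃ N : Subgroup (H 6), IsClassification.{u} 6 ![⊥, N] ∧
      ((cosetSystem (⊥ : Subgroup (H 6))).HasCounts 9 27 18 ∧
        (cosetSystem (⊥ : Subgroup (H 6))).IsTorus) ∧
      (N.Normal ∧ Nat.card N = 3 ∧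
        (cosetSystem N).HasCounts 3 9 6 ∧ (cosetSystem N).IsTorus)) ∧
    -- `d = 8`: four surfaces
    (∃ V₂ V₇ V₁₄ : Subgroup (H 8), IsClassification.{u} 8 ![⊥, V₂, V₇, V₁₄] ∧
      ((cosetSystem (⊥ : Subgroup (H 8))).IsOrientable ∧
        (cosetSystem (⊥ : Subgroup (H 8))).HasCounts 42 168 112 ∧
        (cosetSystem (⊥ : Subgroup (H 8))).HasGenus 8) ∧
      (V₂.Normal ∧ Nat.card V₂ = 2 ∧ ¬ (cosetSystem V₂).IsOrientable ∧
        (cosetSystem V₂).HasCounts 21 84 56 ∧ (cosetSystem V₂).HasGenus 8) ∧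
      (Nat.card V₇ = 7 ∧ V₇.index = 96 ∧ (cosetSystem V₇).IsOrientable ∧
        (cosetSystem V₇).HasCounts 6 24 16 ∧ (cosetSystem V₇).HasGenus 2) ∧
      (Nat.card V₁₄ = 14 ∧ V₁₄.index = 48 ∧ ¬ (cosetSystem V₁₄).IsOrientable ∧
        (cosetSystem V₁₄).HasCounts 3 12 8 ∧ (cosetSystem V₁₄).HasGenus 2)) ∧
    -- `d = 9`: three surfaces
    (∃ V₅ V₁₉ : Subgroup (H 9), IsClassification.{u} 9 ![⊥, V₅, V₁₉] ∧
      (¬ (cosetSystem (⊥ : Subgroup (H 9))).IsOrientable ∧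
        (cosetSystem (⊥ : Subgroup (H 9))).HasCounts 190 855 570 ∧
        (cosetSystem (⊥ : Subgroup (H 9))).HasGenus 96) ∧
      (Nat.card V₅ = 5 ∧ V₅.index = 684 ∧ ¬ (cosetSystem V₅).IsOrientable ∧
        (cosetSystem V₅).HasCounts 38 171 114 ∧ (cosetSystem V₅).HasGenus 20) ∧
      (Nat.card V₁₉ = 19 ∧ V₁₉.index = 180 ∧ ¬ (cosetSystem V₁₉).IsOrientable ∧
        (cosetSystem V₁₉).HasCounts 10 45 30 ∧ (cosetSystem V₁₉).HasGenus 6)) := by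
  refine ⟨?_, ?_, ?_, ?_, ?_⟩
  · rintro d hd F S hS
    have hcard : Finite (H d) ∧ Nat.card (H d) ≤ 2 * d * 1 := by
      rcases hd with rfl | rfl | rfl
      exacts [card_H_3_le, card_H_4_le, card_H_7_le]
    exact not_isGeodesicSelfDual_of_card hcard hd hS
  · exact ⟨isClassification_five, hasCounts_five, not_isOrientable_of_odd (by decide) _,
      hasCounts_five.eulerChar_eq⟩
  · refine ⟨normalSix, isClassification_six, ⟨hasCounts_six, ?_, hasCounts_six.eulerChar_eq⟩,
      normalSix_normal, card_normalSix, hasCounts_normalSix, ?_, hasCounts_normalSix.eulerChar_eq⟩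
    · exact isOrientable_of_odd_card (by decide) (by rw [Subgroup.card_bot]; decide)
    · exact isOrientable_of_odd_card (by decide) (by rw [card_normalSix]; decide)
  · obtain ⟨y, hy, hcard⟩ := exists_orderOf_eq_seven
    have ho := isModel_eight.hasFullOrders
    have hH := injective_and_card_eight.2
    have hcentral : Nat.card (Subgroup.zpowers centralEight) = 2 := by
      rw [Nat.card_zpowers, orderOf_centralEight]
    have h1 : (cosetSystem (⊥ : Subgroup (H 8))).HasCounts 42 168 112 :=
      ho.hasCounts avoids_bot (n := 672) (card_coset_mul _ Subgroup.card_bot hH) rfl rfl rfl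
    have h2 : (cosetSystem (Subgroup.zpowers centralEight)).HasCounts 21 84 56 :=
      ho.hasCounts avoids_zpowers_centralEight (n := 336) (card_coset_mul _ hcentral hH)
        rfl rfl rfl
    have h7 : (cosetSystem (Subgroup.zpowers y)).HasCounts 6 24 16 :=
      ho.hasCounts (avoids_seven hy) (n := 96) (card_coset_mul _ hcard hH) rfl rfl rfl
    have h14 : (cosetSystem (Subgroup.zpowers (y * centralEight))).HasCounts 3 12 8 :=
      ho.hasCounts (avoids_fourteen hy) (n := 48) (card_coset_mul _ (card_fourteen hy) hH)
        rfl rfl rfl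
    have o1 : (cosetSystem (⊥ : Subgroup (H 8))).IsOrientable :=
      isOrientable_of_odd_card (by decide) (by rw [Subgroup.card_bot]; decide)
    have o7 : (cosetSystem (Subgroup.zpowers y)).IsOrientable :=
      isOrientable_of_odd_card (by decide) (by rw [hcard]; decide)
    -- the central involution is a product of an odd number of generators
    have hodd : ∀ {V : Subgroup (H 8)}, centralEight ∈ V → ¬ (cosetSystem V).IsOrientable :=
      fun hV => not_isOrientable_of_odd_word centralWordEight (by decide) hV
    have o2 := hodd (Subgroup.mem_zpowers centralEight)
    have o14 := hodd (centralEight_mem_fourteen hy)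
    exact ⟨_, _, _, isClassification_eight hy,
      ⟨o1, h1, .of_isOrientable o1 h1.eulerChar_eq⟩,
      ⟨normal_zpowers_centralEight, hcentral, o2, h2, .of_not_isOrientable o2 h2.eulerChar_eq⟩,
      ⟨hcard, index_eq_of_card hcard hH, o7, h7, .of_isOrientable o7 h7.eulerChar_eq⟩,
      ⟨card_fourteen hy, index_eq_of_card (card_fourteen hy) hH, o14, h14,
        .of_not_isOrientable o14 h14.eulerChar_eq⟩⟩
  · obtain ⟨V₅, hV₅⟩ := exists_subgroup_nine (.inl rfl)
    obtain ⟨V₁₉, hV₁₉⟩ := exists_subgroup_nine (.inr rfl)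
    have ho := isModel_nine.hasFullOrders
    have hH := injective_and_card_nine.2
    have h1 : (cosetSystem (⊥ : Subgroup (H 9))).HasCounts 190 855 570 :=
      ho.hasCounts avoids_bot (n := 3420) (card_coset_mul _ Subgroup.card_bot hH) rfl rfl rfl
    have h5 : (cosetSystem V₅).HasCounts 38 171 114 :=
      ho.hasCounts (avoids_nine (.inl rfl) hV₅) (n := 684) (card_coset_mul _ hV₅ hH) rfl rfl rfl
    have h19 : (cosetSystem V₁₉).HasCounts 10 45 30 :=
      ho.hasCounts (avoids_nine (.inr rfl) hV₁₉) (n := 180) (card_coset_mul _ hV₁₉ hH)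
        rfl rfl rfl
    have o : ∀ V : Subgroup (H 9), ¬ (cosetSystem V).IsOrientable :=
      not_isOrientable_of_odd (by decide)
    exact ⟨V₅, V₁₉, isClassification_nine hV₅ hV₁₉,
      ⟨o _, h1, .of_not_isOrientable (o _) h1.eulerChar_eq⟩,
      ⟨hV₅, index_eq_of_card hV₅ hH, o _, h5, .of_not_isOrientable (o _) h5.eulerChar_eq⟩,
      ⟨hV₁₉, index_eq_of_card hV₁₉ hH, o _, h19,
        .of_not_isOrientable (o _) h19.eulerChar_eq⟩⟩
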